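/- Work over $\mathbb{C}$. Let $\mathcal{Q}$ be the set of pairs $(F;n_1,n_2,n_3)$, where $F$ is a quartic form in four variables and $n_1,n_2,n_3\in\mathbb{C}^4\setminus\{0\}$ represent three distinct points of $\mathbb{P}^3$ which are nodes (ordinary double points) of the surface $B_0=\{F=0\}$ and are its only singular points. Let $\mathcal{T}$ be the set of pairs $(G;p)$, where $G$ is a form of multidegree $(2,2,2)$ on $\mathbb{P}^1\times\mathbb{P}^1\times\mathbb{P}^1$ and $p\in(\mathbb{C}^2\setminus\{0\})^3$ represents a point which is a node of $B_\circ=\{G=0\}$ and is its only singular point. Both sets carry the Zariski topology given by the coefficients of the form and the coordinates of the points. Write $V_0=\{w^2=F\}\to\mathbb{P}^3$ and $V_\circ=\{w^2=G\}\to\mathbb{P}^1\times\mathbb{P}^1\times\mathbb{P}^1$ for the double covers branched over $B_0$ and $B_\circ$. If $n_1,n_2,n_3$ are not collinear, choose for each $i$ a basis $\ell_i=(\ell_{i0},\ell_{i1})$ of the linear forms vanishing at the two points $n_j$, $j\ne i$ (the pencil of planes through these two nodes). Say that $(F;n_1,n_2,n_3)$ and $(G;p)$ correspond to each other by $\ell=(\ell_1,\ell_2,\ell_3)$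 if * the map $\varphi:\mathbb{P}^3\dashrightarrow\mathbb{P}^1\times\mathbb{P}^1\times\mathbb{P}^1$, $x\mapsto([\ell_{i0}(x):\ell_{i1}(x)])_{i=1,2,3}$, is birational; * $\varphi$ induces a birational map $B_0\dashrightarrow B_\circ$; * there is a birational map $V_0\dashrightarrow V_\circ$ lying over $\varphi$; * the node of $B_\circ$ is the point $([\ell_{i0}(n_i):\ell_{i1}(n_i)])_{i=1,2,3}$, whose $i$th entry is the member of the $i$th pencil given by the plane through the three nodes. **Lemma.** There are dense Zariski-open subsets $U\subset\mathcal{Q}$ and $U'\subset\mathcal{T}$, with $U\neq\emptyset$, such that 1. for every $(F;n_1,n_2,n_3)\in U$ the points $n_1,n_2,n_3$ are not collinear, and for every choice of the bases $\ell$ there is $(G;p)\in U'$ such that $(F;n_1,n_2,n_3)$ and $(G;p)$ correspond to each other by $\ell$; 2. conversely, for every $(G;p)\in U'$ there are $(F;n_1,n_2,n_3)\in U$ and a choice of the bases $\ell$ such that $(F;n_1,n_2,n_3)$ and $(G;p)$ correspond to each other by $\ell$. In particular, a generic double solid over $\mathbb{P}^3$ branched in a quartic surface with three nodes is birational to a double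 cover of $\mathbb{P}^1\times\mathbb{P}^1\times\mathbb{P}^1$ branched over a nodal $(2,2,2)$ surface, and a generic double cover of the latter kind is birational to a double solid of the former kind. -/

import Mathlib

/-! ### Genericity: dense open subsets for the Zariski topology -/

/-- Let the set `S` be embedded in an affine space by the coordinates `c`.
`U` is a dense open subset of `S` for the Zariski topology:  `U` is the complement in `S` of the
common zeros of a set `I` of polynomials in the coordinates, and every polynomial that vanishes
on `U` vanishes on `S`. -/
def IsZariskiDenseOpenIn {α κ : Type} (c : α → κ → ℂ) (S U : Set α) : Prop :=
  (∃ I : Set (MvPolynomial κ ℂ), U = {a ∈ S | ∃ f ∈ I, MvPolynomial.eval (c a) f ≠ 0}) ∧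
  ∀ f : MvPolynomial κ ℂ, (∀ a ∈ U, MvPolynomial.eval (c a) f = 0) →
    ∀ a ∈ S, MvPolynomial.eval (c a) f = 0

/-! ### Varieties in homogeneous coordinates -/

/-- A (classical) complex variety described by homogeneous coordinates: the coordinates are
indexed by `σ`, the coordinate `s` has multidegree `wt s`, and the points of the variety are the
vectors of `cone`, up to the action of the torus `(ℂˣ)^ι` with these weights. -/
structure HomVariety where
  /-- index set of the homogeneous coordinates -/
  σ : Type
  /-- index set of the factors of the torus -/
  ι : Type
  [fintypeι : Fintype ι]
  /-- multidegrees of the coordinates -/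
  wt : σ → ι → ℕ
  /-- the homogeneous coordinate vectors of the points -/
  cone : Set (σ → ℂ)

namespace HomVariety

attribute [instance] HomVariety.fintypeι

/-- Two coordinate vectors give the same point if they differ by the torus action. -/
def SamePoint (X : HomVariety) (a b : X.cone) : Prop :=
  ∃ t : X.ι → ℂˣ, ∀ s, b.1 s = (∏ i, (t i : ℂ) ^ X.wt s i) * a.1 s

theorem samePoint_equivalence (X : HomVariety) : Equivalence X.SamePoint where
  refl a := ⟨fun _ => 1, fun s => by simp⟩
  symm := by
    rintro a b ⟨t, ht⟩
    refine ⟨fun i => (t i)⁻¹, fun s => ?_⟩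
    have h : (∏ i, (t i : ℂ) ^ X.wt s i) ≠ 0 :=
      Finset.prod_ne_zero_iff.2 fun i _ => pow_ne_zero _ (t i).ne_zero
    rw [ht s]
    simp only [Units.val_inv_eq_inv_val, inv_pow, Finset.prod_inv_distrib]
    rw [inv_mul_cancel_left₀ h]
  trans := by
    rintro a b c ⟨t, ht⟩ ⟨u, hu⟩
    refine ⟨fun i => u i * t i, fun s => ?_⟩
    rw [hu s, ht s]
    simp only [Units.val_mul, mul_pow, Finset.prod_mul_distrib]
    ring

/-- The set of points of the variety. -/
def Points (X : HomVariety) : Type :=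
  Quotient (⟨X.SamePoint, X.samePoint_equivalence⟩ : Setoid X.cone)

/-- The point with given homogeneous coordinates. -/
def point (X : HomVariety) (a : X.cone) : X.Points := Quotient.mk _ a

/-- The basic open set of points at which the multihomogeneous polynomial `P` does not vanish. -/
def basicOpen (X : HomVariety) (P : MvPolynomial X.σ ℂ) : Set X.Points :=
  {x | ∃ a : X.cone, X.point a = x ∧ MvPolynomial.eval a.1 P ≠ 0}

/-- The Zariski topology: its closed sets are the zero loci of sets of multihomogeneous
polynomials. -/
instance (X : HomVariety) : TopologicalSpace X.Points :=
  TopologicalSpace.generateFrom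
    {V | ∃ (P : MvPolynomial X.σ ℂ) (d : X.ι → ℕ),
      MvPolynomial.IsWeightedHomogeneous X.wt P d ∧ V = X.basicOpen P}

/-- `f` is a regular function on `U`: near each point of `U` it is a quotient of multihomogeneous
polynomials of the same multidegree with nonvanishing denominator. -/
def IsRegularOn (X : HomVariety) (U : Set X.Points) (f : X.Points → ℂ) : Prop :=
  ∀ a : X.cone, X.point a ∈ U → ∃ (P Q : MvPolynomial X.σ ℂ) (d : X.ι → ℕ),
    MvPolynomial.IsWeightedHomogeneous X.wt P d ∧ MvPolynomial.IsWeightedHomogeneous X.wt Q d ∧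
    MvPolynomial.eval a.1 Q ≠ 0 ∧
    ∀ b : X.cone, X.point b ∈ U → MvPolynomial.eval b.1 Q ≠ 0 →
      f (X.point b) = MvPolynomial.eval b.1 P / MvPolynomial.eval b.1 Q

/-- A homeomorphism `e` between an open subset of `X` and an open subset of `Y` is a birational
map from `X` to `Y` if the two open subsets are dense and `e` is an isomorphism of varieties
between them, that is, `e` and its inverse pull regular functions back to regular functions. -/
structure IsBirational {X Y : HomVariety} (e : OpenPartialHomeomorph X.Points Y.Points) :
    Prop where
  dense_source : Dense e.source
  dense_target : Dense e.target
  pullback : ∀ V ⊆ e.target, IsOpen V → ∀ f : Y.Points → ℂ, Y.IsRegularOn V f →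
    X.IsRegularOn (e.source ∩ e ⁻¹' V) (fun x => f (e x))
  pullback_symm : ∀ V ⊆ e.source, IsOpen V → ∀ f : X.Points → ℂ, X.IsRegularOn V f →
    Y.IsRegularOn (e.target ∩ e.symm ⁻¹' V) (fun y => f (e.symm y))

end HomVariety

/-! ### Projective space, quartic surfaces and quartic double solids -/

/-- The projective space `ℙ³`. -/
def P3 : HomVariety where
  σ := Fin 4
  ι := Unit
  wt := fun _ _ => 1
  cone := {x | x ≠ 0}

/-- The surface `F = 0` in `ℙ³`. -/
def quarticSurface (F : MvPolynomial (Fin 4) ℂ) : HomVariety where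
  σ := Fin 4
  ι := Unit
  wt := fun _ _ => 1
  cone := {x | x ≠ 0 ∧ MvPolynomial.eval x F = 0}

/-- The double cover `w² = F` of `ℙ³` branched over the quartic surface `F = 0`, in the weighted
projective space `ℙ(1,1,1,1,2)`; the coordinate `w` has the index `none`. -/
def doubleSolid (F : MvPolynomial (Fin 4) ℂ) : HomVariety where
  σ := Option (Fin 4)
  ι := Unit
  wt := fun s _ => s.elim 2 fun _ => 1
  cone := {v | (fun j => v (some j)) ≠ 0 ∧ v none ^ 2 = MvPolynomial.eval (fun j => v (some j)) F}

/-- The inclusion of the surface `F = 0` in `ℙ³`. -/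
def quarticSurfaceIncl (F : MvPolynomial (Fin 4) ℂ) : (quarticSurface F).Points → P3.Points :=
  Quotient.map (fun a => ⟨a.1, a.2.1⟩) fun _ _ ⟨t, ht⟩ => ⟨t, ht⟩

/-- The covering map from the double solid `w² = F` to `ℙ³`. -/
def doubleSolidProj (F : MvPolynomial (Fin 4) ℂ) : (doubleSolid F).Points → P3.Points :=
  Quotient.map (fun a => ⟨fun j => a.1 (some j), a.2.1⟩) fun _ _ ⟨t, ht⟩ => ⟨t, fun s => ht (some s)⟩

/-! ### The product of three projective lines, `(2,2,2)` surfaces and their double covers -/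

/-- The multidegree of the coordinate `k` on the factor `i` of `ℙ¹ × ℙ¹ × ℙ¹`. -/
def wt222 (s : Fin 3 × Fin 2) (i : Fin 3) : ℕ := if s.1 = i then 1 else 0

/-- The homogeneous coordinate vectors of the points of `ℙ¹ × ℙ¹ × ℙ¹`. -/
def cone222 : Set (Fin 3 × Fin 2 → ℂ) := {u | ∀ i, (fun k => u (i, k)) ≠ 0}

/-- The product `ℙ¹ × ℙ¹ × ℙ¹`. -/
def P1P1P1 : HomVariety where
  σ := Fin 3 × Fin 2
  ι := Fin 3
  wt := wt222
  cone := cone222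

/-- The surface `G = 0` in `ℙ¹ × ℙ¹ × ℙ¹`. -/
def surface222 (G : MvPolynomial (Fin 3 × Fin 2) ℂ) : HomVariety where
  σ := Fin 3 × Fin 2
  ι := Fin 3
  wt := wt222
  cone := {u | u ∈ cone222 ∧ MvPolynomial.eval u G = 0}

/-- The double cover `w² = G` of `ℙ¹ × ℙ¹ × ℙ¹` branched over the `(2,2,2)` surface `G = 0`;
the coordinate `w`, of multidegree `(1,1,1)`, has the index `none`. -/
def doubleCover222 (G : MvPolynomial (Fin 3 × Fin 2) ℂ) : HomVariety where
  σ := Option (Fin 3 × Fin 2)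
  ι := Fin 3
  wt := fun s => s.elim (fun _ => 1) wt222
  cone := {v | (fun s => v (some s)) ∈ cone222 ∧
    v none ^ 2 = MvPolynomial.eval (fun s => v (some s)) G}

/-- The inclusion of the surface `G = 0` in `ℙ¹ × ℙ¹ × ℙ¹`. -/
def surface222Incl (G : MvPolynomial (Fin 3 × Fin 2) ℂ) :
    (surface222 G).Points → P1P1P1.Points :=
  Quotient.map (fun a => ⟨a.1, a.2.1⟩) fun _ _ ⟨t, ht⟩ => ⟨t, ht⟩

/-- The covering map from `w² = G` to `ℙ¹ × ℙ¹ × ℙ¹`. -/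
def doubleCover222Proj (G : MvPolynomial (Fin 3 × Fin 2) ℂ) :
    (doubleCover222 G).Points → P1P1P1.Points :=
  Quotient.map (fun a => ⟨fun s => a.1 (some s), a.2.1⟩)
    fun _ _ ⟨t, ht⟩ => ⟨t, fun s => ht (some s)⟩

/-! ### Nodes -/

/-- All partial derivatives of the equation `P` vanish at `a`. For a (multi)homogeneous equation
of positive degree this says that `a` is a singular point of the hypersurface `P = 0`, by Euler's
relation. -/
def IsSingularAt {σ : Type} (P : MvPolynomial σ ℂ) (a : σ → ℂ) : Prop :=
  ∀ s, MvPolynomial.eval a (MvPolynomial.pderiv s P) = 0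

/-- The matrix of second derivatives. -/
noncomputable def hessianAt {σ : Type} (P : MvPolynomial σ ℂ) (a : σ → ℂ) : Matrix σ σ ℂ :=
  Matrix.of fun s t => MvPolynomial.eval a (MvPolynomial.pderiv s (MvPolynomial.pderiv t P))

/-- The point `a` is a node (ordinary double point) of the surface `P = 0` in `ℙ³` or
`ℙ¹ × ℙ¹ × ℙ¹`: it is a singular point at which the quadratic part of a local equation in the
ambient threefold is nondegenerate. In homogeneous coordinates the kernel of the Hessian at a
singular point contains the tangent space of the torus orbit of `a`, and the Hessian of the local
equation is the form it induces on the three-dimensional quotient; so it is nondegenerate exactly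
when the rank is `3`. -/
def IsNode {σ : Type} [Fintype σ] (P : MvPolynomial σ ℂ) (a : σ → ℂ) : Prop :=
  IsSingularAt P a ∧ (hessianAt P a).rank = 3

/-- Quartic forms `F`, together with an ordered triple of coordinate vectors `n` of points. -/
abbrev QuarticData : Type := MvPolynomial (Fin 4) ℂ × (Fin 3 → Fin 4 → ℂ)

/-- The affine coordinates of `(F, n)`: the coefficients of `F` and the entries of `n`. -/
def quarticCoords (x : QuarticData) : (Fin 4 →₀ ℕ) ⊕ (Fin 3 × Fin 4) → ℂ :=
  Sum.elim (fun m => MvPolynomial.coeff m x.1) (fun s => x.2 s.1 s.2)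

/-- The parameter space of quartic surfaces with three nodes: `F` is a quartic form and
`n 0, n 1, n 2` are three distinct points of `ℙ³`, which are nodes of `F = 0`, and there are no
other singular points. -/
def threeNodalQuartics : Set QuarticData :=
  {x | x.1.IsHomogeneous 4 ∧ (∀ i, x.2 i ≠ 0) ∧
    (∀ i j, i ≠ j → ∀ t : ℂ, x.2 i ≠ t • x.2 j) ∧
    (∀ i, IsNode x.1 (x.2 i)) ∧
    ∀ a : Fin 4 → ℂ, a ≠ 0 → IsSingularAt x.1 a → ∃ (i : Fin 3) (t : ℂ), a = t • x.2 i}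

/-- Forms `G` on `ℙ¹ × ℙ¹ × ℙ¹`, together with a coordinate vector `p` of a point. -/
abbrev Data222 : Type := MvPolynomial (Fin 3 × Fin 2) ℂ × (Fin 3 × Fin 2 → ℂ)

/-- The affine coordinates of `(G, p)`: the coefficients of `G` and the entries of `p`. -/
def coords222 (y : Data222) : ((Fin 3 × Fin 2) →₀ ℕ) ⊕ (Fin 3 × Fin 2) → ℂ :=
  Sum.elim (fun m => MvPolynomial.coeff m y.1) y.2

/-- The parameter space of nodal `(2,2,2)` surfaces: `G` is a form of multidegree `(2,2,2)`, and
the point `p` is a node of `G = 0` and its only singular point. -/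
def nodal222 : Set Data222 :=
  {y | MvPolynomial.IsWeightedHomogeneous wt222 y.1 (fun _ => 2) ∧ y.2 ∈ cone222 ∧
    IsNode y.1 y.2 ∧
    ∀ a ∈ cone222, IsSingularAt y.1 a → ∃ t : Fin 3 → ℂ, ∀ i k, a (i, k) = t i * y.2 (i, k)}

/-! ### The correspondence -/

/-- The linear forms `ℓ i 0, ℓ i 1` (given by their coefficients) are linearly independent and
vanish at the two points `n j`, `j ≠ i`. When the three points are not collinear, they span the
pencil of planes through these two points. -/
def ArePencils (n : Fin 3 → Fin 4 → ℂ) (ℓ : Fin 3 → Fin 2 → Fin 4 → ℂ) : Prop :=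
  ∀ i, LinearIndependent ℂ (ℓ i) ∧ ∀ j, j ≠ i → ∀ k, ℓ i k ⬝ᵥ n j = 0

/-- The vector `([ℓ i 0 (x) : ℓ i 1 (x)])_i`. -/
def pencilVector (ℓ : Fin 3 → Fin 2 → Fin 4 → ℂ) (x : Fin 4 → ℂ) : Fin 3 × Fin 2 → ℂ :=
  fun s => ℓ s.1 s.2 ⬝ᵥ x

/-- The quartic form `F` with nodes `n` and the `(2,2,2)` form `G` with node `p` correspond to
each other by the three pencils `ℓ`:

* the map `φ = (ℓ 0, ℓ 1, ℓ 2)` is a birational map from `ℙ³` to `ℙ¹ × ℙ¹ × ℙ¹`;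
* it induces a birational map `β` from `F = 0` to `G = 0`;
* it is covered by a birational map `Φ` from `w² = F` to `w² = G`;
* the node `p` is the point whose `i`th entry is the member through `n i` of the `i`th pencil,
  which is the plane through the three nodes. -/
def Correspond (ℓ : Fin 3 → Fin 2 → Fin 4 → ℂ) (x : QuarticData) (y : Data222) : Prop :=
  (∃ φ : OpenPartialHomeomorph P3.Points P1P1P1.Points,
    HomVariety.IsBirational φ ∧
    (∀ a : P3.cone, P3.point a ∈ φ.source →
      ∃ b : P1P1P1.cone, b.1 = pencilVector ℓ a.1 ∧ φ (P3.point a) = P1P1P1.point b) ∧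
    (∃ β : OpenPartialHomeomorph (quarticSurface x.1).Points (surface222 y.1).Points,
      HomVariety.IsBirational β ∧
      ∀ z ∈ β.source, quarticSurfaceIncl x.1 z ∈ φ.source ∧
        surface222Incl y.1 (β z) = φ (quarticSurfaceIncl x.1 z)) ∧
    (∃ Φ : OpenPartialHomeomorph (doubleSolid x.1).Points (doubleCover222 y.1).Points,
      HomVariety.IsBirational Φ ∧
      ∀ z ∈ Φ.source, doubleSolidProj x.1 z ∈ φ.source ∧
        doubleCover222Proj y.1 (Φ z) = φ (doubleSolidProj x.1 z))) ∧
  ∀ i, ∃ t : ℂ, t ≠ 0 ∧ ∀ k, y.2 (i, k) = t * (ℓ i k ⬝ᵥ x.2 i)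

open MvPolynomial Matrix

open Filter Topology

/-! ### Polynomials under substitution -/

namespace MvPolynomial

/-! Choose coordinates on ℙ³ with the three noncollinear nodes at the last three coordinate points,
and coordinates on each ℙ¹ with the node of the `(2,2,2)` surface at (∞,∞,∞). A quartic is singular
at those three points exactly when it is a combination of the monomials x₀^(4-i-j-k) x₁^i x₂^j x₃^k
with i, j, k ≤ 2 and i + j + k ≤ 4. A `(2,2,2)` form is singular at (∞,∞,∞) exactly when,
dehomogenized, it is a combination of the monomials with the same exponents (`eq_quarticOf`,
`eq_form222Of`). So both kinds of surface are completions of the same affine surface. The three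
pencils are [x₀ : xᵢ], and φ is the identity of the common chart 𝔸³. The identity G(φ(x)) = x₀² F(x)
(`eval_stdMap_form222Of`) carries the map of branch surfaces, and w ↦ x₀ w lifts it to the double
covers. `PencilChart` records these equations without coordinates, and `PencilChart.correspond`
derives the birational maps from them.

Singular points in the common chart agree (`isSingularAt_form222Of_iff`). At infinity, the
nonvanishing of `disc` makes the prescribed points nodes and excludes further singular points on
either side (`eq_smul_stdNodes_of_isSingularAt`, `eq_smul_stdPoint_of_isSingularAt`). Hence the sets
where `disc` is nonzero in some frame, `genericQuartics` and `generic222`, correspond in both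
directions. They are open because determinant times `disc` is, for each choice of the auxiliary
vectors, a polynomial in the parameters.

For density, each point of a parameter space is put on an arc whose other points near it are
generic; a polynomial that vanishes on the generic set then vanishes at the given point by
continuity. The arc stays in the parameter space because having nodes exactly at given moving
singular points is an open condition (`eventually_hasNodesExactlyAt`), by compactness and
nondegeneracy of the Hessian. For `(2,2,2)` forms and for quartics with noncollinear nodes the arc
is a line towards a form with a sample normal form in the same frame.

Quartics with collinear nodes need more: the nodes must first be deformed into general position
(`isDeformable`). One node is moved in a direction v for which the derivative of F along v vanishes
identically on the line of nodes. Such a v exists outside that line by a dimension count, since this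
derivative is a cubic on the line that vanishes at the three nodes already, so that one linear
condition on v suffices. -/

theorem pderiv_bind₁ {σ τ R : Type*} [CommRing R] [Fintype σ] (φ : σ → MvPolynomial τ R)
    (P : MvPolynomial σ R) (j : τ) :
    pderiv j (bind₁ φ P) = ∑ s, bind₁ φ (pderiv s P) * pderiv j (φ s) := by
  classical
  induction P using MvPolynomial.induction_on with
  | C a => simp
  | add p q hp hq => simp only [map_add, hp, hq, add_mul, Finset.sum_add_distrib]
  | mul_X p i hp =>
    simp only [map_mul, pderiv_mul, bind₁_X_right, map_add, hp, add_mul, Finset.sum_add_distrib,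
      pderiv_X, Finset.sum_mul]
    congr 1
    · exact Finset.sum_congr rfl fun s _ => by ring
    · rw [Finset.sum_eq_single i]
      · simp
      · intro b _ hb; simp [hb.symm]
      · simp

theorem pderiv_comm {σ R : Type*} [CommRing R] (i j : σ) (P : MvPolynomial σ R) :
    pderiv i (pderiv j P) = pderiv j (pderiv i P) := by
  classical
  have : ⁅pderiv (R := R) i, pderiv (R := R) j⁆ = 0 := by
    apply MvPolynomial.derivation_ext
    intro k
    simp only [Derivation.commutator_apply, pderiv_X, Pi.single_apply]
    split_ifs <;> simp
  simpa [Derivation.commutator_apply, sub_eq_zero] using congrArg (fun D => D P) this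

theorem eval_bind₁ {σ τ R : Type*} [CommRing R] (φ : σ → MvPolynomial τ R) (P : MvPolynomial σ R)
    (a : τ → R) : eval a (bind₁ φ P) = eval (fun s => eval a (φ s)) P := by
  induction P using MvPolynomial.induction_on with
  | C a => simp
  | add p q hp hq => simp [hp, hq]
  | mul_X p i hp => simp [hp]

theorem IsWeightedHomogeneous.bind₁ {σ τ R M N : Type*} [CommRing R] [AddCommMonoid M]
    [AddCommMonoid N] {w : σ → M} {w' : τ → N} (L : M →+ N) {φ : σ → MvPolynomial τ R}
    (hφ : ∀ s, IsWeightedHomogeneous w' (φ s) (L (w s))) {P : MvPolynomial σ R} {d : M}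
    (hP : IsWeightedHomogeneous w P d) : IsWeightedHomogeneous w' (MvPolynomial.bind₁ φ P) (L d) := by
  rw [P.as_sum, map_sum]
  refine IsWeightedHomogeneous.sum _ _ _ fun m hm => ?_
  rw [bind₁_monomial]
  have hd : L d = 0 + ∑ s ∈ m.support, m s • L (w s) := by
    rw [← hP (mem_support_iff.1 hm), Finsupp.weight_apply, Finsupp.sum, map_sum, zero_add]
    simp
  rw [hd]
  exact (isWeightedHomogeneous_C _ _).mul
    (IsWeightedHomogeneous.prod _ _ _ fun s _ => (hφ s).pow _)

theorem IsWeightedHomogeneous.eval_torus {σ ι R : Type*} [CommRing R] [Fintype ι]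
    {w : σ → ι → ℕ} {P : MvPolynomial σ R} {d : ι → ℕ} (hP : IsWeightedHomogeneous w P d)
    (t : ι → R) (a : σ → R) :
    eval (fun s => (∏ i, t i ^ w s i) * a s) P = (∏ i, t i ^ d i) * eval a P := by
  rw [eval_eq, eval_eq, Finset.mul_sum]
  refine Finset.sum_congr rfl fun m hm => ?_
  have hd : ∀ i, d i = ∑ s ∈ m.support, m s * w s i := fun i => by
    rw [← hP (mem_support_iff.1 hm), Finsupp.weight_apply, Finsupp.sum]
    simp
  simp_rw [hd, mul_pow, Finset.prod_mul_distrib, ← Finset.prod_pow_eq_pow_sum]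
  rw [Finset.prod_comm]
  simp_rw [← Finset.prod_pow, ← pow_mul]
  simp_rw [mul_comm (w _ _)]
  ring

/-- The linear form with given coefficients. -/
noncomputable def linForm {σ R : Type*} [CommRing R] [Fintype σ] (c : σ → R) : MvPolynomial σ R :=
  ∑ s, C (c s) * X s

@[simp] theorem eval_linForm {σ R : Type*} [CommRing R] [Fintype σ] (c a : σ → R) :
    eval a (linForm c) = c ⬝ᵥ a := by
  simp [linForm, dotProduct]

@[simp] theorem pderiv_linForm {σ R : Type*} [CommRing R] [Fintype σ] (c : σ → R) (j : σ) :
    pderiv j (linForm c) = C (c j) := by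
  classical
  simp [linForm, pderiv_X, Pi.single_apply]

theorem isWeightedHomogeneous_linForm {σ R M : Type*} [CommRing R] [Fintype σ] [AddCommMonoid M]
    {w : σ → M} {c : σ → R} {d : M} (h : ∀ s, c s ≠ 0 → w s = d) :
    IsWeightedHomogeneous w (linForm c) d := by
  refine IsWeightedHomogeneous.sum _ _ _ fun s _ => ?_
  by_cases hs : c s = 0
  · simpa [hs] using isWeightedHomogeneous_zero _ _ _
  · rw [← h s hs, ← zero_add (w s)]
    exact (isWeightedHomogeneous_C _ _).mul (isWeightedHomogeneous_X _ _ _)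

/-- The linear change of coordinates: `P.subst g` is `a ↦ P (g a)`. -/
noncomputable def subst {σ R : Type*} [CommRing R] [Fintype σ] (g : Matrix σ σ R) :
    MvPolynomial σ R →ₐ[R] MvPolynomial σ R := MvPolynomial.bind₁ fun s => linForm (g s)

@[simp] theorem eval_subst {σ R : Type*} [CommRing R] [Fintype σ] (g : Matrix σ σ R)
    (P : MvPolynomial σ R) (a : σ → R) : eval a (subst g P) = eval (g *ᵥ a) P := by
  rw [subst, eval_bind₁]
  simp only [eval_linForm]
  rfl

theorem subst_mul {σ R : Type*} [CommRing R] [Fintype σ] (g h : Matrix σ σ R)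
    (P : MvPolynomial σ R) : subst h (subst g P) = subst (g * h) P := by
  rw [subst, subst, subst, bind₁_bind₁]
  congr 2
  funext s
  simp only [linForm, map_sum, map_mul, bind₁_C_right, bind₁_X_right, Matrix.mul_apply,
    Finset.mul_sum, Finset.sum_mul]
  rw [Finset.sum_comm]
  refine Finset.sum_congr rfl fun i _ => Finset.sum_congr rfl fun j _ => by ring

theorem subst_one {σ R : Type*} [CommRing R] [Fintype σ] [DecidableEq σ] (P : MvPolynomial σ R) :
    subst (1 : Matrix σ σ R) P = P := by
  have : (fun s => linForm ((1 : Matrix σ σ R) s)) = X := by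
    funext s
    simp [linForm, Matrix.one_apply]
  rw [subst, this]
  simp

theorem map_subst {σ R S : Type*} [CommRing R] [CommRing S] [Fintype σ] (f : R →+* S)
    (g : Matrix σ σ R) (P : MvPolynomial σ R) :
    map f (subst g P) = subst (g.map f) (map f P) := by
  rw [subst, map_bind₁, subst]
  congr 2
  funext s
  simp [linForm, map_sum]

theorem pderiv_subst {σ R : Type*} [CommRing R] [Fintype σ] (g : Matrix σ σ R)
    (P : MvPolynomial σ R) (j : σ) :
    pderiv j (subst g P) = ∑ s, C (g s j) * subst g (pderiv s P) := by
  rw [subst, pderiv_bind₁]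
  exact Finset.sum_congr rfl fun s _ => by rw [pderiv_linForm, mul_comm]

theorem IsWeightedHomogeneous.subst {σ R M : Type*} [CommRing R] [Fintype σ] [AddCommMonoid M]
    {w : σ → M} {g : Matrix σ σ R} (hg : ∀ s t, g s t ≠ 0 → w t = w s) {P : MvPolynomial σ R}
    {d : M} (hP : IsWeightedHomogeneous w P d) :
    IsWeightedHomogeneous w (MvPolynomial.subst g P) d :=
  hP.bind₁ (AddMonoidHom.id M) fun s => isWeightedHomogeneous_linForm (hg s)

end MvPolynomial

/-! ### Singular points and Hessians -/

/-- By the chain rule the gradient is multiplied by the invertible matrix `gᵀ`. -/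
theorem isSingularAt_subst {σ : Type} [Fintype σ] [DecidableEq σ] {g : Matrix σ σ ℂ}
    (hg : IsUnit g.det) (P : MvPolynomial σ ℂ) (a : σ → ℂ) :
    IsSingularAt (subst g P) a ↔ IsSingularAt P (g *ᵥ a) := by
  have key : (fun j => eval a (pderiv j (subst g P))) =
      gᵀ *ᵥ fun s => eval (g *ᵥ a) (pderiv s P) := by
    funext j
    simp [pderiv_subst, mulVec, dotProduct, Matrix.transpose_apply]
  have hinj : Function.Injective (gᵀ *ᵥ ·) :=
    Matrix.mulVec_injective_of_isUnit ((Matrix.isUnit_iff_isUnit_det _).2 (by simpa using hg))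
  constructor
  · intro h
    have h0 : (fun s => eval (g *ᵥ a) (pderiv s P)) = 0 := by
      apply hinj
      simp only [mulVec_zero]
      rw [← key]
      exact funext h
    exact fun s => congrFun h0 s
  · intro h s
    have h0 : (fun s => eval (g *ᵥ a) (pderiv s P)) = 0 := funext h
    rw [h0, mulVec_zero] at key
    exact congrFun key s

theorem hessianAt_subst {σ : Type} [Fintype σ] (g : Matrix σ σ ℂ) (P : MvPolynomial σ ℂ)
    (a : σ → ℂ) : hessianAt (subst g P) a = gᵀ * hessianAt P (g *ᵥ a) * g := by
  ext i j
  simp only [hessianAt, Matrix.of_apply, pderiv_subst, map_sum, pderiv_C_mul, map_mul, eval_C,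
    eval_subst, Matrix.mul_apply, Matrix.transpose_apply, Finset.mul_sum, Finset.sum_mul]
  refine Finset.sum_congr rfl fun s _ => Finset.sum_congr rfl fun t _ => by ring

/-! ### Multihomogeneous forms on a product of projective spaces

The coordinates `σ` are distributed to the factors `ι` by a map `τ`. -/

/-- The multidegrees of the coordinates of a product of projective spaces. -/
def blockWt {σ ι : Type} [DecidableEq ι] (τ : σ → ι) (s : σ) (i : ι) : ℕ :=
  if τ s = i then 1 else 0

/-- The homogeneous coordinate vectors of the points of a product of projective spaces. -/
def blockCone {σ ι : Type} (τ : σ → ι) : Set (σ → ℂ) := {a | ∀ i, ∃ s, τ s = i ∧ a s ≠ 0}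

/-- The action of the torus on coordinate vectors. -/
def blockScale {σ ι : Type} (τ : σ → ι) (t : ι → ℂ) (a : σ → ℂ) : σ → ℂ := fun s => t (τ s) * a s

theorem prod_blockWt {σ ι : Type} [Fintype ι] [DecidableEq ι] (τ : σ → ι) (t : ι → ℂ) (s : σ) :
    ∏ i, t i ^ blockWt τ s i = t (τ s) := by
  simp [blockWt, pow_ite]

theorem eval_blockScale {σ ι : Type} [Fintype ι] [DecidableEq ι] {τ : σ → ι}
    {P : MvPolynomial σ ℂ} {d : ι → ℕ} (hP : IsWeightedHomogeneous (blockWt τ) P d) (t : ι → ℂ)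
    (a : σ → ℂ) : eval (blockScale τ t a) P = (∏ i, t i ^ d i) * eval a P := by
  rw [← hP.eval_torus t a]
  simp only [prod_blockWt]
  rfl

/-- The condition `d i ≠ 0` makes the truncated subtraction in the new degree exact. -/
theorem isWeightedHomogeneous_pderiv_blockWt {σ ι : Type} [DecidableEq ι] {τ : σ → ι}
    {P : MvPolynomial σ ℂ} {d : ι → ℕ} (hP : IsWeightedHomogeneous (blockWt τ) P d)
    (hd : ∀ i, d i ≠ 0) (s : σ) :
    IsWeightedHomogeneous (blockWt τ) (pderiv s P) (fun i => d i - blockWt τ s i) := by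
  refine hP.pderiv (funext fun i => ?_)
  have := hd i
  simp only [Pi.add_apply, blockWt]
  split_ifs <;> omega

theorem IsSingularAt.blockScale {σ ι : Type} [Fintype ι] [DecidableEq ι] {τ : σ → ι}
    {P : MvPolynomial σ ℂ} {d : ι → ℕ} (hP : IsWeightedHomogeneous (blockWt τ) P d)
    (hd : ∀ i, d i ≠ 0) {a : σ → ℂ} (ha : IsSingularAt P a) (t : ι → ℂ) :
    IsSingularAt P (blockScale τ t a) := fun s => by
  rw [eval_blockScale (isWeightedHomogeneous_pderiv_blockWt hP hd s), ha s, mul_zero]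

/-- Euler's relation on one factor. -/
theorem euler_block {σ ι : Type} [Fintype σ] [DecidableEq ι] {τ : σ → ι}
    {P : MvPolynomial σ ℂ} {d : ι → ℕ} (hP : IsWeightedHomogeneous (blockWt τ) P d) (a : σ → ℂ)
    (i : ι) : ∑ s, (if τ s = i then a s * eval a (pderiv s P) else 0) = d i * eval a P := by
  have h1 : IsWeightedHomogeneous (fun s => blockWt τ s i) P (d i) := by
    intro m hm
    rw [← hP hm, Finsupp.weight_apply, Finsupp.weight_apply, Finsupp.sum, Finsupp.sum]
    simp
  have := congrArg (eval a) h1.sum_weight_X_mul_pderiv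
  simp only [map_sum, map_mul, eval_X, nsmul_eq_mul, map_natCast] at this
  rw [← this]
  refine Finset.sum_congr rfl fun s _ => ?_
  simp only [blockWt]
  split_ifs <;> simp

theorem IsSingularAt.eval_eq_zero {σ ι : Type} [Fintype σ] [DecidableEq ι] {τ : σ → ι}
    {P : MvPolynomial σ ℂ} {d : ι → ℕ} (hP : IsWeightedHomogeneous (blockWt τ) P d) {a : σ → ℂ}
    (ha : IsSingularAt P a) {i : ι} (hi : d i ≠ 0) : eval a P = 0 := by
  have := euler_block hP a i
  simp only [ha _, mul_zero, ite_self, Finset.sum_const_zero] at this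
  exact (mul_eq_zero.1 this.symm).resolve_left (by exact_mod_cast hi)

/-- The kernel of the Hessian consists of tangent vectors to the torus orbit. -/
def IsNondegenerateAt {σ ι : Type} [Fintype σ] (τ : σ → ι) (P : MvPolynomial σ ℂ) (a : σ → ℂ) :
    Prop := ∀ v, hessianAt P a *ᵥ v = 0 → ∃ t, v = blockScale τ t a

/-- Euler's relation in each block, applied to the first derivatives, which themselves vanish at
`a`; the blocks are then weighted by `t`. -/
theorem hessianAt_mulVec_blockScale {σ ι : Type} [Fintype σ] [Fintype ι] [DecidableEq ι]
    {τ : σ → ι} {P : MvPolynomial σ ℂ} {d : ι → ℕ}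
    (hP : IsWeightedHomogeneous (blockWt τ) P d) (hd : ∀ i, d i ≠ 0) {a : σ → ℂ}
    (ha : IsSingularAt P a) (t : ι → ℂ) : hessianAt P a *ᵥ blockScale τ t a = 0 := by
  funext s
  have h := fun i => euler_block (isWeightedHomogeneous_pderiv_blockWt hP hd s) a i
  simp only [ha s, mul_zero] at h
  have h2 : ∑ i, t i * ∑ u, (if τ u = i then a u * eval a (pderiv u (pderiv s P)) else 0) = 0 :=
    Finset.sum_eq_zero fun i _ => by rw [h i, mul_zero]
  simp only [Finset.mul_sum] at h2
  rw [Finset.sum_comm] at h2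
  simp only [mul_ite, mul_zero, Finset.sum_ite_eq, Finset.mem_univ, if_true] at h2
  simp only [mulVec, dotProduct, hessianAt, of_apply, _root_.blockScale, Pi.zero_apply]
  rw [← h2]
  refine Finset.sum_congr rfl fun u _ => ?_
  rw [pderiv_comm s u P]
  ring

/-- The tangent space of the torus orbit lies in the kernel of the Hessian, and its dimension is the
number of blocks because `a` is nonzero in every block. So the rank takes its largest possible value
exactly when the kernel is no bigger. This replaces a rank by a condition that transforms well. -/
theorem rank_hessianAt_iff {σ ι : Type} [Fintype σ] [Fintype ι] [DecidableEq σ] [DecidableEq ι]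
    {τ : σ → ι} {P : MvPolynomial σ ℂ} {d : ι → ℕ}
    (hP : IsWeightedHomogeneous (blockWt τ) P d) (hd : ∀ i, d i ≠ 0) {a : σ → ℂ}
    (hc : a ∈ blockCone τ) (ha : IsSingularAt P a) {r : ℕ}
    (hr : Fintype.card σ = Fintype.card ι + r) :
    (hessianAt P a).rank = r ↔ IsNondegenerateAt τ P a := by
  let T : (ι → ℂ) →ₗ[ℂ] (σ → ℂ) :=
    { toFun := fun t => blockScale τ t a
      map_add' := fun x y => by funext s; simp [_root_.blockScale, add_mul]
      map_smul' := fun x y => by funext s; simp [_root_.blockScale, mul_assoc] }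
  have hT : Function.Injective T := by
    intro x y h
    funext i
    obtain ⟨s, rfl, hs⟩ := hc i
    exact mul_right_cancel₀ hs (congrFun h s)
  have hle : LinearMap.range T ≤ LinearMap.ker (hessianAt P a).mulVecLin := by
    rintro _ ⟨t, rfl⟩
    exact hessianAt_mulVec_blockScale hP hd ha t
  have hf : Module.finrank ℂ (LinearMap.range T) = Fintype.card ι := by
    rw [LinearMap.finrank_range_of_inj hT, Module.finrank_fintype_fun_eq_card]
  have hrk := LinearMap.finrank_range_add_finrank_ker (hessianAt P a).mulVecLin
  rw [Module.finrank_fintype_fun_eq_card] at hrk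
  have hdef : (hessianAt P a).rank =
    Module.finrank ℂ (LinearMap.range (hessianAt P a).mulVecLin) := rfl
  rw [← hdef] at hrk
  constructor
  · intro h v hv
    have : LinearMap.range T = LinearMap.ker (hessianAt P a).mulVecLin :=
      Submodule.eq_of_le_of_finrank_eq hle (by omega)
    have hv' : v ∈ LinearMap.range T := by rw [this]; exact hv
    obtain ⟨t, rfl⟩ := hv'
    exact ⟨t, rfl⟩
  · intro h
    have : LinearMap.range T = LinearMap.ker (hessianAt P a).mulVecLin := by
      refine le_antisymm hle fun v hv => ?_
      obtain ⟨t, rfl⟩ := h v hv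
      exact ⟨t, rfl⟩
    rw [← this] at hrk
    omega

theorem isNode_iff {σ ι : Type} [Fintype σ] [Fintype ι] [DecidableEq σ] [DecidableEq ι]
    {τ : σ → ι} {P : MvPolynomial σ ℂ} {d : ι → ℕ}
    (hP : IsWeightedHomogeneous (blockWt τ) P d) (hd : ∀ i, d i ≠ 0) {a : σ → ℂ}
    (hc : a ∈ blockCone τ) (hr : Fintype.card σ = Fintype.card ι + 3) :
    IsNode P a ↔ IsSingularAt P a ∧ IsNondegenerateAt τ P a :=
  and_congr_right fun ha => rank_hessianAt_iff hP hd hc ha hr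

/-- The singular points of the hypersurface `P = 0` are the points `n j`, and these are nodes. -/
def HasNodesExactlyAt {σ ι J : Type} [Fintype σ] (τ : σ → ι) (P : MvPolynomial σ ℂ)
    (n : J → σ → ℂ) : Prop :=
  (∀ j, IsSingularAt P (n j) ∧ IsNondegenerateAt τ P (n j)) ∧
    ∀ a ∈ blockCone τ, IsSingularAt P a → ∃ j t, a = blockScale τ t (n j)

theorem mulVec_blockScale {σ ι : Type} [Fintype σ] {τ : σ → ι} {g : Matrix σ σ ℂ}
    (hg : ∀ s t, g s t ≠ 0 → τ t = τ s) (t : ι → ℂ) (a : σ → ℂ) :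
    g *ᵥ blockScale τ t a = blockScale τ t (g *ᵥ a) := by
  funext s
  simp only [mulVec, dotProduct, _root_.blockScale, Finset.mul_sum]
  refine Finset.sum_congr rfl fun u _ => ?_
  by_cases h : g s u = 0
  · simp [h]
  · rw [hg s u h]; ring

theorem mulVec_mem_blockCone {σ ι : Type} [Fintype σ] [DecidableEq σ] [DecidableEq ι] {τ : σ → ι}
    {g : Matrix σ σ ℂ} (hu : IsUnit g.det) (hg : ∀ s t, g s t ≠ 0 → τ t = τ s) {a : σ → ℂ}
    (ha : a ∈ blockCone τ) : g *ᵥ a ∈ blockCone τ := by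
  intro i
  by_contra! h
  -- Projection to the block `i` commutes with `g`; if that block of the image vanished, `g` would
  -- kill the block `i` of `a`.
  have h0 : g *ᵥ blockScale τ (Pi.single i 1) a = g *ᵥ 0 := by
    rw [mulVec_blockScale hg, mulVec_zero]
    funext s
    by_cases hs : τ s = i
    · simp [_root_.blockScale, h s hs]
    · simp [_root_.blockScale, hs]
  have h1 := Matrix.mulVec_injective_of_isUnit ((Matrix.isUnit_iff_isUnit_det _).2 hu) h0
  obtain ⟨s, hs, hne⟩ := ha i
  apply hne
  simpa [_root_.blockScale, hs] using congrFun h1 s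

theorem HasNodesExactlyAt.of_subst {σ ι J : Type} [Fintype σ] [DecidableEq σ] [DecidableEq ι]
    {τ : σ → ι} {P : MvPolynomial σ ℂ} {n : J → σ → ℂ} {g : Matrix σ σ ℂ} (hu : IsUnit g.det)
    (hg : ∀ s t, g s t ≠ 0 → τ t = τ s) (hg' : ∀ s t, g⁻¹ s t ≠ 0 → τ t = τ s)
    (h : HasNodesExactlyAt τ (subst g P) n) : HasNodesExactlyAt τ P fun j => g *ᵥ n j := by
  have hgi : ∀ v, g *ᵥ (g⁻¹ *ᵥ v) = v := fun v => by
    rw [mulVec_mulVec, Matrix.mul_nonsing_inv _ hu, one_mulVec]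
  refine ⟨fun j => ⟨(isSingularAt_subst hu P _).1 (h.1 j).1, fun v hv => ?_⟩, fun a ha hs => ?_⟩
  · obtain ⟨t, ht⟩ := (h.1 j).2 (g⁻¹ *ᵥ v) (by
      rw [hessianAt_subst, ← mulVec_mulVec, hgi, ← mulVec_mulVec, hv, mulVec_zero])
    exact ⟨t, by rw [← mulVec_blockScale hg, ← ht, hgi]⟩
  · obtain ⟨j, t, ht⟩ := h.2 (g⁻¹ *ᵥ a)
      (mulVec_mem_blockCone (by simpa [Matrix.det_nonsing_inv] using hu) hg' ha)
      ((isSingularAt_subst hu P _).2 (by rwa [hgi]))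
    exact ⟨j, t, by rw [← mulVec_blockScale hg, ← ht, hgi]⟩

theorem HasNodesExactlyAt.subst {σ ι J : Type} [Fintype σ] [DecidableEq σ] [DecidableEq ι]
    {τ : σ → ι} {P : MvPolynomial σ ℂ} {n : J → σ → ℂ} {g : Matrix σ σ ℂ} (hu : IsUnit g.det)
    (hg : ∀ s t, g s t ≠ 0 → τ t = τ s) (hg' : ∀ s t, g⁻¹ s t ≠ 0 → τ t = τ s)
    (h : HasNodesExactlyAt τ P fun j => g *ᵥ n j) :
    HasNodesExactlyAt τ (MvPolynomial.subst g P) n := by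
  have h1 : HasNodesExactlyAt τ (MvPolynomial.subst g⁻¹ (MvPolynomial.subst g P))
      fun j => g *ᵥ n j := by
    rwa [subst_mul, Matrix.mul_nonsing_inv _ hu, subst_one]
  have h2 := h1.of_subst (by simpa [Matrix.det_nonsing_inv] using hu) hg'
    (by rwa [Matrix.nonsing_inv_nonsing_inv _ hu])
  simpa [mulVec_mulVec, Matrix.nonsing_inv_mul _ hu] using h2

/-! ### Surfaces with prescribed nodes form an open set -/


/-- Hadamard's lemma. The inductive step is b_i p(b) - c_i p(c) = b_i (p(b) - p(c)) + (b_i - c_i)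
p(c). An exact difference quotient, unlike a Taylor estimate, allows two nearby zeros to be compared
by linear algebra. -/
theorem MvPolynomial.exists_difference_quotient {σ : Type} [Fintype σ] (P : MvPolynomial σ ℂ) :
    ∃ M : σ → (σ → ℂ) × (σ → ℂ) → ℂ, (∀ s, Continuous (M s)) ∧
      (∀ b c, eval b P - eval c P = ∑ s, M s (b, c) * (b s - c s)) ∧
      ∀ b s, M s (b, b) = eval b (pderiv s P) := by
  classical
  induction P using MvPolynomial.induction_on with
  | C a => exact ⟨fun _ _ => 0, fun _ => continuous_const, by simp, by simp⟩
  | add p q hp hq =>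
    obtain ⟨M, h1, h2, h3⟩ := hp
    obtain ⟨N, k1, k2, k3⟩ := hq
    refine ⟨fun s z => M s z + N s z, fun s => (h1 s).add (k1 s), fun b c => ?_, fun b s => ?_⟩
    · simp only [map_add, add_mul, Finset.sum_add_distrib, ← h2, ← k2]; ring
    · simp [h3, k3]
  | mul_X p i hp =>
    obtain ⟨M, h1, h2, h3⟩ := hp
    refine ⟨fun s z => z.1 i * M s z + if s = i then eval z.2 p else 0, fun s => ?_,
      fun b c => ?_, fun b s => ?_⟩
    · have hc : Continuous fun z : (σ → ℂ) × (σ → ℂ) => eval z.2 p :=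
        (MvPolynomial.continuous_eval p).comp continuous_snd
      have := h1 s
      by_cases h : s = i
      · simp only [h, if_true]
        exact ((continuous_apply i).comp continuous_fst).mul (h ▸ this) |>.add hc
      · simp only [h, if_false]
        exact ((continuous_apply i).comp continuous_fst).mul this |>.add continuous_const
    · simp only [map_mul, eval_X, add_mul, Finset.sum_add_distrib, mul_assoc, ← Finset.mul_sum,
        ← h2, ite_mul, zero_mul, Finset.sum_ite_eq', Finset.mem_univ, if_true]
      ring
    · simp only [h3, pderiv_mul, pderiv_X, map_add, map_mul, eval_X, Pi.single_apply]
      split_ifs with h <;> simp [mul_comm, eq_comm] <;> grind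

/-- A left inverse of `N x₀`, multiplied with `N x`, has a determinant that is continuous at `x₀`
and equal to 1 there. -/
theorem Matrix.eventually_mulVec_injective {X m n : Type} [TopologicalSpace X] [Fintype m]
    [Fintype n] [DecidableEq n] {N : X → Matrix m n ℂ} {x₀ : X} (hN : ContinuousAt N x₀)
    (h : ∀ v, N x₀ *ᵥ v = 0 → v = 0) : ∀ᶠ x in 𝓝 x₀, ∀ v, N x *ᵥ v = 0 → v = 0 := by
  classical
  obtain ⟨L, hL⟩ := LinearMap.exists_leftInverse_of_injective (N x₀).mulVecLin
    (LinearMap.ker_eq_bot'.2 h)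
  have hL' : LinearMap.toMatrix' L * N x₀ = 1 := by
    have := congrArg LinearMap.toMatrix' hL
    rwa [LinearMap.toMatrix'_comp, ← Matrix.toLin'_apply', LinearMap.toMatrix'_toLin',
      LinearMap.toMatrix'_id] at this
  have hd : ContinuousAt (fun x => (LinearMap.toMatrix' L * N x).det) x₀ := by
    have h2 : Continuous fun A : Matrix m n ℂ => (LinearMap.toMatrix' L * A).det := by fun_prop
    exact h2.continuousAt.comp hN
  have hne : (LinearMap.toMatrix' L * N x₀).det ≠ 0 := by simp [hL']
  filter_upwards [hd.eventually_ne hne] with x hx v hv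
  refine Matrix.eq_zero_of_mulVec_eq_zero hx ?_
  rw [← mulVec_mulVec, hv, mulVec_zero]

/-- The member of a polynomial family of polynomials with the parameter `t`; the parameter is
the variable `none`. -/
noncomputable def specialize {σ : Type} (t : ℂ) (Q : MvPolynomial (Option σ) ℂ) :
    MvPolynomial σ ℂ := bind₁ (fun o => o.elim (C t) X) Q

theorem eval_specialize {σ : Type} (t : ℂ) (Q : MvPolynomial (Option σ) ℂ) (a : σ → ℂ) :
    eval a (specialize t Q) = eval (fun o => o.elim t a) Q := by
  rw [specialize, eval_bind₁]
  congr 2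
  funext o
  cases o <;> simp

theorem pderiv_specialize {σ : Type} [Fintype σ] (t : ℂ) (Q : MvPolynomial (Option σ) ℂ) (s : σ) :
    pderiv s (specialize t Q) = specialize t (pderiv (some s) Q) := by
  classical
  rw [specialize, pderiv_bind₁, Fintype.sum_option]
  simp [pderiv_X, Pi.single_apply, specialize]

/-- Both points are taken in the same member of the family, so the parameter contributes nothing to
the difference. Two singular points of one member thus differ by a kernel vector of a matrix that is
close to a Hessian when the points are close. -/
theorem exists_hessian_quotient {σ : Type} [Fintype σ] (Q : MvPolynomial (Option σ) ℂ) :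
    ∃ M : ℂ × (σ → ℂ) × (σ → ℂ) → Matrix σ σ ℂ, Continuous M ∧
      (∀ t b c, M (t, b, c) *ᵥ (b - c) = fun s => eval b (pderiv s (specialize t Q)) -
        eval c (pderiv s (specialize t Q))) ∧
      ∀ t b, M (t, b, b) = hessianAt (specialize t Q) b := by
  choose N h1 h2 h3 using fun s : σ => (pderiv (some s) Q).exists_difference_quotient
  have hext : Continuous fun z : ℂ × (σ → ℂ) => fun o : Option σ => o.elim z.1 z.2 := by
    refine continuous_pi fun o => ?_
    cases o
    · exact continuous_fst
    · exact (continuous_apply _).comp continuous_snd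
  refine ⟨fun z => of fun s u => N s (some u) (fun o => o.elim z.1 z.2.1, fun o => o.elim z.1 z.2.2),
    ?_, fun t b c => ?_, fun t b => ?_⟩
  · refine continuous_pi fun s => continuous_pi fun u => (h1 s (some u)).comp ?_
    exact (hext.comp (continuous_fst.prodMk continuous_snd.fst)).prodMk
      (hext.comp (continuous_fst.prodMk continuous_snd.snd))
  · funext s
    rw [pderiv_specialize, eval_specialize, eval_specialize, h2, Fintype.sum_option]
    simp [mulVec, dotProduct]
  · ext s u
    simp only [of_apply, h3, hessianAt, pderiv_specialize, eval_specialize]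
    rw [pderiv_comm]

/-- Rescaling the blocks is a diagonal substitution that multiplies `P` by a nonzero constant, so
the condition does not depend on the coordinate vector chosen for the point. -/
theorem IsNondegenerateAt.blockScale {σ ι : Type} [Fintype σ] [Fintype ι] [DecidableEq σ]
    [DecidableEq ι] {τ : σ → ι} {P : MvPolynomial σ ℂ} {d : ι → ℕ}
    (hP : IsWeightedHomogeneous (blockWt τ) P d) {a : σ → ℂ} (ha : IsNondegenerateAt τ P a)
    {c : ι → ℂ} (hc : ∀ i, c i ≠ 0) : IsNondegenerateAt τ P (blockScale τ c a) := by
  have hg : ∀ v, diagonal (fun s => c (τ s)) *ᵥ v = _root_.blockScale τ c v := fun v => by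
    funext s
    simp [mulVec_diagonal, _root_.blockScale]
  have hsub : subst (diagonal fun s => c (τ s)) P = C (∏ i, c i ^ d i) * P := by
    refine MvPolynomial.funext fun x => ?_
    rw [eval_subst, hg, eval_blockScale hP, map_mul, eval_C]
  have hh := hessianAt_subst (diagonal fun s => c (τ s)) P a
  rw [hg, hsub] at hh
  have hh' : hessianAt (C (∏ i, c i ^ d i) * P) a = (∏ i, c i ^ d i) • hessianAt P a := by
    ext s u
    simp only [hessianAt, pderiv_C_mul, of_apply, map_mul, eval_C, Matrix.smul_apply, smul_eq_mul]
  intro v hv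
  obtain ⟨t, ht⟩ := ha (_root_.blockScale τ (fun i => (c i)⁻¹) v) (by
    have h1 : (∏ i, c i ^ d i) • (hessianAt P a *ᵥ _root_.blockScale τ (fun i => (c i)⁻¹) v) = 0 := by
      rw [← smul_mulVec, ← hh', hh, ← mulVec_mulVec, hg, ← mulVec_mulVec]
      have : _root_.blockScale τ c (_root_.blockScale τ (fun i => (c i)⁻¹) v) = v := by
        funext s
        simp [_root_.blockScale, hc]
      rw [this, hv, mulVec_zero]
    exact (smul_eq_zero.1 h1).resolve_left
      (Finset.prod_ne_zero_iff.2 fun i _ => pow_ne_zero _ (hc i)))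
  refine ⟨t, funext fun s => ?_⟩
  have := congrFun ht s
  simp only [_root_.blockScale] at this ⊢
  rw [inv_mul_eq_iff_eq_mul₀ (hc _)] at this
  rw [this]; ring

/-- Each block is divided by an entry of largest absolute value. Together with
`isCompact_normalized` this expresses the compactness of a product of projective spaces. -/
theorem exists_blockScale_normalized {σ ι : Type} [Fintype σ] {τ : σ → ι} {a : σ → ℂ}
    (ha : a ∈ blockCone τ) : ∃ t : ι → ℂ, (∀ i, t i ≠ 0) ∧ (∀ s, ‖blockScale τ t a s‖ ≤ 1) ∧
      ∀ i, ∃ s, τ s = i ∧ blockScale τ t a s = 1 := by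
  classical
  have h : ∀ i, ∃ s, τ s = i ∧ a s ≠ 0 ∧ ∀ u, τ u = i → ‖a u‖ ≤ ‖a s‖ := by
    intro i
    obtain ⟨s₀, hs₀, hne⟩ := ha i
    obtain ⟨s, hs, hmax⟩ := (Finset.univ.filter fun s => τ s = i).exists_max_image (fun s => ‖a s‖)
      ⟨s₀, by simpa using hs₀⟩
    refine ⟨s, by simpa using hs, fun h0 => hne ?_, fun u hu => hmax u (by simpa using hu)⟩
    have := hmax s₀ (by simpa using hs₀)
    simpa [h0] using this
  choose κ h1 h2 h3 using h
  refine ⟨fun i => (a (κ i))⁻¹, fun i => inv_ne_zero (h2 i), fun s => ?_, fun i => ⟨κ i, h1 i, ?_⟩⟩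
  · simp only [blockScale, norm_mul, norm_inv]
    rw [inv_mul_le_one₀ (norm_pos_iff.2 (h2 _))]
    exact h3 _ s rfl
  · simp [blockScale, h1, h2]

theorem isCompact_normalized {σ ι : Type} [Fintype σ] [Fintype ι] (τ : σ → ι) :
    IsCompact {a : σ → ℂ | (∀ s, ‖a s‖ ≤ 1) ∧ ∀ i, ∃ s, τ s = i ∧ a s = 1} := by
  have h1 : IsCompact (Set.univ.pi fun _ : σ => Metric.closedBall (0 : ℂ) 1) :=
    isCompact_univ_pi fun _ => isCompact_closedBall _ _
  have h2 : IsClosed {a : σ → ℂ | ∀ i, ∃ s, τ s = i ∧ a s = 1} := by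
    have : {a : σ → ℂ | ∀ i, ∃ s, τ s = i ∧ a s = 1} = ⋂ i, ⋃ s, {a | τ s = i ∧ a s = 1} := by
      ext a; simp
    rw [this]
    refine isClosed_iInter fun i => isClosed_iUnion_of_finite fun s => ?_
    exact isClosed_const.and (isClosed_eq (continuous_apply s) continuous_const)
  convert h1.inter_right h2 using 1
  ext a
  simp [Set.mem_pi]

/-- Nondegeneracy at the moving nodes survives because injectivity of a matrix is an open condition.
That no other singular point appears is checked locally on the compact set of normalized vectors:
near a nonsingular point of the member at 0 some derivative stays nonzero; near a node, a singular
point and the moving node, both rescaled into a common slice, differ by a vector in the kernel of an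
injective matrix and so agree. -/
theorem eventually_hasNodesExactlyAt {σ ι J : Type} [Fintype σ] [Fintype ι] [Finite J]
    [DecidableEq σ] [DecidableEq ι] {τ : σ → ι} {d : ι → ℕ} (hd : ∀ i, d i ≠ 0)
    {Q : MvPolynomial (Option σ) ℂ}
    (hQ : ∀ t, IsWeightedHomogeneous (blockWt τ) (specialize t Q) d)
    {n : ℂ → J → σ → ℂ} (hn : ∀ j, Continuous fun t => n t j) (hc : ∀ j, n 0 j ∈ blockCone τ)
    (hs : ∀ t j, IsSingularAt (specialize t Q) (n t j))
    (h0 : HasNodesExactlyAt τ (specialize 0 Q) (n 0)) :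
    ∀ᶠ t in 𝓝 0, HasNodesExactlyAt τ (specialize t Q) (n t) := by
  obtain ⟨M, hM, hMq, hMh⟩ := exists_hessian_quotient Q
  -- the matrix of the Hessian, extended by equations of a slice
  let N : (ι → σ) → ℂ × (σ → ℂ) × (σ → ℂ) → Matrix (σ ⊕ ι) σ ℂ := fun κ z =>
    fromRows (M z) (of fun i s => if s = κ i then 1 else 0)
  have hNc : ∀ κ, Continuous (N κ) := by
    intro κ
    refine continuous_pi fun r => continuous_pi fun s => ?_
    cases r with
    | inl r => exact (continuous_apply s).comp ((continuous_apply r).comp hM)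
    | inr r => exact continuous_const
  have hN : ∀ κ z v, N κ z *ᵥ v = 0 ↔ M z *ᵥ v = 0 ∧ ∀ i, v (κ i) = 0 := by
    intro κ z v
    have h2 : ∀ i, ((of fun i s => if s = κ i then 1 else 0 : Matrix ι σ ℂ) *ᵥ v) i = v (κ i) := by
      intro i
      simp [mulVec, dotProduct]
    simp only [N, fromRows_mulVec, _root_.funext_iff, Sum.forall, Sum.elim_inl, Sum.elim_inr,
      Pi.zero_apply, h2]
  have hinj : ∀ (κ : ι → σ) (a : σ → ℂ), (∀ i, τ (κ i) = i) → (∀ i, a (κ i) ≠ 0) →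
      IsNondegenerateAt τ (specialize 0 Q) a → ∀ v, N κ (0, a, a) *ᵥ v = 0 → v = 0 := by
    intro κ a hκ ha hnd v hv
    rw [hN, hMh] at hv
    obtain ⟨t, rfl⟩ := hnd v hv.1
    funext s
    have := hv.2 (τ s)
    simp only [blockScale, hκ, mul_eq_zero, ha, or_false] at this
    simp [blockScale, this]
  have part1 : ∀ j, ∀ᶠ t in 𝓝 0, IsNondegenerateAt τ (specialize t Q) (n t j) := by
    intro j
    choose κ hκ hκ0 using hc j
    have e1 : ∀ᶠ t in 𝓝 0, ∀ i, n t j (κ i) ≠ 0 := eventually_all.2 fun i =>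
      ((continuous_apply (κ i)).comp (hn j)).continuousAt.eventually_ne (hκ0 i)
    have e2 : ∀ᶠ t in 𝓝 0, ∀ v, N κ (t, n t j, n t j) *ᵥ v = 0 → v = 0 :=
      Matrix.eventually_mulVec_injective
        ((hNc κ).comp (continuous_id.prodMk ((hn j).prodMk (hn j)))).continuousAt
        (hinj κ _ hκ hκ0 (h0.1 j).2)
    filter_upwards [e1, e2] with t h1 h2 v hv
    -- The orbit tangent vector with the same entries as `v` at the `κ i`; subtracting it from `v`
    -- gives a kernel vector that satisfies the slice equations.
    refine ⟨fun i => v (κ i) / n t j (κ i), ?_⟩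
    rw [← sub_eq_zero]
    refine h2 _ ((hN _ _ _).2 ⟨?_, fun i => ?_⟩)
    · rw [hMh, mulVec_sub, hv, hessianAt_mulVec_blockScale (hQ t) hd (hs t j), sub_zero]
    · simp [blockScale, hκ, h1]
  have part2 : ∀ᶠ t in 𝓝 0, ∀ a ∈ {a : σ → ℂ | (∀ s, ‖a s‖ ≤ 1) ∧ ∀ i, ∃ s, τ s = i ∧ a s = 1},
      IsSingularAt (specialize t Q) a → ∃ j c, a = blockScale τ c (n t j) := by
    refine (isCompact_normalized τ).eventually_forall_of_forall_eventually fun a ha => ?_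
    have hac : a ∈ blockCone τ := fun i => by
      obtain ⟨s, h1, h2⟩ := ha.2 i
      exact ⟨s, h1, by simp [h2]⟩
    by_cases hsing : IsSingularAt (specialize 0 Q) a
    · obtain ⟨j, c, hac'⟩ := h0.2 a hac hsing
      choose κ hκ hκ0 using hac
      have hnκ : ∀ i, n 0 j (κ i) ≠ 0 := fun i h => hκ0 i (by simp [hac', blockScale, h])
      -- `B` rescales the candidate singular point and `B'` the moving node so that their entries at
      -- the `κ i` are those of `a`. Both take the value `a` at the base point, where the matrix of
      -- the Hessian and the slice is injective.
      let B : ℂ × (σ → ℂ) → σ → ℂ := fun z => blockScale τ (fun i => a (κ i) / z.2 (κ i)) z.2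
      let B' : ℂ × (σ → ℂ) → σ → ℂ := fun z =>
        blockScale τ (fun i => a (κ i) / n z.1 j (κ i)) (n z.1 j)
      have hB : ContinuousAt B (0, a) := by
        refine continuousAt_pi.2 fun s => ?_
        refine ContinuousAt.mul (ContinuousAt.div continuousAt_const ?_ (hκ0 _)) ?_
        · exact ((continuous_apply _).comp continuous_snd).continuousAt
        · exact ((continuous_apply _).comp continuous_snd).continuousAt
      have hB' : ContinuousAt B' (0, a) := by
        refine continuousAt_pi.2 fun s => ?_
        refine ContinuousAt.mul (ContinuousAt.div continuousAt_const ?_ (hnκ _)) ?_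
        · exact ((continuous_apply _).comp ((hn j).comp continuous_fst)).continuousAt
        · exact ((continuous_apply _).comp ((hn j).comp continuous_fst)).continuousAt
      have hB0 : B (0, a) = a := by
        funext s
        simp [B, blockScale, hκ0]
      have hB0' : B' (0, a) = a := by
        funext s
        have hq : a (κ (τ s)) / n 0 j (κ (τ s)) = c (τ s) := by
          rw [div_eq_iff (hnκ _)]
          conv_lhs => rw [hac']
          simp [blockScale, hκ]
        conv_rhs => rw [hac']
        simp only [B', blockScale, hq]
      have hnd : IsNondegenerateAt τ (specialize 0 Q) a := by
        rw [hac']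
        refine (h0.1 j).2.blockScale (hQ 0) fun i h => hκ0 i ?_
        simp [hac', blockScale, hκ, h]
      have e0 : ContinuousAt (fun z => N κ (z.1, B z, B' z)) (0, a) := by
        refine (hNc κ).continuousAt.comp ?_
        exact continuousAt_fst.prodMk (hB.prodMk hB')
      have e1 := Matrix.eventually_mulVec_injective e0 (by
        simp only [hB0, hB0']
        exact hinj κ a hκ hκ0 hnd)
      have e2 : ∀ᶠ z : ℂ × (σ → ℂ) in 𝓝 (0, a), ∀ i, z.2 (κ i) ≠ 0 := eventually_all.2 fun i =>
        ((continuous_apply (κ i)).comp continuous_snd).continuousAt.eventually_ne (hκ0 i)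
      have e3 : ∀ᶠ z : ℂ × (σ → ℂ) in 𝓝 (0, a), ∀ i, n z.1 j (κ i) ≠ 0 := eventually_all.2 fun i =>
        ((continuous_apply (κ i)).comp ((hn j).comp continuous_fst)).continuousAt.eventually_ne
          (hnκ i)
      filter_upwards [e1, e2, e3] with z h1 h2 h3 hz
      have hBB : B z = B' z := by
        rw [← sub_eq_zero]
        refine h1 _ ((hN _ _ _).2 ⟨?_, fun i => ?_⟩)
        · rw [hMq]
          funext s
          rw [hz.blockScale (hQ _) hd _ s, (hs z.1 j).blockScale (hQ _) hd _ s]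
          simp
        · simp [B, B', blockScale, hκ, h2, h3]
      refine ⟨j, fun i => z.2 (κ i) / n z.1 j (κ i), funext fun s => ?_⟩
      have := congrFun hBB s
      simp only [B, B', blockScale] at this ⊢
      have k1 := h2 (τ s)
      have k2 := h3 (τ s)
      have k3 := hκ0 (τ s)
      field_simp at this ⊢
      linear_combination this
    · obtain ⟨s, hne⟩ := not_forall.1 hsing
      have hcont : Continuous fun z : ℂ × (σ → ℂ) => eval z.2 (pderiv s (specialize z.1 Q)) := by
        simp only [pderiv_specialize, eval_specialize]
        refine (MvPolynomial.continuous_eval _).comp (continuous_pi fun o => ?_)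
        cases o
        · exact continuous_fst
        · exact (continuous_apply _).comp continuous_snd
      filter_upwards [hcont.continuousAt.eventually_ne (x := (0, a)) hne] with z hz hz'
      exact absurd (hz' s) hz
  filter_upwards [eventually_all.2 part1, part2] with t h1 h2
  refine ⟨fun j => ⟨hs t j, h1 j⟩, fun a ha hsing => ?_⟩
  obtain ⟨c, hc0, hc1, hc2⟩ := exists_blockScale_normalized ha
  obtain ⟨j, e, he⟩ := h2 _ ⟨hc1, hc2⟩ (hsing.blockScale (hQ t) hd c)
  refine ⟨j, fun i => e i / c i, funext fun s => ?_⟩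
  have := congrFun he s
  simp only [blockScale] at this ⊢
  rw [div_mul_eq_mul_div, eq_div_iff (hc0 _), ← this, mul_comm]

/-! ### Birational maps in homogeneous coordinates -/

namespace HomVariety

theorem point_eq_point {X : HomVariety} {a b : X.cone} :
    X.point a = X.point b ↔ X.SamePoint a b :=
  Quotient.eq (r := (⟨X.SamePoint, X.samePoint_equivalence⟩ : Setoid X.cone))

theorem exists_point {X : HomVariety} (x : X.Points) : ∃ a, X.point a = x := Quotient.exists_rep x

theorem point_mem_basicOpen {X : HomVariety} {P : MvPolynomial X.σ ℂ} {d : X.ι → ℕ}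
    (hP : IsWeightedHomogeneous X.wt P d) (a : X.cone) :
    X.point a ∈ X.basicOpen P ↔ eval a.1 P ≠ 0 := by
  refine ⟨fun ⟨b, hb, hne⟩ => ?_, fun h => ⟨a, rfl, h⟩⟩
  obtain ⟨t, ht⟩ := point_eq_point.1 hb
  rw [show a.1 = fun s => (∏ i, (t i : ℂ) ^ X.wt s i) * b.1 s from funext ht, hP.eval_torus]
  exact mul_ne_zero (Finset.prod_ne_zero_iff.2 fun i _ => pow_ne_zero _ (t i).ne_zero) hne

theorem isOpen_basicOpen {X : HomVariety} {P : MvPolynomial X.σ ℂ} {d : X.ι → ℕ}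
    (hP : IsWeightedHomogeneous X.wt P d) : IsOpen (X.basicOpen P) :=
  TopologicalSpace.isOpen_generateFrom_of_mem ⟨P, d, hP, rfl⟩

/-- Products of multihomogeneous polynomials are multihomogeneous, so the generating open sets are
closed under intersection. -/
theorem isTopologicalBasis_basicOpen (X : HomVariety) : TopologicalSpace.IsTopologicalBasis
    {V : Set X.Points | ∃ (P : MvPolynomial X.σ ℂ) (d : X.ι → ℕ),
      IsWeightedHomogeneous X.wt P d ∧ V = X.basicOpen P} where
  exists_subset_inter := by
    rintro _ ⟨P, d, hP, rfl⟩ _ ⟨Q, e, hQ, rfl⟩ x hx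
    refine ⟨_, ⟨P * Q, d + e, hP.mul hQ, rfl⟩, ?_⟩
    obtain ⟨a, rfl⟩ := exists_point x
    have key : ∀ b, X.point b ∈ X.basicOpen (P * Q) ↔
        X.point b ∈ X.basicOpen P ∧ X.point b ∈ X.basicOpen Q := fun b => by
      rw [point_mem_basicOpen (hP.mul hQ), point_mem_basicOpen hP, point_mem_basicOpen hQ, map_mul,
        mul_ne_zero_iff]
    refine ⟨(key a).2 hx, fun y hy => ?_⟩
    obtain ⟨b, rfl⟩ := exists_point y
    exact (key b).1 hy
  sUnion_eq := by
    refine Set.eq_univ_of_forall fun x => ?_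
    obtain ⟨a, rfl⟩ := exists_point x
    exact ⟨_, ⟨1, 0, isWeightedHomogeneous_one _ _, rfl⟩, a, rfl, by simp⟩
  eq_generateFrom := rfl

/-- The polynomial `m` is not a zero divisor modulo `E`. -/
def _root_.MvPolynomial.IsRegularMod {σ : Type} (E m : MvPolynomial σ ℂ) : Prop :=
  ∀ P, E ∣ P * m → E ∣ P

/-- If the polynomial `m` is not a zero divisor modulo the equation `E` of `X`, then its basic open
set is dense. -/
theorem dense_basicOpen {X : HomVariety} [Finite X.σ] {E m : MvPolynomial X.σ ℂ} {d : X.ι → ℕ}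
    (hm : IsWeightedHomogeneous X.wt m d)
    (hE : ∀ a : X.cone, eval a.1 E = 0) (hcone : ∀ a, eval a E = 0 → eval a m ≠ 0 → a ∈ X.cone)
    (hdvd : E.IsRegularMod m) : Dense (X.basicOpen m) := by
  rw [(isTopologicalBasis_basicOpen X).dense_iff]
  rintro _ ⟨P, e, hP, rfl⟩ ⟨_, a, rfl, ha⟩
  by_contra hempty
  rw [Set.not_nonempty_iff_eq_empty] at hempty
  -- Nullstellensatz. A zero of `E` outside the cone is no obstacle, because `m` vanishes there. The
  -- powers of `m` are cancelled afterwards, leaving a power of `P` divisible by `E`.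
  have hmem : P * m ∈ (Ideal.span {E}).radical := by
    rw [← vanishingIdeal_zeroLocus_eq_radical (k := ℂ) (K := ℂ), mem_vanishingIdeal_iff]
    intro x hx
    have hxE : eval x E = 0 := by
      have := hx E (Ideal.mem_span_singleton_self E)
      rwa [aeval_eq_eval] at this
    rw [aeval_eq_eval]
    by_contra hne
    have hne' : eval x (P * m) ≠ 0 := hne
    rw [map_mul, mul_ne_zero_iff] at hne'
    have hxc := hcone x hxE hne'.2
    have : X.point ⟨x, hxc⟩ ∈ X.basicOpen P ∩ X.basicOpen m :=
      ⟨(point_mem_basicOpen hP _).2 hne'.1, (point_mem_basicOpen hm _).2 hne'.2⟩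
    rw [hempty] at this
    exact this
  obtain ⟨N, hN⟩ := hmem
  rw [Ideal.mem_span_singleton, mul_pow] at hN
  have hpow : ∀ k, E ∣ P ^ N * m ^ k → E ∣ P ^ N := by
    intro k
    induction k with
    | zero => simp
    | succ k ih => exact fun h => ih (hdvd _ (by rwa [mul_assoc, ← pow_succ]))
  obtain ⟨R, hR⟩ := hpow N hN
  have := congrArg (eval a.1) hR
  rw [map_pow, map_mul, hE, zero_mul] at this
  exact pow_ne_zero N ha this

/-! ### Maps given by multihomogeneous polynomials -/

/-- Homogeneous polynomials `f` define a map of varieties where a polynomial `m` does not vanish. -/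
structure PolyMap (X Y : HomVariety) (m : MvPolynomial X.σ ℂ) where
  /-- the homogeneous coordinates of the image -/
  f : Y.σ → MvPolynomial X.σ ℂ
  /-- the multidegrees of the map -/
  deg : Y.ι → X.ι → ℕ
  isHomogeneous : ∀ s, IsWeightedHomogeneous X.wt (f s) (∑ i, Y.wt s i • deg i)
  mem_cone : ∀ a ∈ X.cone, eval a m ≠ 0 → (fun s => eval a (f s)) ∈ Y.cone

namespace PolyMap

variable {X Y : HomVariety} {m : MvPolynomial X.σ ℂ}

/-- The coordinates of the image of a point. -/
noncomputable def coords (F : PolyMap X Y m) (a : X.cone) (ha : eval a.1 m ≠ 0) : Y.cone :=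
  ⟨fun s => eval a.1 (F.f s), F.mem_cone a.1 a.2 ha⟩

theorem bind₁_isHomogeneous (F : PolyMap X Y m) {P : MvPolynomial Y.σ ℂ} {d : Y.ι → ℕ}
    (hP : IsWeightedHomogeneous Y.wt P d) :
    IsWeightedHomogeneous X.wt (bind₁ F.f P) (∑ i, d i • F.deg i) := by
  let L : (Y.ι → ℕ) →+ (X.ι → ℕ) :=
    { toFun := fun d => ∑ i, d i • F.deg i
      map_zero' := by simp
      map_add' := fun x y => by simp [add_smul, Finset.sum_add_distrib] }
  exact hP.bind₁ L F.isHomogeneous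

/-- Changing the coordinate vector by `t` changes the image vector by the torus element ∏ t_j^(deg i
j), so the map is well defined where `m` is nonzero. Elsewhere its value is arbitrary. -/
theorem exists_map (F : PolyMap X Y m) [Nonempty Y.Points] :
    ∃ e : X.Points → Y.Points, ∀ a ha, e (X.point a) = Y.point (F.coords a ha) := by
  classical
  refine ⟨fun x => if h : ∃ a, X.point a = x ∧ eval a.1 m ≠ 0 then
    Y.point (F.coords h.choose h.choose_spec.2) else Classical.arbitrary _, fun a ha => ?_⟩
  have h : ∃ b, X.point b = X.point a ∧ eval b.1 m ≠ 0 := ⟨a, rfl, ha⟩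
  simp only [dif_pos h]
  obtain ⟨t, ht⟩ := point_eq_point.1 h.choose_spec.1
  refine point_eq_point.2 ⟨fun i => ∏ j, t j ^ F.deg i j, fun s => ?_⟩
  change eval a.1 (F.f s) = _ * eval h.choose.1 (F.f s)
  rw [show a.1 = fun s => (∏ i, (t i : ℂ) ^ X.wt s i) * h.choose.1 s from funext ht,
    (F.isHomogeneous s).eval_torus]
  congr 1
  simp only [Units.coe_prod, Units.val_pow_eq_pow_val, Finset.sum_apply, Pi.smul_apply,
    smul_eq_mul, ← Finset.prod_pow_eq_pow_sum, ← Finset.prod_pow, ← pow_mul]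
  rw [Finset.prod_comm]
  simp only [mul_comm]

theorem continuousOn (F : PolyMap X Y m) {e : X.Points → Y.Points}
    (he : ∀ a ha, e (X.point a) = Y.point (F.coords a ha)) {d : X.ι → ℕ}
    (hm : IsWeightedHomogeneous X.wt m d) : ContinuousOn e (X.basicOpen m) := by
  rw [continuousOn_iff_continuous_domRestrict]
  refine continuous_generateFrom_iff.2 ?_
  rintro _ ⟨P, d', hP, rfl⟩
  convert (isOpen_basicOpen (F.bind₁_isHomogeneous hP)).preimage continuous_subtype_val using 1
  ext ⟨x, hx⟩
  obtain ⟨a, rfl⟩ := exists_point x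
  rw [point_mem_basicOpen hm] at hx
  simp only [Set.mem_preimage, Set.domRestrict_apply, he a hx, point_mem_basicOpen hP,
    point_mem_basicOpen (F.bind₁_isHomogeneous hP), eval_bind₁]
  rfl

theorem isRegularOn (F : PolyMap X Y m) {e : X.Points → Y.Points}
    (he : ∀ a ha, e (X.point a) = Y.point (F.coords a ha)) {d : X.ι → ℕ}
    (hm : IsWeightedHomogeneous X.wt m d) {V : Set Y.Points} {f : Y.Points → ℂ}
    (hf : Y.IsRegularOn V f) :
    X.IsRegularOn (X.basicOpen m ∩ e ⁻¹' V) (fun x => f (e x)) := by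
  rintro a ⟨ha, haV⟩
  rw [point_mem_basicOpen hm] at ha
  rw [Set.mem_preimage, he a ha] at haV
  obtain ⟨P, Q, d', hP, hQ, hQa, h⟩ := hf _ haV
  refine ⟨bind₁ F.f P, bind₁ F.f Q, _, F.bind₁_isHomogeneous hP, F.bind₁_isHomogeneous hQ, ?_, ?_⟩
  · rw [eval_bind₁]; exact hQa
  · rintro b ⟨hb, hbV⟩ hQb
    rw [point_mem_basicOpen hm] at hb
    rw [Set.mem_preimage, he b hb] at hbV
    rw [eval_bind₁] at hQb
    simp only [he b hb]
    rw [h _ hbV hQb, eval_bind₁, eval_bind₁]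
    rfl

end PolyMap

theorem exists_isBirational {X Y : HomVariety} [Nonempty X.Points] [Nonempty Y.Points]
    {m : MvPolynomial X.σ ℂ} {m' : MvPolynomial Y.σ ℂ} {d : X.ι → ℕ} {d' : Y.ι → ℕ}
    (hm : IsWeightedHomogeneous X.wt m d) (hm' : IsWeightedHomogeneous Y.wt m' d')
    (F : PolyMap X Y m) (G : PolyMap Y X m')
    (hF : ∀ a ha, eval (F.coords a ha).1 m' ≠ 0) (hG : ∀ b hb, eval (G.coords b hb).1 m ≠ 0)
    (hGF : ∀ a ha, X.SamePoint a (G.coords (F.coords a ha) (hF a ha)))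
    (hFG : ∀ b hb, Y.SamePoint b (F.coords (G.coords b hb) (hG b hb)))
    (hX : Dense (X.basicOpen m)) (hY : Dense (Y.basicOpen m')) :
    ∃ e : OpenPartialHomeomorph X.Points Y.Points, IsBirational e ∧ e.source = X.basicOpen m ∧
      ∀ a ha, e (X.point a) = Y.point (F.coords a ha) := by
  obtain ⟨e, he⟩ := F.exists_map
  obtain ⟨e', he'⟩ := G.exists_map
  refine ⟨{ toFun := e
            invFun := e'
            source := X.basicOpen m
            target := Y.basicOpen m'
            map_source' := ?_
            map_target' := ?_
            left_inv' := ?_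
            right_inv' := ?_
            open_source := isOpen_basicOpen hm
            open_target := isOpen_basicOpen hm'
            continuousOn_toFun := F.continuousOn he hm
            continuousOn_invFun := G.continuousOn he' hm' },
    ⟨hX, hY, fun V _ _ f hf => F.isRegularOn he hm hf, fun V _ _ f hf => G.isRegularOn he' hm' hf⟩,
    rfl, he⟩
  · rintro _ ⟨a, rfl, ha⟩
    rw [he a ha]
    exact ⟨_, rfl, hF a ha⟩
  · rintro _ ⟨a, rfl, ha⟩
    rw [he' a ha]
    exact ⟨_, rfl, hG a ha⟩
  · rintro _ ⟨a, rfl, ha⟩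
    rw [he a ha, he' _ (hF a ha)]
    exact (point_eq_point.2 (hGF a ha)).symm
  · rintro _ ⟨a, rfl, ha⟩
    rw [he' a ha, he _ (hG a ha)]
    exact (point_eq_point.2 (hFG a ha)).symm

end HomVariety

/-! ### Divisibility and linear forms -/

theorem MvPolynomial.prime_linForm {σ : Type} [Fintype σ] {c : σ → ℂ} (hc : c ≠ 0) :
    Prime (linForm c) := by
  classical
  have hco : ∀ s, coeff (Finsupp.single s 1) (linForm c) = c s := fun s => by
    simp [linForm, coeff_sum, coeff_C_mul, coeff_X, Finsupp.single_left_inj]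
  obtain ⟨s, hs⟩ := Function.ne_iff.1 hc
  refine Irreducible.prime (irreducible_of_totalDegree_eq_one ?_ ?_)
  · apply IsHomogeneous.totalDegree
    · exact isWeightedHomogeneous_linForm fun _ _ => rfl
    · intro h
      exact hs (by rw [← hco, h]; simp)
  · intro x hx
    have := hx (Finsupp.single s 1)
    rw [hco] at this
    exact isUnit_of_dvd_unit this (isUnit_iff_ne_zero.2 hs)

/-- A zero of `m` at which `E` does not vanish shows that the prime `m` does not divide `E`, so the
two are coprime. -/
theorem MvPolynomial.dvd_of_dvd_mul_prime {σ : Type} {E m P : MvPolynomial σ ℂ} (hm : Prime m)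
    {a : σ → ℂ} (ha : eval a m = 0) (hE : eval a E ≠ 0) (h : E ∣ P * m) : E ∣ P := by
  refine IsRelPrime.dvd_of_dvd_mul_right ?_ h
  refine (hm.irreducible.isRelPrime_iff_not_dvd.2 ?_).symm
  rintro ⟨R, rfl⟩
  simp [ha] at hE

/-! ### Coefficients at a vertex -/

/-- At a point with a single nonzero coordinate, equal to 1, in each block only one monomial
survives. Applied to first derivatives, this turns singularity at a coordinate point into the
vanishing of coefficients. -/
theorem eval_vertex {σ ι : Type} [Fintype σ] [Fintype ι] [DecidableEq σ] [DecidableEq ι]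
    {τ : σ → ι} {P : MvPolynomial σ ℂ} {d : ι → ℕ}
    (hP : IsWeightedHomogeneous (blockWt τ) P d) (κ : ι → σ) (hκ : ∀ i, τ (κ i) = i) :
    eval (fun s => if s = κ (τ s) then 1 else 0) P = coeff (∑ i, Finsupp.single (κ i) (d i)) P := by
  have hm₀ : ∀ s, (∑ i, Finsupp.single (κ i) (d i)) s = if s = κ (τ s) then d (τ s) else 0 := by
    intro s
    rw [Finsupp.finsetSum_apply]
    split_ifs with h
    · rw [Finset.sum_eq_single (τ s)]
      · rw [← h]; simp
      · intro i _ hi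
        rw [Finsupp.single_apply, if_neg]
        rintro rfl
        exact hi (hκ i).symm
      · simp
    · refine Finset.sum_eq_zero fun i _ => ?_
      rw [Finsupp.single_apply, if_neg]
      rintro rfl
      exact h (by rw [hκ])
  have key : ∀ m ∈ P.support, (∀ s ∈ m.support, s = κ (τ s)) →
      m = ∑ i, Finsupp.single (κ i) (d i) := by
    intro m hm h
    ext s
    rw [hm₀]
    split_ifs with hs
    · have h1 := congrFun (hP (mem_support_iff.1 hm)) (τ s)
      rw [Finsupp.weight_apply, Finsupp.sum_fintype _ _ (by simp), Finset.sum_apply,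
        Finset.sum_eq_single s] at h1
      · rw [← h1]; simp [blockWt]
      · intro u _ hu
        by_cases hmu : m u = 0
        · simp [hmu]
        · have h2 := h u (Finsupp.mem_support_iff.2 hmu)
          have : τ u ≠ τ s := fun h3 => hu (by rw [h2, h3, ← hs])
          simp [blockWt, this]
      · simp
    · by_contra hne
      exact hs (h s (Finsupp.mem_support_iff.2 hne))
  rw [eval_eq]
  rw [Finset.sum_eq_single (∑ i, Finsupp.single (κ i) (d i))]
  · rw [Finset.prod_eq_one, mul_one]
    intro s hs
    rw [Finsupp.mem_support_iff, hm₀] at hs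
    rw [if_pos (by by_contra h; exact hs (if_neg h)), one_pow]
  · intro m hm hne
    have : ¬ ∀ s ∈ m.support, s = κ (τ s) := fun h => hne (key m hm h)
    push Not at this
    obtain ⟨s, hs, hs'⟩ := this
    rw [Finset.prod_eq_zero hs, mul_zero]
    rw [if_neg hs', zero_pow (Finsupp.mem_support_iff.1 hs)]
  · intro h
    rw [notMem_support_iff.1 h, zero_mul]

theorem MvPolynomial.eq_sum_monomial_coeff {σ K R : Type*} [CommRing R] {S : Finset K}
    {μ : K → σ →₀ ℕ} (hμ : Function.Injective μ) {P : MvPolynomial σ R}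
    (h : ∀ m ∈ P.support, ∃ e ∈ S, μ e = m) : P = ∑ e ∈ S, monomial (μ e) (coeff (μ e) P) := by
  classical
  ext m
  simp only [coeff_sum, coeff_monomial]
  by_cases hm : m ∈ P.support
  · obtain ⟨e, he, rfl⟩ := h m hm
    simp [hμ.eq_iff, he]
  · rw [notMem_support_iff.1 hm]
    symm
    refine Finset.sum_eq_zero fun e _ => ?_
    split_ifs with h1
    · rw [h1, notMem_support_iff.1 hm]
    · rfl

/-! ### Normal forms -/

/-- The exponents of the monomials of degree at most `2` in each of three variables and of total
degree at most `4`. -/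
def exps : Finset (Fin 3 × Fin 3 × Fin 3) :=
  Finset.univ.filter fun e => (e.1 + e.2.1 + e.2.2 : ℕ) ≤ 4

/-- The exponents of a quartic monomial in four variables. -/
noncomputable def quarticExp (e : Fin 3 × Fin 3 × Fin 3) : Fin 4 →₀ ℕ :=
  Finsupp.equivFunOnFinite.symm ![4 - (e.1 + e.2.1 + e.2.2), e.1, e.2.1, e.2.2]

/-- The exponents of a monomial of multidegree `(2,2,2)`. -/
noncomputable def exp222 (e : Fin 3 × Fin 3 × Fin 3) : Fin 3 × Fin 2 →₀ ℕ :=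
  Finsupp.equivFunOnFinite.symm fun s => (![![2 - e.1, e.1], ![2 - e.2.1, e.2.1],
    ![2 - e.2.2, e.2.2]] : Fin 3 → Fin 2 → ℕ) s.1 s.2

/-- The quartic forms with singular points at the last three coordinate points. -/
noncomputable def quarticOf (c : Fin 3 × Fin 3 × Fin 3 → ℂ) : MvPolynomial (Fin 4) ℂ :=
  ∑ e ∈ exps, monomial (quarticExp e) (c e)

/-- The `(2,2,2)` forms with a singular point at `(∞,∞,∞)`. -/
noncomputable def form222Of (c : Fin 3 × Fin 3 × Fin 3 → ℂ) : MvPolynomial (Fin 3 × Fin 2) ℂ :=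
  ∑ e ∈ exps, monomial (exp222 e) (c e)

theorem quarticExp_injective : Function.Injective quarticExp := by
  rintro ⟨i, j, k⟩ ⟨i', j', k'⟩ h
  have h1 := DFunLike.congr_fun h 1
  have h2 := DFunLike.congr_fun h 2
  have h3 := DFunLike.congr_fun h 3
  simp only [quarticExp, Finsupp.equivFunOnFinite_symm_apply_apply, cons_val] at h1 h2 h3
  ext <;> assumption

theorem exp222_injective : Function.Injective exp222 := by
  rintro ⟨i, j, k⟩ ⟨i', j', k'⟩ h
  have h1 := DFunLike.congr_fun h (0, 1)
  have h2 := DFunLike.congr_fun h (1, 1)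
  have h3 := DFunLike.congr_fun h (2, 1)
  simp only [exp222, Finsupp.equivFunOnFinite_symm_apply_apply, cons_val] at h1 h2 h3
  ext <;> assumption

theorem isHomogeneous_iff_blockWt {σ : Type} {P : MvPolynomial σ ℂ} {d : ℕ} :
    P.IsHomogeneous d ↔ IsWeightedHomogeneous (blockWt fun _ : σ => ()) P (fun _ => d) := by
  refine forall_congr' fun m => imp_congr_right fun _ => ?_
  rw [Finsupp.weight_apply, Finsupp.weight_apply, Finsupp.sum, Finsupp.sum, _root_.funext_iff]
  simp [blockWt]

theorem isWeightedHomogeneous_quarticOf (c : Fin 3 × Fin 3 × Fin 3 → ℂ) :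
    IsWeightedHomogeneous (blockWt fun _ : Fin 4 => ()) (quarticOf c) (fun _ => 4) := by
  refine IsWeightedHomogeneous.sum _ _ _ fun e he => isWeightedHomogeneous_monomial _ _ _ ?_
  funext i
  have : (e.1 + e.2.1 + e.2.2 : ℕ) ≤ 4 := by simpa [exps] using he
  rw [Finsupp.weight_apply, Finsupp.sum_fintype _ _ (by simp)]
  simp [Fin.sum_univ_four, quarticExp, blockWt]
  omega

theorem isWeightedHomogeneous_form222Of (c : Fin 3 × Fin 3 × Fin 3 → ℂ) :
    IsWeightedHomogeneous (blockWt Prod.fst) (form222Of c) (fun _ => 2) := by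
  refine IsWeightedHomogeneous.sum _ _ _ fun e _ => isWeightedHomogeneous_monomial _ _ _ ?_
  funext i
  rw [Finsupp.weight_apply, Finsupp.sum_fintype _ _ (by simp)]
  obtain ⟨j, k, l⟩ := e
  fin_cases i <;> simp [Fintype.sum_prod_type, exp222, blockWt] <;> omega

theorem eval_quarticOf (c : Fin 3 × Fin 3 × Fin 3 → ℂ) (x : Fin 4 → ℂ) :
    eval x (quarticOf c) = ∑ e ∈ exps, c e * (x 0 ^ (4 - (e.1 + e.2.1 + e.2.2) : ℕ) *
      x 1 ^ (e.1 : ℕ) * x 2 ^ (e.2.1 : ℕ) * x 3 ^ (e.2.2 : ℕ)) := by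
  simp [quarticOf, eval_monomial, Finsupp.prod_fintype, Fin.prod_univ_four, quarticExp]

theorem eval_form222Of (c : Fin 3 × Fin 3 × Fin 3 → ℂ) (u : Fin 3 × Fin 2 → ℂ) :
    eval u (form222Of c) = ∑ e ∈ exps, c e * (u (0, 0) ^ (2 - e.1 : ℕ) * u (0, 1) ^ (e.1 : ℕ) *
      (u (1, 0) ^ (2 - e.2.1 : ℕ) * u (1, 1) ^ (e.2.1 : ℕ)) *
      (u (2, 0) ^ (2 - e.2.2 : ℕ) * u (2, 1) ^ (e.2.2 : ℕ))) := by
  simp [form222Of, eval_monomial, Finsupp.prod_fintype, Fintype.prod_prod_type,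
    Fin.prod_univ_three, exp222]

theorem eval_pderiv_quarticOf (c : Fin 3 × Fin 3 × Fin 3 → ℂ) (x : Fin 4 → ℂ) (s : Fin 4) :
    eval x (pderiv s (quarticOf c)) = ∑ e ∈ exps, c e * (quarticExp e s : ℂ) *
      ∏ t, x t ^ (quarticExp e t - if s = t then 1 else 0) := by
  simp [quarticOf, eval_monomial, Finsupp.prod_fintype, pderiv_monomial, Finsupp.single_apply]

theorem eval_pderiv_form222Of (c : Fin 3 × Fin 3 × Fin 3 → ℂ) (x : Fin 3 × Fin 2 → ℂ)
    (s : Fin 3 × Fin 2) :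
    eval x (pderiv s (form222Of c)) = ∑ e ∈ exps, c e * (exp222 e s : ℂ) *
      ∏ t, x t ^ (exp222 e t - if s = t then 1 else 0) := by
  simp [form222Of, eval_monomial, Finsupp.prod_fintype, pderiv_monomial, Finsupp.single_apply]

theorem hessianAt_quarticOf (c : Fin 3 × Fin 3 × Fin 3 → ℂ) (x : Fin 4 → ℂ) (s u : Fin 4) :
    hessianAt (quarticOf c) x s u = ∑ e ∈ exps, c e * (quarticExp e u : ℂ) *
      ((quarticExp e s - if u = s then 1 else 0 : ℕ) : ℂ) *
      ∏ t, x t ^ (quarticExp e t - (if u = t then 1 else 0) - if s = t then 1 else 0) := by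
  simp [hessianAt, quarticOf, eval_monomial, Finsupp.prod_fintype, pderiv_monomial,
    Finsupp.single_apply]

theorem hessianAt_form222Of (c : Fin 3 × Fin 3 × Fin 3 → ℂ) (x : Fin 3 × Fin 2 → ℂ)
    (s u : Fin 3 × Fin 2) :
    hessianAt (form222Of c) x s u = ∑ e ∈ exps, c e * (exp222 e u : ℂ) *
      ((exp222 e s - if u = s then 1 else 0 : ℕ) : ℂ) *
      ∏ t, x t ^ (exp222 e t - (if u = t then 1 else 0) - if s = t then 1 else 0) := by
  simp [hessianAt, form222Of, eval_monomial, Finsupp.prod_fintype, pderiv_monomial,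
    Finsupp.single_apply]

/-- The coordinate points `n i` of the normal form. -/
def stdNodes (i : Fin 3) : Fin 4 → ℂ := Pi.single i.succ 1

/-- The point `(∞,∞,∞)`. -/
def stdPoint (s : Fin 3 × Fin 2) : ℂ := if s.2 = 1 then 1 else 0

/-- A monomial excluded from the normal form is x_i³ x_s for some node index i, and its coefficient
is, up to a positive integer, the s-th derivative at that node. -/
theorem eq_quarticOf {F : MvPolynomial (Fin 4) ℂ} (hF : F.IsHomogeneous 4)
    (hs : ∀ i, IsSingularAt F (stdNodes i)) : F = quarticOf fun e => coeff (quarticExp e) F := by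
  refine eq_sum_monomial_coeff quarticExp_injective fun m hm => ?_
  have hdeg : m 0 + m 1 + m 2 + m 3 = 4 := by
    have := hF (mem_support_iff.1 hm)
    rw [Finsupp.weight_apply, Finsupp.sum_fintype _ _ (by simp), Fin.sum_univ_four] at this
    simpa using this
  have hle : ∀ i : Fin 3, m i.succ ≤ 2 := by
    intro i
    by_contra! h3
    -- The variable that remains when x_i³ is divided out; it may be x_i again.
    obtain ⟨s, hs'⟩ : ∃ s, m s - (Finsupp.single i.succ 3 : Fin 4 →₀ ℕ) s = 1 := by
      by_contra! hne
      have h0 := hne 0; have h1 := hne 1; have h2 := hne 2; have h3 := hne 3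
      fin_cases i <;> simp at * <;> omega
    have hm' : m = Finsupp.single i.succ 3 + Finsupp.single s 1 := by
      ext u
      fin_cases i <;> fin_cases s <;> fin_cases u <;>
        simp at * <;> omega
    have h1 := isWeightedHomogeneous_pderiv_blockWt (isHomogeneous_iff_blockWt.1 hF) (by simp) s
    have h2 := eval_vertex h1 (fun _ => i.succ) (fun _ => rfl)
    have h3 : (fun s => if s = i.succ then 1 else 0) = stdNodes i := by
      funext s; simp [stdNodes, Pi.single_apply]
    rw [h3, hs i s] at h2
    simp only [Finset.univ_unique, Finset.sum_const, Finset.card_singleton, one_smul, blockWt,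
      if_true, coeff_pderiv] at h2
    rw [← hm'] at h2
    refine mem_support_iff.1 hm ((mul_eq_zero.1 h2.symm).resolve_right ?_)
    exact Nat.cast_add_one_ne_zero _
  have h1 := hle 0; have h2 := hle 1; have h3 := hle 2
  simp only [Fin.succ_zero_eq_one, Fin.succ_one_eq_two, Fin.reduceSucc] at h1 h2 h3
  refine ⟨(⟨m 1, by omega⟩, ⟨m 2, by omega⟩, ⟨m 3, by omega⟩), ?_, ?_⟩
  · simp [exps]; omega
  · ext u
    fin_cases u <;> simp [quarticExp] <;> omega

/-- An excluded monomial has total degree at most one in the coordinates that vanish at the point,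
so its coefficient is read off from a first derivative there. -/
theorem eq_form222Of {G : MvPolynomial (Fin 3 × Fin 2) ℂ}
    (hG : IsWeightedHomogeneous (blockWt Prod.fst) G (fun _ => 2))
    (hs : IsSingularAt G stdPoint) : G = form222Of fun e => coeff (exp222 e) G := by
  refine eq_sum_monomial_coeff exp222_injective fun m hm => ?_
  have hdeg : ∀ i, m (i, 0) + m (i, 1) = 2 := by
    intro i
    have := congrFun (hG (mem_support_iff.1 hm)) i
    rw [Finsupp.weight_apply, Finsupp.sum_fintype _ _ (by simp)] at this
    fin_cases i <;>
      simpa [Fintype.sum_prod_type, Fin.sum_univ_three, blockWt] using this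
  have d0 := hdeg 0; have d1 := hdeg 1; have d2 := hdeg 2
  have hle : m (0, 1) + m (1, 1) + m (2, 1) ≤ 4 := by
    by_contra! h5
    obtain ⟨s, hs'⟩ : ∃ s, m = (∑ i, Finsupp.single (i, (1 : Fin 2)) (2 - blockWt Prod.fst s i)) +
        Finsupp.single s 1 := by
      have hex : ∃ i : Fin 3, ∀ j, j ≠ i → m (j, 0) = 0 := by
        obtain h | h | h : (m (1, 0) = 0 ∧ m (2, 0) = 0) ∨ (m (0, 0) = 0 ∧ m (2, 0) = 0) ∨
            (m (0, 0) = 0 ∧ m (1, 0) = 0) := by omega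
        · exact ⟨0, fun j hj => by
            fin_cases j <;> first | exact absurd rfl hj | exact h.1 | exact h.2⟩
        · exact ⟨1, fun j hj => by
            fin_cases j <;> first | exact absurd rfl hj | exact h.1 | exact h.2⟩
        · exact ⟨2, fun j hj => by
            fin_cases j <;> first | exact absurd rfl hj | exact h.1 | exact h.2⟩
      obtain ⟨i, hi⟩ := hex
      -- The derivative is taken in the one vanishing coordinate that occurs; if none occurs, any
      -- coordinate of the point itself will do.
      refine ⟨(i, if m (i, 0) = 0 then 1 else 0), ?_⟩
      ext ⟨j, k⟩
      have e0 := hi 0; have e1 := hi 1; have e2 := hi 2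
      fin_cases i <;> fin_cases j <;> fin_cases k <;>
        simp [Fin.sum_univ_three, Finsupp.single_apply, blockWt] at * <;> (try split_ifs) <;> omega
    have h1 := isWeightedHomogeneous_pderiv_blockWt hG (by simp) s
    have h2 := eval_vertex h1 (fun i => (i, 1)) (fun _ => rfl)
    have h3 : (fun s : Fin 3 × Fin 2 => if s = (s.1, 1) then 1 else 0) = stdPoint := by
      funext s; simp [stdPoint, Prod.ext_iff]
    rw [h3, hs s] at h2
    simp only [coeff_pderiv] at h2
    rw [← hs'] at h2
    refine mem_support_iff.1 hm ((mul_eq_zero.1 h2.symm).resolve_right ?_)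
    exact Nat.cast_add_one_ne_zero _
  refine ⟨(⟨m (0, 1), by omega⟩, ⟨m (1, 1), by omega⟩, ⟨m (2, 1), by omega⟩), ?_, ?_⟩
  · simpa [exps] using hle
  · ext ⟨i, k⟩
    fin_cases i <;> fin_cases k <;> simp [exp222] <;> omega

/-! ### The discriminant of the normal form -/

/-- Half the determinant of the quadratic form
`a y₁² + b y₂² + c y₃² + d y₂ y₃ + e y₁ y₃ + g y₁ y₂`. -/
def conicDisc {R : Type*} [CommRing R] (a b c d e g : R) : R :=
  4 * a * b * c + d * e * g - a * d ^ 2 - b * e ^ 2 - c * g ^ 2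

/-- Cramer's rule: the multipliers are the cofactors of the symmetric matrix of the system, whose
determinant is `2 * conicDisc a b c d e g`. -/
theorem eq_zero_of_conicDisc_ne_zero {a b c d e g y₁ y₂ y₃ : ℂ} (h : conicDisc a b c d e g ≠ 0)
    (h₁ : 2 * a * y₁ + g * y₂ + e * y₃ = 0) (h₂ : g * y₁ + 2 * b * y₂ + d * y₃ = 0)
    (h₃ : e * y₁ + d * y₂ + 2 * c * y₃ = 0) : y₁ = 0 ∧ y₂ = 0 ∧ y₃ = 0 := by
  refine ⟨?_, ?_, ?_⟩ <;> refine (mul_eq_zero.1 (?_ : 2 * conicDisc a b c d e g * _ = 0)).resolve_left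
    (mul_ne_zero two_ne_zero h) <;> rw [conicDisc]
  · linear_combination (4 * b * c - d ^ 2) * h₁ + (d * e - 2 * c * g) * h₂ + (d * g - 2 * b * e) * h₃
  · linear_combination (d * e - 2 * c * g) * h₁ + (4 * a * c - e ^ 2) * h₂ + (e * g - 2 * a * d) * h₃
  · linear_combination (d * g - 2 * b * e) * h₁ + (e * g - 2 * a * d) * h₂ + (4 * a * b - g ^ 2) * h₃

/-- The conics in the normal form: the tangent cone at `(∞,∞,∞)` and those at the nodes of the
quartic. -/
def conics {R : Type*} [CommRing R] (c : Fin 3 × Fin 3 × Fin 3 → R) : Fin 4 → R :=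
  ![conicDisc (c (0, 2, 2)) (c (2, 0, 2)) (c (2, 2, 0)) (c (2, 1, 1)) (c (1, 2, 1)) (c (1, 1, 2)),
    conicDisc (c (2, 0, 0)) (c (2, 2, 0)) (c (2, 0, 2)) (c (2, 1, 1)) (c (2, 0, 1)) (c (2, 1, 0)),
    conicDisc (c (0, 2, 0)) (c (2, 2, 0)) (c (0, 2, 2)) (c (1, 2, 1)) (c (0, 2, 1)) (c (1, 2, 0)),
    conicDisc (c (0, 0, 2)) (c (2, 0, 2)) (c (0, 2, 2)) (c (1, 1, 2)) (c (0, 1, 2)) (c (1, 0, 2))]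

/-- If this polynomial in the coefficients does not vanish, then the quartic and the `(2,2,2)` form
have nodes at the given points and no other singular points at infinity. -/
def disc {R : Type*} [CommRing R] (c : Fin 3 × Fin 3 × Fin 3 → R) : R :=
  c (0, 2, 2) * c (2, 0, 2) * c (2, 2, 0) * ∏ i, conics c i

theorem map_disc {R S : Type*} [CommRing R] [CommRing S] (f : R →+* S)
    (c : Fin 3 × Fin 3 × Fin 3 → R) : f (disc c) = disc fun e => f (c e) := by
  simp [disc, conics, conicDisc, Fin.prod_univ_four, map_ofNat]

theorem disc_ne_zero_iff {c : Fin 3 × Fin 3 × Fin 3 → ℂ} : disc c ≠ 0 ↔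
    (c (0, 2, 2) ≠ 0 ∧ c (2, 0, 2) ≠ 0 ∧ c (2, 2, 0) ≠ 0) ∧ ∀ i, conics c i ≠ 0 := by
  simp only [disc, mul_ne_zero_iff, Finset.prod_ne_zero_iff, Finset.mem_univ, true_imp_iff,
    and_assoc]

/-! ### Comparison of the singular points -/

/-- The standard birational map in coordinates. -/
def stdMap (x : Fin 4 → ℂ) (s : Fin 3 × Fin 2) : ℂ := if s.2 = 0 then x 0 else x s.1.succ

/-- Monomial by monomial: the blocks contribute x₀ to the power 6 - (i+j+k), which exceeds the
exponent in the quartic by 2. The square factor is what lets the map lift to the double covers. -/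
theorem eval_stdMap_form222Of (c : Fin 3 × Fin 3 × Fin 3 → ℂ) (x : Fin 4 → ℂ) :
    eval (stdMap x) (form222Of c) = x 0 ^ 2 * eval x (quarticOf c) := by
  rw [eval_form222Of, eval_quarticOf, Finset.mul_sum]
  refine Finset.sum_congr rfl fun e he => ?_
  have he' : (e.1 + e.2.1 + e.2.2 : ℕ) ≤ 4 := by simpa [exps] using he
  have h1 := e.1.2; have h2 := e.2.1.2; have h3 := e.2.2.2
  have key : x 0 ^ (2 - e.1 : ℕ) * x 0 ^ (2 - e.2.1 : ℕ) * x 0 ^ (2 - e.2.2 : ℕ) =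
      x 0 ^ 2 * x 0 ^ (4 - (e.1 + e.2.1 + e.2.2) : ℕ) := by
    rw [← pow_add, ← pow_add, ← pow_add]
    congr 1
    omega
  simp only [stdMap, Fin.succ_zero_eq_one, Fin.succ_one_eq_two, Fin.reduceSucc, if_true,
    one_ne_zero, if_false]
  linear_combination (c e * x 1 ^ (e.1 : ℕ) * x 2 ^ (e.2.1 : ℕ) * x 3 ^ (e.2.2 : ℕ)) * key

/-- Differentiate the identity G(stdMap x) = x₀² F(x). For the converse, the derivatives in x₁, x₂,
x₃ give those of G in the coordinates `(i, 1)`, and Euler's relation in each block gives the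
remaining ones because x₀ is nonzero. -/
theorem isSingularAt_form222Of_iff (c : Fin 3 × Fin 3 × Fin 3 → ℂ) {x : Fin 4 → ℂ} (hx : x 0 ≠ 0) :
    IsSingularAt (form222Of c) (stdMap x) ↔ IsSingularAt (quarticOf c) x := by
  have hG := isWeightedHomogeneous_form222Of c
  have hF := isWeightedHomogeneous_quarticOf c
  let φ : Fin 3 × Fin 2 → MvPolynomial (Fin 4) ℂ := fun s => if s.2 = 0 then X 0 else X s.1.succ
  have hφ : ∀ y : Fin 4 → ℂ, (fun s => eval y (φ s)) = stdMap y := fun y => by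
    funext s
    simp only [φ, stdMap]
    split_ifs <;> simp
  have hpoly : bind₁ φ (form222Of c) = X 0 ^ 2 * quarticOf c := by
    refine MvPolynomial.funext fun y => ?_
    rw [eval_bind₁, hφ, eval_stdMap_form222Of]
    simp
  have hd := fun j => congrArg (fun P => eval x (pderiv j P)) hpoly
  simp only [pderiv_bind₁, map_mul, eval_bind₁, hφ, pderiv_mul, pderiv_pow, map_add,
    map_pow, eval_X, Fintype.sum_prod_type, Fin.sum_univ_three, Fin.sum_univ_two, φ] at hd
  constructor
  · intro h
    have hF0 : eval x (quarticOf c) = 0 := by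
      have := h.eval_eq_zero hG (i := 0) (by simp)
      rw [eval_stdMap_form222Of] at this
      simpa [hx] using this
    intro j
    have := hd j
    simp only [h _, zero_mul, add_zero, hF0, mul_zero, zero_add] at this
    simpa [hx] using this.symm
  · intro h
    have hF0 : eval x (quarticOf c) = 0 := h.eval_eq_zero hF (i := ()) (by simp)
    have hG0 : eval (stdMap x) (form222Of c) = 0 := by rw [eval_stdMap_form222Of, hF0, mul_zero]
    have h1 : ∀ i, eval (stdMap x) (pderiv (i, 1) (form222Of c)) = 0 := by
      intro i
      have := hd i.succ
      simp only [h _, hF0, mul_zero, add_zero] at this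
      fin_cases i <;> simpa [pderiv_X, Pi.single_apply] using this
    rintro ⟨i, k⟩
    obtain rfl | rfl : k = 1 ∨ k = 0 := by fin_cases k <;> simp
    · exact h1 i
    have he := euler_block hG (stdMap x) i
    rw [hG0, mul_zero] at he
    fin_cases i <;>
      simpa [Fintype.sum_prod_type, Fin.sum_univ_three, h1, stdMap, hx] using he

theorem not_isSingularAt_form222Of {c : Fin 3 × Fin 3 × Fin 3 → ℂ}
    (h : ∀ x : Fin 4 → ℂ, x 0 ≠ 0 → ¬ IsSingularAt (quarticOf c) x) {u : Fin 3 × Fin 2 → ℂ}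
    (hu : ∀ i, u (i, 0) ≠ 0) : ¬ IsSingularAt (form222Of c) u := by
  intro hs
  let x : Fin 4 → ℂ := Fin.cons 1 fun i => u (i, 1) / u (i, 0)
  refine h x one_ne_zero ((isSingularAt_form222Of_iff c (x := x) one_ne_zero).1 ?_)
  have h1 := hs.blockScale (isWeightedHomogeneous_form222Of c) (by simp) fun i => (u (i, 0))⁻¹
  convert h1 using 1
  funext ⟨i, k⟩
  fin_cases k
  · simp [stdMap, x, blockScale, hu]
  · simp [stdMap, x, blockScale, div_eq_inv_mul]

/-- On the plane x₀ = 0 the quartic is the quadratic form of `conics c 0` evaluated at (x₂x₃, x₁x₃,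
x₁x₂), a Cremona transform of a conic. Where no coordinate vanishes, a singular point would make the
conic degenerate. Where one vanishes, a single term x_j²x_k² with nonzero coefficient is left, so a
second coordinate vanishes as well. -/
theorem eq_smul_stdNodes_of_isSingularAt {c : Fin 3 × Fin 3 × Fin 3 → ℂ} (hc : disc c ≠ 0)
    {x : Fin 4 → ℂ} (hx : x 0 = 0) (hs : IsSingularAt (quarticOf c) x) :
    ∃ i t, x = blockScale (fun _ => ()) t (stdNodes i) := by
  obtain ⟨⟨ha, hb, hg⟩, hq⟩ := disc_ne_zero_iff.1 hc
  have hF0 : eval x (quarticOf c) = 0 :=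
    hs.eval_eq_zero (isWeightedHomogeneous_quarticOf c) (i := ()) (by simp)
  have h1 := hs 1
  have h2 := hs 2
  have h3 := hs 3
  rw [eval_pderiv_quarticOf] at h1 h2 h3
  rw [eval_quarticOf] at hF0
  simp [exps, Finset.sum_filter, Fintype.sum_prod_type, Fin.sum_univ_three, Fin.prod_univ_four,
    quarticExp, hx] at h1 h2 h3 hF0
  have key : (x 2 = 0 ∧ x 3 = 0) ∨ (x 1 = 0 ∧ x 3 = 0) ∨ (x 1 = 0 ∧ x 2 = 0) := by
    by_cases k1 : x 1 = 0
    · simp [k1, ha] at hF0 ⊢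
      tauto
    by_cases k2 : x 2 = 0
    · simp [k1, k2, hb] at hF0 ⊢
      tauto
    by_cases k3 : x 3 = 0
    · simp [k1, k2, k3, hg] at hF0
    exfalso
    have q0 := hq 0
    -- With y₁ = x₂x₃, y₂ = x₁x₃, y₃ = x₁x₂, the operator (x₂∂₂ + x₃∂₃ - x₁∂₁)/2 is y₁∂/∂y₁;
    -- similarly for the other two.
    have e1 : x 2 * x 3 * (2 * c (0, 2, 2) * (x 2 * x 3) + c (1, 1, 2) * (x 1 * x 3) +
      c (1, 2, 1) * (x 1 * x 2)) = 0 := by linear_combination (x 2 * h2 + x 3 * h3 - x 1 * h1) / 2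
    have e2 : x 1 * x 3 * (c (1, 1, 2) * (x 2 * x 3) + 2 * c (2, 0, 2) * (x 1 * x 3) +
      c (2, 1, 1) * (x 1 * x 2)) = 0 := by linear_combination (x 1 * h1 + x 3 * h3 - x 2 * h2) / 2
    have e3 : x 1 * x 2 * (c (1, 2, 1) * (x 2 * x 3) + c (2, 1, 1) * (x 1 * x 3) +
      2 * c (2, 2, 0) * (x 1 * x 2)) = 0 := by linear_combination (x 1 * h1 + x 2 * h2 - x 3 * h3) / 2
    simp only [mul_eq_zero, k1, k2, k3, false_or] at e1 e2 e3
    have := eq_zero_of_conicDisc_ne_zero q0 e1 e2 e3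
    simp [k1, k2, k3] at this
  rcases key with ⟨k1, k2⟩ | ⟨k1, k2⟩ | ⟨k1, k2⟩
  · refine ⟨0, fun _ => x 1, funext fun j => ?_⟩
    fin_cases j <;> simp [blockScale, stdNodes, hx, k1, k2]
  · refine ⟨1, fun _ => x 2, funext fun j => ?_⟩
    fin_cases j <;> simp [blockScale, stdNodes, hx, k1, k2]
  · refine ⟨2, fun _ => x 3, funext fun j => ?_⟩
    fin_cases j <;> simp [blockScale, stdNodes, hx, k1, k2]

/-- The shape of the `(2,2,2)` normal form on a face `u (i, 0) = 0`: a conic evaluated at (st, xt,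
sy), where (s : x) and (t : y) are the two other factors. The hypotheses `h₂` and `h₃` are the
derivatives in x and y. If s = 0, only the term of b survives; if t = 0, only that of c; otherwise
the conic would be degenerate. -/
theorem eq_zero_of_biquadratic {a b c d e g z s x t y : ℂ} (hq : conicDisc a b c d e g ≠ 0)
    (hb : b ≠ 0) (hc : c ≠ 0) (hz : z ≠ 0) (hs : s = 0 → x ≠ 0) (ht : t = 0 → y ≠ 0)
    (h : z ^ 2 * (a * (s * t) ^ 2 + b * (x * t) ^ 2 + c * (s * y) ^ 2 + d * (x * t) * (s * y) +
      e * (s * t) * (s * y) + g * (s * t) * (x * t)) = 0)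
    (h₂ : z ^ 2 * t * (g * (s * t) + 2 * b * (x * t) + d * (s * y)) = 0)
    (h₃ : z ^ 2 * s * (e * (s * t) + d * (x * t) + 2 * c * (s * y)) = 0) : s = 0 ∧ t = 0 := by
  by_cases hs0 : s = 0
  · simp [hs0, hz, hb, hs hs0] at h
    exact ⟨hs0, h⟩
  by_cases ht0 : t = 0
  · simp [ht0, hz, hc, ht ht0] at h
    exact ⟨h, ht0⟩
  -- Euler's relation for the quadratic form supplies the derivative in its first argument.
  have h₁ : z ^ 2 * (s * t) * (2 * a * (s * t) + g * (x * t) + e * (s * y)) = 0 := by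
    linear_combination 2 * h - x * h₂ - y * h₃
  simp only [mul_eq_zero, pow_eq_zero_iff two_ne_zero, hz, hs0, ht0, false_or] at h₁ h₂ h₃
  simpa [hs0, ht0] using (eq_zero_of_conicDisc_ne_zero hq h₁ h₂ h₃).1

theorem eq_smul_stdPoint_of_isSingularAt {c : Fin 3 × Fin 3 × Fin 3 → ℂ} (hc : disc c ≠ 0)
    {u : Fin 3 × Fin 2 → ℂ} (hu : u ∈ blockCone Prod.fst) {i : Fin 3} (hi : u (i, 0) = 0)
    (hs : IsSingularAt (form222Of c) u) : ∃ t, u = blockScale Prod.fst t stdPoint := by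
  obtain ⟨⟨h022, h202, h220⟩, q⟩ := disc_ne_zero_iff.1 hc
  have hF0 : eval u (form222Of c) = 0 :=
    hs.eval_eq_zero (isWeightedHomogeneous_form222Of c) (i := 0) (by simp)
  have hcone : ∀ i, u (i, 0) = 0 → u (i, 1) ≠ 0 := by
    intro i h0
    obtain ⟨⟨j, k⟩, rfl, h⟩ := hu i
    fin_cases k
    · exact absurd h0 h
    · exact h
  have key : u (0, 0) = 0 ∧ u (1, 0) = 0 ∧ u (2, 0) = 0 := by
    have k0 := hs (0, 1)
    have k1 := hs (1, 1)
    have k2 := hs (2, 1)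
    rw [eval_pderiv_form222Of] at k0 k1 k2
    rw [eval_form222Of] at hF0
    fin_cases i
    · simp [exps, Finset.sum_filter, Fintype.sum_prod_type, Fin.sum_univ_three,
        Fintype.prod_prod_type, Fin.prod_univ_three, exp222] at hi hF0 k0 k1 k2
      simp [hi] at hF0 k1 k2
      exact ⟨hi, eq_zero_of_biquadratic (q 1) h220 h202 (hcone 0 hi) (hcone 1) (hcone 2)
        (by linear_combination hF0) (by linear_combination k1) (by linear_combination k2)⟩
    · simp [exps, Finset.sum_filter, Fintype.sum_prod_type, Fin.sum_univ_three,
        Fintype.prod_prod_type, Fin.prod_univ_three, exp222] at hi hF0 k0 k1 k2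
      simp [hi] at hF0 k0 k2
      have := eq_zero_of_biquadratic (q 2) h220 h022 (hcone 1 hi) (hcone 0) (hcone 2)
        (by linear_combination hF0) (by linear_combination k0) (by linear_combination k2)
      exact ⟨this.1, hi, this.2⟩
    · simp [exps, Finset.sum_filter, Fintype.sum_prod_type, Fin.sum_univ_three,
        Fintype.prod_prod_type, Fin.prod_univ_three, exp222] at hi hF0 k0 k1 k2
      simp [hi] at hF0 k0 k1
      have := eq_zero_of_biquadratic (q 3) h202 h022 (hcone 2 hi) (hcone 0) (hcone 1)
        (by linear_combination hF0) (by linear_combination k0) (by linear_combination k1)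
      exact ⟨this.1, this.2, hi⟩
  refine ⟨fun i => u (i, 1), funext fun ⟨j, k⟩ => ?_⟩
  fin_cases k
  · fin_cases j <;> simp [blockScale, stdPoint, key]
  · simp [blockScale, stdPoint]

/-! ### Nodes of the normal forms -/

theorem isSingularAt_quarticOf_stdNodes (c : Fin 3 × Fin 3 × Fin 3 → ℂ) (i : Fin 3) :
    IsSingularAt (quarticOf c) (stdNodes i) := by
  intro s
  rw [eval_pderiv_quarticOf]
  fin_cases i <;> fin_cases s <;>
    simp [exps, Finset.sum_filter, Fintype.sum_prod_type, Fin.sum_univ_three, Fin.prod_univ_four,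
      quarticExp, stdNodes, Pi.single_apply]

theorem isSingularAt_form222Of_stdPoint (c : Fin 3 × Fin 3 × Fin 3 → ℂ) :
    IsSingularAt (form222Of c) stdPoint := by
  rintro ⟨i, k⟩
  rw [eval_pderiv_form222Of]
  fin_cases i <;> fin_cases k <;>
    simp [exps, Finset.sum_filter, Fintype.sum_prod_type, Fin.sum_univ_three,
      Fintype.prod_prod_type, Fin.prod_univ_three, exp222, stdPoint]

set_option maxHeartbeats 1000000 in
-- In the three directions transverse to a node, the Hessian is the matrix of the corresponding
-- member of `conics`, the tangent cone.
theorem isNondegenerateAt_stdNodes {c : Fin 3 × Fin 3 × Fin 3 → ℂ} (hc : disc c ≠ 0) (i : Fin 3) :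
    IsNondegenerateAt (fun _ => ()) (quarticOf c) (stdNodes i) := by
  have hq := (disc_ne_zero_iff.1 hc).2
  intro v hv
  fin_cases i
  · have k0 := congrFun hv 0
    have k2 := congrFun hv 2
    have k3 := congrFun hv 3
    simp [mulVec, dotProduct, Fin.sum_univ_four, hessianAt_quarticOf, exps, Finset.sum_filter,
      Fintype.sum_prod_type, Fin.sum_univ_three, Fin.prod_univ_four, quarticExp, stdNodes,
      Pi.single_apply] at k0 k2 k3
    obtain ⟨h1, h2, h3⟩ := eq_zero_of_conicDisc_ne_zero (y₁ := v 0) (y₂ := v 2)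
      (y₃ := v 3) (hq 1) (by linear_combination k0)
      (by linear_combination k2) (by linear_combination k3)
    refine ⟨fun _ => v 1, funext fun j => ?_⟩
    fin_cases j <;> simp [blockScale, stdNodes, h1, h2, h3]
  · have k0 := congrFun hv 0
    have k1 := congrFun hv 1
    have k3 := congrFun hv 3
    simp [mulVec, dotProduct, Fin.sum_univ_four, hessianAt_quarticOf, exps, Finset.sum_filter,
      Fintype.sum_prod_type, Fin.sum_univ_three, Fin.prod_univ_four, quarticExp, stdNodes,
      Pi.single_apply] at k0 k1 k3
    obtain ⟨h1, h2, h3⟩ := eq_zero_of_conicDisc_ne_zero (y₁ := v 0) (y₂ := v 1)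
      (y₃ := v 3) (hq 2) (by linear_combination k0)
      (by linear_combination k1) (by linear_combination k3)
    refine ⟨fun _ => v 2, funext fun j => ?_⟩
    fin_cases j <;> simp [blockScale, stdNodes, h1, h2, h3]
  · have k0 := congrFun hv 0
    have k1 := congrFun hv 1
    have k2 := congrFun hv 2
    simp [mulVec, dotProduct, Fin.sum_univ_four, hessianAt_quarticOf, exps, Finset.sum_filter,
      Fintype.sum_prod_type, Fin.sum_univ_three, Fin.prod_univ_four, quarticExp, stdNodes,
      Pi.single_apply] at k0 k1 k2
    obtain ⟨h1, h2, h3⟩ := eq_zero_of_conicDisc_ne_zero (y₁ := v 0) (y₂ := v 1)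
      (y₃ := v 2) (hq 3) (by linear_combination k0)
      (by linear_combination k1) (by linear_combination k2)
    refine ⟨fun _ => v 3, funext fun j => ?_⟩
    fin_cases j <;> simp [blockScale, stdNodes, h1, h2, h3]

theorem isNondegenerateAt_stdPoint {c : Fin 3 × Fin 3 × Fin 3 → ℂ} (hc : disc c ≠ 0) :
    IsNondegenerateAt Prod.fst (form222Of c) stdPoint := by
  have hq := (disc_ne_zero_iff.1 hc).2
  intro v hv
  have k0 := congrFun hv (0, 0)
  have k1 := congrFun hv (1, 0)
  have k2 := congrFun hv (2, 0)
  simp [mulVec, dotProduct, hessianAt_form222Of, exps, Finset.sum_filter, Fintype.sum_prod_type,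
    Fin.sum_univ_three, Fintype.prod_prod_type, Fin.prod_univ_three, exp222, stdPoint] at k0 k1 k2
  obtain ⟨h1, h2, h3⟩ := eq_zero_of_conicDisc_ne_zero (y₁ := v (0, 0)) (y₂ := v (1, 0))
      (y₃ := v (2, 0)) (hq 0) (by linear_combination k0)
    (by linear_combination k1) (by linear_combination k2)
  refine ⟨fun i => v (i, 1), funext fun ⟨i, k⟩ => ?_⟩
  fin_cases k
  · fin_cases i <;> simp [blockScale, stdPoint, h1, h2, h3]
  · simp [blockScale, stdPoint]

theorem hasNodesExactlyAt_quarticOf {c : Fin 3 × Fin 3 × Fin 3 → ℂ} (hc : disc c ≠ 0)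
    (h : ∀ u : Fin 3 × Fin 2 → ℂ, (∀ i, u (i, 0) ≠ 0) → ¬ IsSingularAt (form222Of c) u) :
    HasNodesExactlyAt (fun _ => ()) (quarticOf c) stdNodes := by
  refine ⟨fun i => ⟨isSingularAt_quarticOf_stdNodes c i, isNondegenerateAt_stdNodes hc i⟩,
    fun a _ hs => eq_smul_stdNodes_of_isSingularAt hc ?_ hs⟩
  by_contra ha
  exact h (stdMap a) (fun i => by simpa [stdMap] using ha) ((isSingularAt_form222Of_iff c ha).2 hs)

theorem hasNodesExactlyAt_form222Of {c : Fin 3 × Fin 3 × Fin 3 → ℂ} (hc : disc c ≠ 0)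
    (h : ∀ x : Fin 4 → ℂ, x 0 ≠ 0 → ¬ IsSingularAt (quarticOf c) x) :
    HasNodesExactlyAt Prod.fst (form222Of c) fun _ : Unit => stdPoint := by
  refine ⟨fun _ => ⟨isSingularAt_form222Of_stdPoint c, isNondegenerateAt_stdPoint hc⟩,
    fun u hu hs => ⟨(), ?_⟩⟩
  have : ∃ i, u (i, 0) = 0 := by
    by_contra! hne
    exact not_isSingularAt_form222Of h hne hs
  obtain ⟨i, hi⟩ := this
  exact eq_smul_stdPoint_of_isSingularAt hc hu hi hs

/-! ### The birational maps defined by three pencils of planes -/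

/-- The equations of a birational map given by three pencils `ℓ` of planes that contain a common
plane `h = 0`; on `ℙ¹ × ℙ¹ × ℙ¹` this plane corresponds to the forms `β i`. -/
structure PencilChart (F : MvPolynomial (Fin 4) ℂ) (G : MvPolynomial (Fin 3 × Fin 2) ℂ)
    (ℓ : Fin 3 → Fin 2 → Fin 4 → ℂ) where
  /-- the coefficients of the common plane -/
  h : Fin 4 → ℂ
  /-- the coefficients of the images of the common plane -/
  β : Fin 3 → Fin 3 × Fin 2 → ℂ
  /-- the inverse map -/
  ψ : Fin 4 → MvPolynomial (Fin 3 × Fin 2) ℂ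
  isHomogeneous_ψ : ∀ s, IsWeightedHomogeneous wt222 (ψ s) (fun _ => 1)
  isHomogeneous_G : IsWeightedHomogeneous wt222 G (fun _ => 2)
  h_ne_zero : h ≠ 0
  β_ne_zero : ∀ i, β i ≠ 0
  β_block : ∀ i s, s.1 ≠ i → β i s = 0
  β_pencilVector : ∀ i a, β i ⬝ᵥ pencilVector ℓ a = h ⬝ᵥ a
  h_ψ : ∀ u, (h ⬝ᵥ fun s => eval u (ψ s)) = ∏ i, β i ⬝ᵥ u
  ψ_pencilVector : ∀ a s, eval (pencilVector ℓ a) (ψ s) = (h ⬝ᵥ a) ^ 2 * a s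
  pencilVector_ψ : ∀ u s,
    (β s.1 ⬝ᵥ u) * pencilVector ℓ (fun s => eval u (ψ s)) s = (∏ i, β i ⬝ᵥ u) * u s
  eval_pencilVector : ∀ a, eval (pencilVector ℓ a) G = (h ⬝ᵥ a) ^ 2 * eval a F
  -- This and the next condition keep the planes removed by the chart from being components of the
  -- branch surfaces; density of the domains in the surfaces and double covers rests on them.
  exists_F_ne_zero : ∃ a, h ⬝ᵥ a = 0 ∧ eval a F ≠ 0
  exists_G_ne_zero : ∀ i, ∃ u, β i ⬝ᵥ u = 0 ∧ eval u G ≠ 0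
  exists_F_eq_zero : ∃ a ≠ 0, eval a F = 0
  exists_G_eq_zero : ∃ u ∈ cone222, eval u G = 0

namespace PencilChart

variable {F : MvPolynomial (Fin 4) ℂ} {G : MvPolynomial (Fin 3 × Fin 2) ℂ}
  {ℓ : Fin 3 → Fin 2 → Fin 4 → ℂ} (K : PencilChart F G ℓ)

/-- The equation of the image of the common plane. -/
noncomputable def m : MvPolynomial (Fin 3 × Fin 2) ℂ := ∏ i, linForm (K.β i)

theorem eval_m (u : Fin 3 × Fin 2 → ℂ) : eval u K.m = ∏ i, K.β i ⬝ᵥ u := by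
  simp [m, map_prod]

theorem isWeightedHomogeneous_m : IsWeightedHomogeneous wt222 K.m (fun _ => 1) := by
  have h1 : (fun _ : Fin 3 => 1) = ∑ i : Fin 3, fun j => if i = j then 1 else 0 := by
    funext j; simp
  rw [h1]
  refine IsWeightedHomogeneous.prod _ _ _ fun i _ => isWeightedHomogeneous_linForm fun s hs => ?_
  have : s.1 = i := by by_contra hne; exact hs (K.β_block i s hne)
  funext j
  simp [wt222, this]

theorem eval_m_pencilVector (a : Fin 4 → ℂ) : eval (pencilVector ℓ a) K.m = (K.h ⬝ᵥ a) ^ 3 := by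
  simp [eval_m, K.β_pencilVector]

theorem β_ne_zero_of_m {u : Fin 3 × Fin 2 → ℂ} (hu : eval u K.m ≠ 0) (i : Fin 3) :
    K.β i ⬝ᵥ u ≠ 0 := by
  rw [eval_m] at hu
  exact Finset.prod_ne_zero_iff.1 hu i (Finset.mem_univ _)

theorem pencilVector_mem_cone222 {a : Fin 4 → ℂ} (ha : K.h ⬝ᵥ a ≠ 0) :
    pencilVector ℓ a ∈ cone222 := by
  intro i h0
  apply ha
  rw [← K.β_pencilVector i a]
  refine Finset.sum_eq_zero fun s _ => ?_
  by_cases hs : s.1 = i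
  · subst hs
    rw [show pencilVector ℓ a s = 0 from congrFun h0 s.2, mul_zero]
  · rw [K.β_block i s hs, zero_mul]

theorem mem_cone222 {u : Fin 3 × Fin 2 → ℂ} (hu : eval u K.m ≠ 0) : u ∈ cone222 := by
  intro i h0
  apply K.β_ne_zero_of_m hu i
  refine Finset.sum_eq_zero fun s _ => ?_
  by_cases hs : s.1 = i
  · subst hs
    rw [show u s = 0 from congrFun h0 s.2, mul_zero]
  · rw [K.β_block i s hs, zero_mul]

theorem ψ_ne_zero {u : Fin 3 × Fin 2 → ℂ} (hu : eval u K.m ≠ 0) :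
    (fun s => eval u (K.ψ s)) ≠ 0 := by
  intro h0
  apply hu
  rw [eval_m, ← K.h_ψ, h0, dotProduct_zero]

theorem pencilVector_ψ_eq {u : Fin 3 × Fin 2 → ℂ} (hu : eval u K.m ≠ 0) (s : Fin 3 × Fin 2) :
    pencilVector ℓ (fun s => eval u (K.ψ s)) s = eval u K.m / (K.β s.1 ⬝ᵥ u) * u s := by
  rw [div_mul_eq_mul_div, eq_div_iff (K.β_ne_zero_of_m hu _), eval_m, ← K.pencilVector_ψ, mul_comm]

theorem prod_m_div {u : Fin 3 × Fin 2 → ℂ} (hu : eval u K.m ≠ 0) :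
    ∏ i, eval u K.m / (K.β i ⬝ᵥ u) = eval u K.m ^ 2 := by
  rw [Finset.prod_div_distrib, ← eval_m]
  simp only [Finset.prod_const, Finset.card_univ, Fintype.card_fin]
  field_simp

/-- Write m for the product of the βᵢ(u). The image of ψ(u) under the pencils is u with its blocks
scaled by m/βᵢ(u), whose product is m². Evaluating G there gives m⁴G(u) on one side and m²F(ψ(u)) on
the other. -/
theorem eval_F_ψ {u : Fin 3 × Fin 2 → ℂ} (hu : eval u K.m ≠ 0) :
    eval (fun s => eval u (K.ψ s)) F = eval u K.m ^ 2 * eval u G := by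
  have h1 := K.eval_pencilVector fun s => eval u (K.ψ s)
  have h2 : pencilVector ℓ (fun s => eval u (K.ψ s)) =
      blockScale Prod.fst (fun i => eval u K.m / (K.β i ⬝ᵥ u)) u :=
    funext fun s => K.pencilVector_ψ_eq hu s
  rw [h2, eval_blockScale (d := fun _ => 2) K.isHomogeneous_G, Finset.prod_pow, K.prod_m_div hu,
    K.h_ψ, ← eval_m] at h1
  refine mul_left_cancel₀ (pow_ne_zero 2 hu) ?_
  rw [← h1]; ring

/-- The equation of the common plane. -/
noncomputable def hPoly : MvPolynomial (Fin 4) ℂ := linForm K.h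

@[simp] theorem eval_hPoly (a : Fin 4 → ℂ) : eval a K.hPoly = K.h ⬝ᵥ a := eval_linForm _ _

theorem prime_hPoly : Prime K.hPoly := prime_linForm K.h_ne_zero

/-- The linear forms of the pencils. -/
noncomputable def pencilPoly (ℓ : Fin 3 → Fin 2 → Fin 4 → ℂ) (s : Fin 3 × Fin 2) :
    MvPolynomial (Fin 4) ℂ := linForm (ℓ s.1 s.2)

theorem eval_pencilPoly (a : Fin 4 → ℂ) :
    (fun s => eval a (pencilPoly ℓ s)) = pencilVector ℓ a := funext fun _ => eval_linForm _ _

theorem prod_wt222 (t : Fin 3 → ℂ) (s : Fin 3 × Fin 2) : ∏ i, t i ^ wt222 s i = t s.1 := by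
  simp [wt222, pow_ite]

theorem sum_wt222 {ι : Type} (s : Fin 3 × Fin 2) :
    ∑ i, wt222 s i • (fun _ : ι => 1) = fun _ => 1 := by
  funext j
  simp only [Finset.sum_apply, Pi.smul_apply, smul_eq_mul, mul_one]
  simp [wt222]

theorem forward_mem {a : Fin 4 → ℂ} (ha : eval a K.hPoly ≠ 0) :
    (fun s => eval a (pencilPoly ℓ s)) ∈ cone222 := by
  rw [eval_pencilPoly]
  exact K.pencilVector_mem_cone222 (by rwa [← eval_hPoly])

theorem eval_m_forward (a : Fin 4 → ℂ) :
    eval (fun s => eval a (pencilPoly ℓ s)) K.m = eval a K.hPoly ^ 3 := by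
  rw [eval_pencilPoly, K.eval_m_pencilVector, eval_hPoly]

theorem eval_hPoly_backward (u : Fin 3 × Fin 2 → ℂ) :
    eval (fun s => eval u (K.ψ s)) K.hPoly = eval u K.m := by
  rw [eval_hPoly, K.h_ψ, ← eval_m]

theorem eval_G_forward (a : Fin 4 → ℂ) :
    eval (fun s => eval a (pencilPoly ℓ s)) G = eval a K.hPoly ^ 2 * eval a F := by
  rw [eval_pencilPoly, K.eval_pencilVector, eval_hPoly]

theorem backward_forward {a : Fin 4 → ℂ} (ha : eval a K.hPoly ≠ 0) :
    ∃ t : Unit → ℂˣ, (t () : ℂ) = eval a K.hPoly ^ 2 ∧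
      ∀ s, eval (fun s => eval a (pencilPoly ℓ s)) (K.ψ s) = (∏ i, (t i : ℂ) ^ 1) * a s := by
  refine ⟨fun _ => Units.mk0 _ (pow_ne_zero 2 ha), rfl, fun s => ?_⟩
  rw [eval_pencilPoly, K.ψ_pencilVector]
  simp

theorem forward_backward {u : Fin 3 × Fin 2 → ℂ} (hu : eval u K.m ≠ 0) :
    ∃ t : Fin 3 → ℂˣ, (∏ i, (t i : ℂ)) = eval u K.m ^ 2 ∧
      ∀ s, eval (fun s => eval u (K.ψ s)) (pencilPoly ℓ s) = (∏ i, (t i : ℂ) ^ wt222 s i) * u s := by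
  refine ⟨fun i => Units.mk0 _ (div_ne_zero hu (K.β_ne_zero_of_m hu i)), K.prod_m_div hu,
    fun s => ?_⟩
  rw [prod_wt222 fun i => (Units.mk0 (eval u K.m / (K.β i ⬝ᵥ u)) _ : ℂ), Units.val_mk0,
    ← K.pencilVector_ψ_eq hu]
  exact eval_linForm _ _

theorem dvd_of_dvd_mul_m {σ : Type} {E P : MvPolynomial σ ℂ} {b : Fin 3 → MvPolynomial σ ℂ}
    (hb : ∀ i, Prime (b i)) (hE : ∀ i, ∃ u, eval u (b i) = 0 ∧ eval u E ≠ 0)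
    (h : E ∣ P * ∏ i, b i) : E ∣ P := by
  rw [Fin.prod_univ_three, ← mul_assoc, ← mul_assoc] at h
  choose u h0 h1 using hE
  exact dvd_of_dvd_mul_prime (hb 0) (h0 0) (h1 0) (dvd_of_dvd_mul_prime (hb 1) (h0 1) (h1 1)
    (dvd_of_dvd_mul_prime (hb 2) (h0 2) (h1 2) h))

theorem isRegularMod_G : G.IsRegularMod K.m := fun _ h =>
  dvd_of_dvd_mul_m (fun i => prime_linForm (K.β_ne_zero i))
    (fun i => (K.exists_G_ne_zero i).imp fun _ hu => ⟨(eval_linForm _ _).trans hu.1, hu.2⟩) h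

theorem isRegularMod_F : F.IsRegularMod K.hPoly := fun P h => by
  obtain ⟨a, h0, hne⟩ := K.exists_F_ne_zero
  exact dvd_of_dvd_mul_prime K.prime_hPoly ((K.eval_hPoly a).trans h0) hne h

theorem ne_zero_of_hPoly {a : Fin 4 → ℂ} (ha : eval a K.hPoly ≠ 0) : a ≠ 0 := by
  rintro rfl
  exact ha ((K.eval_hPoly 0).trans (dotProduct_zero _))

theorem isHomogeneous_hPoly : IsWeightedHomogeneous (fun (_ : Fin 4) (_ : Unit) => 1) K.hPoly
    (fun _ => 1) := isWeightedHomogeneous_linForm fun _ _ => rfl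

theorem isHomogeneous_pencilPoly (s : Fin 3 × Fin 2) :
    IsWeightedHomogeneous (fun (_ : Fin 4) (_ : Unit) => 1) (pencilPoly ℓ s)
      (∑ i, wt222 s i • fun _ => 1) := by
  rw [sum_wt222]
  exact isWeightedHomogeneous_linForm fun _ _ => rfl

theorem isHomogeneous_ψ' (s : Fin 4) : IsWeightedHomogeneous wt222 (K.ψ s)
    (∑ _i : Unit, 1 • fun _ => 1) := by
  simpa using K.isHomogeneous_ψ s

/-! ### The birational map between the ambient spaces -/

theorem exists_birational (K : PencilChart F G ℓ) :
    ∃ φ : OpenPartialHomeomorph P3.Points P1P1P1.Points, HomVariety.IsBirational φ ∧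
      φ.source = P3.basicOpen K.hPoly ∧
      ∀ (a : P3.cone) (ha : eval a.1 K.hPoly ≠ 0),
        φ (P3.point a) = P1P1P1.point ⟨fun s => eval a.1 (pencilPoly ℓ s), K.forward_mem ha⟩ := by
  obtain ⟨a₀, ha₀, -⟩ := K.exists_F_eq_zero
  obtain ⟨u₀, hu₀, -⟩ := K.exists_G_eq_zero
  have : Nonempty P3.Points := ⟨P3.point ⟨a₀, ha₀⟩⟩
  have : Nonempty P1P1P1.Points := ⟨P1P1P1.point ⟨u₀, hu₀⟩⟩
  have : Finite P3.σ := inferInstanceAs (Finite (Fin 4))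
  have : Finite P1P1P1.σ := inferInstanceAs (Finite (Fin 3 × Fin 2))
  let A : HomVariety.PolyMap P3 P1P1P1 K.hPoly :=
    ⟨pencilPoly ℓ, fun _ _ => 1, isHomogeneous_pencilPoly, fun _ _ ha => K.forward_mem ha⟩
  let B : HomVariety.PolyMap P1P1P1 P3 K.m :=
    ⟨K.ψ, fun _ _ => 1, K.isHomogeneous_ψ', fun _ _ hu => K.ψ_ne_zero hu⟩
  refine HomVariety.exists_isBirational (d := fun _ => 1) (d' := fun _ => 1)
    K.isHomogeneous_hPoly K.isWeightedHomogeneous_m A B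
    (fun a ha => ?_) (fun u hu => ?_) (fun a ha => ?_) (fun u hu => ?_) ?_ ?_
  · exact (K.eval_m_forward a.1).trans_ne (pow_ne_zero 3 ha)
  · exact (K.eval_hPoly_backward u.1).trans_ne hu
  · obtain ⟨t, -, ht⟩ := K.backward_forward ha
    exact ⟨t, ht⟩
  · obtain ⟨t, -, ht⟩ := K.forward_backward hu
    exact ⟨t, ht⟩
  · refine HomVariety.dense_basicOpen (E := 0) K.isHomogeneous_hPoly
      (fun a => map_zero _) (fun a _ ha => K.ne_zero_of_hPoly ha) fun P hP => ?_
    rw [zero_dvd_iff] at hP ⊢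
    exact (mul_eq_zero.1 hP).resolve_right K.prime_hPoly.ne_zero
  · refine HomVariety.dense_basicOpen (E := 0) K.isWeightedHomogeneous_m
      (fun a => map_zero _) (fun a _ ha => K.mem_cone222 ha) fun P hP => ?_
    rw [zero_dvd_iff] at hP ⊢
    refine (mul_eq_zero.1 hP).resolve_right (Finset.prod_ne_zero_iff.2 fun i _ => ?_)
    exact (prime_linForm (K.β_ne_zero i)).ne_zero

/-! ### The birational map between the surfaces -/

theorem dense_quarticSurface : Dense ((quarticSurface F).basicOpen K.hPoly) := by
  have : Finite (quarticSurface F).σ := inferInstanceAs (Finite (Fin 4))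
  have hE : ∀ a : (quarticSurface F).cone, eval a.1 F = 0 := fun a => a.2.2
  have hc : ∀ a : Fin 4 → ℂ, eval a F = 0 → eval a K.hPoly ≠ 0 → a ∈ (quarticSurface F).cone :=
    fun a hF ha => ⟨K.ne_zero_of_hPoly ha, hF⟩
  refine HomVariety.dense_basicOpen (X := quarticSurface F) (E := F) (d := fun _ => 1)
    K.isHomogeneous_hPoly hE ?_ ?_
  · exact hc
  · exact K.isRegularMod_F

theorem dense_surface222 : Dense ((surface222 G).basicOpen K.m) := by
  have : Finite (surface222 G).σ := inferInstanceAs (Finite (Fin 3 × Fin 2))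
  have hE : ∀ a : (surface222 G).cone, eval a.1 G = 0 := fun a => a.2.2
  have hc : ∀ a : Fin 3 × Fin 2 → ℂ, eval a G = 0 → eval a K.m ≠ 0 → a ∈ (surface222 G).cone :=
    fun a hG ha => ⟨K.mem_cone222 ha, hG⟩
  refine HomVariety.dense_basicOpen (X := surface222 G) (E := G) (d := fun _ => 1)
    K.isWeightedHomogeneous_m hE ?_ ?_
  · exact hc
  · exact K.isRegularMod_G

/-- The map between the surfaces. -/
noncomputable def surfaceForward :
    HomVariety.PolyMap (quarticSurface F) (surface222 G) K.hPoly where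
  f := pencilPoly ℓ
  deg _ _ := 1
  isHomogeneous := isHomogeneous_pencilPoly
  mem_cone a ha h :=
    ⟨K.forward_mem h, (K.eval_G_forward a).trans (mul_eq_zero_of_right _ ha.2)⟩

/-- The inverse map between the surfaces. -/
noncomputable def surfaceBackward :
    HomVariety.PolyMap (surface222 G) (quarticSurface F) K.m where
  f := K.ψ
  deg _ _ := 1
  isHomogeneous := K.isHomogeneous_ψ'
  mem_cone _ hu h := ⟨K.ψ_ne_zero h, (K.eval_F_ψ h).trans (mul_eq_zero_of_right _ hu.2)⟩

theorem exists_birational_surface (K : PencilChart F G ℓ) :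
    ∃ β : OpenPartialHomeomorph (quarticSurface F).Points (surface222 G).Points,
      HomVariety.IsBirational β ∧ β.source = (quarticSurface F).basicOpen K.hPoly ∧
      ∀ a ha, β ((quarticSurface F).point a) =
        (surface222 G).point (K.surfaceForward.coords a ha) := by
  obtain ⟨a₀, ha₀⟩ := K.exists_F_eq_zero
  obtain ⟨u₀, hu₀⟩ := K.exists_G_eq_zero
  have : Nonempty (quarticSurface F).Points := ⟨(quarticSurface F).point ⟨a₀, ha₀⟩⟩
  have : Nonempty (surface222 G).Points := ⟨(surface222 G).point ⟨u₀, hu₀⟩⟩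
  refine HomVariety.exists_isBirational (d := fun _ => 1) (d' := fun _ => 1)
    K.isHomogeneous_hPoly K.isWeightedHomogeneous_m K.surfaceForward K.surfaceBackward
    (fun a ha => ?_) (fun u hu => ?_) (fun a ha => ?_) (fun u hu => ?_)
    K.dense_quarticSurface K.dense_surface222
  · exact (K.eval_m_forward a.1).trans_ne (pow_ne_zero 3 ha)
  · exact (K.eval_hPoly_backward u.1).trans_ne hu
  · obtain ⟨t, -, ht⟩ := K.backward_forward ha
    exact ⟨t, ht⟩
  · obtain ⟨t, -, ht⟩ := K.forward_backward hu
    exact ⟨t, ht⟩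

/-! ### The birational map between the double covers -/

theorem _root_.MvPolynomial.rename_some_linForm {σ : Type} [Fintype σ] (c : σ → ℂ) :
    rename some (linForm c) = linForm fun o : Option σ => o.elim 0 c := by
  simp [linForm, Fintype.sum_option]

theorem _root_.MvPolynomial.prime_rename_some_linForm {σ : Type} [Fintype σ] {c : σ → ℂ}
    (hc : c ≠ 0) : Prime (rename some (linForm c)) := by
  rw [rename_some_linForm]
  exact prime_linForm fun h => hc (funext fun s => congrFun h (some s))

theorem _root_.MvPolynomial.eval_rename_some {σ : Type} (v : Option σ → ℂ)
    (P : MvPolynomial σ ℂ) : eval v (rename some P) = eval (fun s => v (some s)) P :=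
  eval_rename _ _ _

theorem _root_.MvPolynomial.IsWeightedHomogeneous.rename_some {σ M : Type} [AddCommMonoid M]
    {w : σ → M} {w' : Option σ → M} (hw : ∀ s, w' (some s) = w s) {P : MvPolynomial σ ℂ} {d : M}
    (hP : IsWeightedHomogeneous w P d) : IsWeightedHomogeneous w' (rename some P) d := by
  have h : rename some P = MvPolynomial.bind₁ (fun s => X (some s)) P := by
    refine MvPolynomial.funext fun v => ?_
    rw [eval_bind₁, eval_rename_some]
    simp
  rw [h]
  refine hP.bind₁ (AddMonoidHom.id M) fun s => ?_
  rw [AddMonoidHom.id_apply, ← hw]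
  exact isWeightedHomogeneous_X _ _ _

/-- The equation of a double cover. -/
noncomputable def _root_.MvPolynomial.doubleCover {σ : Type} (P : MvPolynomial σ ℂ) :
    MvPolynomial (Option σ) ℂ := X none ^ 2 - rename some P

theorem _root_.MvPolynomial.eval_doubleCover {σ : Type} (P : MvPolynomial σ ℂ)
    (v : Option σ → ℂ) :
    eval v P.doubleCover = v none ^ 2 - eval (fun s => v (some s)) P := by
  simp [doubleCover, eval_rename_some]

theorem _root_.MvPolynomial.eval_doubleCover_ne_zero {σ : Type} {P b : MvPolynomial σ ℂ}
    (h : ∃ a, eval a b = 0 ∧ eval a P ≠ 0) :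
    ∃ v, eval v (rename some b) = 0 ∧ eval v P.doubleCover ≠ 0 := by
  obtain ⟨a, h0, h1⟩ := h
  refine ⟨fun o => o.elim 0 a, ?_, ?_⟩
  · rw [eval_rename_some]; exact h0
  · rw [eval_doubleCover]; simpa using h1

/-- The map between the double covers. -/
noncomputable def coverForward (o : Option (Fin 3 × Fin 2)) : MvPolynomial (Option (Fin 4)) ℂ :=
  -- The factor is a square root of h², the ratio between the pulled back G and F.
  o.elim (X none * rename some K.hPoly) fun s => rename some (pencilPoly ℓ s)

/-- The inverse map between the double covers. -/
noncomputable def coverBackward (o : Option (Fin 4)) : MvPolynomial (Option (Fin 3 × Fin 2)) ℂ :=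
  -- Here the ratio between the pulled back F and G is the square of `K.m`.
  o.elim (X none * rename some K.m) fun s => rename some (K.ψ s)

theorem eval_coverForward (v : Option (Fin 4) → ℂ) (o : Option (Fin 3 × Fin 2)) :
    eval v (K.coverForward o) = o.elim (v none * eval (fun s => v (some s)) K.hPoly)
      fun s => eval (fun s => v (some s)) (pencilPoly ℓ s) := by
  cases o <;> simp [coverForward, eval_rename_some]

theorem eval_coverBackward (v : Option (Fin 3 × Fin 2) → ℂ) (o : Option (Fin 4)) :
    eval v (K.coverBackward o) = o.elim (v none * eval (fun s => v (some s)) K.m)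
      fun s => eval (fun s => v (some s)) (K.ψ s) := by
  cases o <;> simp [coverBackward, eval_rename_some]

/-- The weights of the double solid. -/
def solidWt (s : Option (Fin 4)) (_ : Unit) : ℕ := s.elim 2 fun _ => 1

/-- The weights of the double cover of `ℙ¹ × ℙ¹ × ℙ¹`. -/
def coverWt (s : Option (Fin 3 × Fin 2)) : Fin 3 → ℕ := s.elim (fun _ => 1) wt222

theorem isHomogeneous_coverForward (o : Option (Fin 3 × Fin 2)) :
    IsWeightedHomogeneous solidWt (K.coverForward o) (∑ i, coverWt o i • fun _ => 1) := by
  cases o with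
  | none =>
    have h := (isWeightedHomogeneous_X ℂ solidWt none).mul
      (K.isHomogeneous_hPoly.rename_some (w' := solidWt) fun s => rfl)
    rw [show ∑ i, coverWt none i • (fun _ : Unit => 1) = solidWt none + fun _ => 1 from
      funext fun j => by simp [coverWt, solidWt]]
    exact h
  | some s => exact (isHomogeneous_pencilPoly s).rename_some fun s => rfl

theorem isHomogeneous_coverBackward (o : Option (Fin 4)) :
    IsWeightedHomogeneous coverWt (K.coverBackward o) (∑ i : Unit, solidWt o i • fun _ => 1) := by
  cases o with
  | none =>
    have h := (isWeightedHomogeneous_X ℂ coverWt none).mul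
      (K.isWeightedHomogeneous_m.rename_some (w' := coverWt) fun s => rfl)
    rw [show ∑ i, solidWt none i • (fun _ : Fin 3 => 1) = coverWt none + fun _ => 1 from
      funext fun j => by simp [coverWt, solidWt]]
    exact h
  | some s => exact (K.isHomogeneous_ψ' s).rename_some fun s => rfl

theorem coverForward_mem {v : Option (Fin 4) → ℂ} (hv : v ∈ (doubleSolid F).cone)
    (h : eval v (rename some K.hPoly) ≠ 0) :
    (fun o => eval v (K.coverForward o)) ∈ (doubleCover222 G).cone := by
  rw [eval_rename_some] at h
  simp only [eval_coverForward]
  refine ⟨K.forward_mem h, (?_ : (v none * _) ^ 2 = _).trans (K.eval_G_forward _).symm⟩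
  rw [← hv.2]
  ring

theorem coverBackward_mem {v : Option (Fin 3 × Fin 2) → ℂ} (hv : v ∈ (doubleCover222 G).cone)
    (h : eval v (rename some K.m) ≠ 0) :
    (fun o => eval v (K.coverBackward o)) ∈ (doubleSolid F).cone := by
  rw [eval_rename_some] at h
  simp only [eval_coverBackward]
  refine ⟨K.ψ_ne_zero h, (?_ : (v none * _) ^ 2 = _).trans (K.eval_F_ψ h).symm⟩
  rw [← hv.2]
  ring

theorem coverBackward_coverForward {v : Option (Fin 4) → ℂ}
    (h : eval v (rename some K.hPoly) ≠ 0) : ∃ t : Unit → ℂˣ, ∀ o,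
      eval (fun o => eval v (K.coverForward o)) (K.coverBackward o) =
        (∏ i, (t i : ℂ) ^ solidWt o i) * v o := by
  rw [eval_rename_some] at h
  obtain ⟨t, ht, hs⟩ := K.backward_forward h
  refine ⟨t, fun o => ?_⟩
  rw [eval_coverBackward]
  cases o with
  | none =>
    simp only [eval_coverForward, Option.elim]
    -- The coordinate w gains h on the way there and h³ on the way back; h⁴ is the square of the
    -- scaling h² of the coordinates of ℙ³, as the weight 2 of w demands.
    rw [K.eval_m_forward]
    simp [solidWt, ht]
    ring
  | some s =>
    simp only [eval_coverForward, Option.elim]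
    exact hs s

theorem coverForward_coverBackward {v : Option (Fin 3 × Fin 2) → ℂ}
    (h : eval v (rename some K.m) ≠ 0) : ∃ t : Fin 3 → ℂˣ, ∀ o,
      eval (fun o => eval v (K.coverBackward o)) (K.coverForward o) =
        (∏ i, (t i : ℂ) ^ coverWt o i) * v o := by
  rw [eval_rename_some] at h
  obtain ⟨t, ht, hs⟩ := K.forward_backward h
  refine ⟨t, fun o => ?_⟩
  rw [eval_coverForward]
  cases o with
  | none =>
    simp only [eval_coverBackward, Option.elim]
    rw [K.eval_hPoly_backward]
    simp only [coverWt, Option.elim, pow_one]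
    rw [ht]
    ring
  | some s =>
    simp only [eval_coverBackward, Option.elim]
    exact hs s

theorem eval_hPoly_coverBackward (v : Option (Fin 3 × Fin 2) → ℂ) :
    eval (fun o => eval v (K.coverBackward o)) (rename some K.hPoly) = eval v (rename some K.m) := by
  rw [eval_rename_some, eval_rename_some]
  simp only [eval_coverBackward, Option.elim]
  exact K.eval_hPoly_backward _

theorem eval_m_coverForward (v : Option (Fin 4) → ℂ) :
    eval (fun o => eval v (K.coverForward o)) (rename some K.m) =
      eval v (rename some K.hPoly) ^ 3 := by
  rw [eval_rename_some, eval_rename_some]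
  simp only [eval_coverForward, Option.elim]
  exact K.eval_m_forward _

theorem isRegularMod_doubleCover_F : F.doubleCover.IsRegularMod (rename some K.hPoly) := by
  intro P h
  obtain ⟨v, h0, h1⟩ := eval_doubleCover_ne_zero (P := F) (b := K.hPoly) (by
    obtain ⟨a, h0, h1⟩ := K.exists_F_ne_zero
    exact ⟨a, by rwa [eval_hPoly], h1⟩)
  exact dvd_of_dvd_mul_prime (prime_rename_some_linForm K.h_ne_zero) h0 h1 h

theorem isRegularMod_doubleCover_G : G.doubleCover.IsRegularMod (rename some K.m) := by
  intro P h
  refine dvd_of_dvd_mul_m (b := fun i => rename some (linForm (K.β i)))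
    (fun i => prime_rename_some_linForm (K.β_ne_zero i)) (fun i => eval_doubleCover_ne_zero ?_) ?_
  · exact (K.exists_G_ne_zero i).imp fun _ hu => ⟨(eval_linForm _ _).trans hu.1, hu.2⟩
  · rwa [m, map_prod] at h

theorem mem_solid_cone {v : Option (Fin 4) → ℂ} (h : eval v F.doubleCover = 0)
    (hv : eval v (rename some K.hPoly) ≠ 0) : v ∈ (doubleSolid F).cone := by
  rw [eval_doubleCover, sub_eq_zero] at h
  rw [eval_rename_some, eval_hPoly] at hv
  exact ⟨fun h0 => hv ((congrArg (K.h ⬝ᵥ ·) h0).trans (dotProduct_zero _)), h⟩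

theorem mem_cover_cone {v : Option (Fin 3 × Fin 2) → ℂ} (h : eval v G.doubleCover = 0)
    (hv : eval v (rename some K.m) ≠ 0) : v ∈ (doubleCover222 G).cone := by
  rw [eval_doubleCover, sub_eq_zero] at h
  rw [eval_rename_some] at hv
  exact ⟨K.mem_cone222 hv, h⟩

theorem isHomogeneous_rename_hPoly :
    IsWeightedHomogeneous solidWt (rename some K.hPoly) (fun _ => 1) :=
  K.isHomogeneous_hPoly.rename_some fun _ => rfl

theorem isHomogeneous_rename_m :
    IsWeightedHomogeneous coverWt (rename some K.m) (fun _ => 1) :=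
  K.isWeightedHomogeneous_m.rename_some fun _ => rfl

theorem dense_doubleSolid : Dense ((doubleSolid F).basicOpen (rename some K.hPoly)) := by
  have : Finite (doubleSolid F).σ := inferInstanceAs (Finite (Option (Fin 4)))
  have hE : ∀ a : (doubleSolid F).cone, eval a.1 F.doubleCover = 0 :=
    fun a => (eval_doubleCover F a.1).trans (sub_eq_zero.2 a.2.2)
  have hc : ∀ a : Option (Fin 4) → ℂ, eval a F.doubleCover = 0 →
      eval a (rename some K.hPoly) ≠ 0 → a ∈ (doubleSolid F).cone :=
    fun _ h ha => K.mem_solid_cone h ha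
  refine HomVariety.dense_basicOpen (X := doubleSolid F) (E := F.doubleCover) (d := fun _ => 1)
    K.isHomogeneous_rename_hPoly hE ?_ ?_
  · exact hc
  · exact K.isRegularMod_doubleCover_F

theorem dense_doubleCover222 : Dense ((doubleCover222 G).basicOpen (rename some K.m)) := by
  have : Finite (doubleCover222 G).σ := inferInstanceAs (Finite (Option (Fin 3 × Fin 2)))
  have hE : ∀ a : (doubleCover222 G).cone, eval a.1 G.doubleCover = 0 :=
    fun a => (eval_doubleCover G a.1).trans (sub_eq_zero.2 a.2.2)
  have hc : ∀ a : Option (Fin 3 × Fin 2) → ℂ, eval a G.doubleCover = 0 →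
      eval a (rename some K.m) ≠ 0 → a ∈ (doubleCover222 G).cone :=
    fun _ h ha => K.mem_cover_cone h ha
  refine HomVariety.dense_basicOpen (X := doubleCover222 G) (E := G.doubleCover)
    (d := fun _ => 1) K.isHomogeneous_rename_m hE ?_ ?_
  · exact hc
  · exact K.isRegularMod_doubleCover_G

/-- The map between the double covers. -/
noncomputable def solidForward :
    HomVariety.PolyMap (doubleSolid F) (doubleCover222 G) (rename some K.hPoly) where
  f := K.coverForward
  deg _ _ := 1
  isHomogeneous := K.isHomogeneous_coverForward
  mem_cone _ ha h := K.coverForward_mem ha h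

/-- The inverse map between the double covers. -/
noncomputable def solidBackward :
    HomVariety.PolyMap (doubleCover222 G) (doubleSolid F) (rename some K.m) where
  f := K.coverBackward
  deg _ _ := 1
  isHomogeneous := K.isHomogeneous_coverBackward
  mem_cone _ ha h := K.coverBackward_mem ha h

theorem exists_birational_cover (K : PencilChart F G ℓ) :
    ∃ Φ : OpenPartialHomeomorph (doubleSolid F).Points (doubleCover222 G).Points,
      HomVariety.IsBirational Φ ∧ Φ.source = (doubleSolid F).basicOpen (rename some K.hPoly) ∧
      ∀ a ha, Φ ((doubleSolid F).point a) =
        (doubleCover222 G).point (K.solidForward.coords a ha) := by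
  obtain ⟨a₀, ha₀, hF⟩ := K.exists_F_eq_zero
  obtain ⟨u₀, hu₀, hG⟩ := K.exists_G_eq_zero
  have : Nonempty (doubleSolid F).Points :=
    ⟨(doubleSolid F).point ⟨fun o : Option (Fin 4) => o.elim 0 a₀, ha₀, by simp [hF]⟩⟩
  have : Nonempty (doubleCover222 G).Points :=
    ⟨(doubleCover222 G).point ⟨fun o : Option (Fin 3 × Fin 2) => o.elim 0 u₀, hu₀, by simp [hG]⟩⟩
  refine HomVariety.exists_isBirational (d := fun _ => 1) (d' := fun _ => 1)
    K.isHomogeneous_rename_hPoly K.isHomogeneous_rename_m K.solidForward K.solidBackward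
    (fun a ha => ?_) (fun u hu => ?_) (fun a ha => ?_) (fun u hu => ?_)
    K.dense_doubleSolid K.dense_doubleCover222
  · exact (K.eval_m_coverForward a.1).trans_ne (pow_ne_zero 3 ha)
  · exact (K.eval_hPoly_coverBackward u.1).trans_ne hu
  · exact K.coverBackward_coverForward ha
  · exact K.coverForward_coverBackward hu

/-- The correspondence given by a chart. -/
theorem correspond (K : PencilChart F G ℓ) {n : Fin 3 → Fin 4 → ℂ} {p : Fin 3 × Fin 2 → ℂ}
    (hp : ∀ i, ∃ t : ℂ, t ≠ 0 ∧ ∀ k, p (i, k) = t * (ℓ i k ⬝ᵥ n i)) :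
    Correspond ℓ (F, n) (G, p) := by
  obtain ⟨φ, hφ, hφs, hφe⟩ := K.exists_birational
  obtain ⟨β, hβ, hβs, hβe⟩ := K.exists_birational_surface
  obtain ⟨Φ, hΦ, hΦs, hΦe⟩ := K.exists_birational_cover
  refine ⟨⟨φ, hφ, fun a ha => ?_, ⟨β, hβ, fun z hz => ?_⟩, ⟨Φ, hΦ, fun z hz => ?_⟩⟩, hp⟩
  · rw [hφs] at ha
    have h := (HomVariety.point_mem_basicOpen (X := P3) K.isHomogeneous_hPoly a).1 ha
    exact ⟨⟨fun s => eval a.1 (pencilPoly ℓ s), K.forward_mem h⟩, eval_pencilPoly _, hφe a h⟩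
  · rw [hβs] at hz
    obtain ⟨a, rfl, ha⟩ := hz
    rw [hφs, hβe a ha]
    exact ⟨⟨⟨a.1, a.2.1⟩, rfl, ha⟩, (hφe ⟨a.1, a.2.1⟩ ha).symm⟩
  · rw [hΦs] at hz
    obtain ⟨a, rfl, ha⟩ := hz
    have ha' := (eval_rename_some a.1 K.hPoly).symm.trans_ne ha
    rw [hφs, hΦe a ha]
    refine ⟨⟨⟨fun s => a.1 (some s), a.2.1⟩, rfl, ha'⟩, ?_⟩
    refine Eq.trans ?_ (hφe ⟨fun s => a.1 (some s), a.2.1⟩ ha').symm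
    refine congrArg P1P1P1.point (Subtype.ext (funext fun s => ?_))
    exact K.eval_coverForward a.1 (some s)

end PencilChart

/-! ### The parameter spaces -/

theorem mem_blockCone_unit {σ : Type} {a : σ → ℂ} : a ∈ blockCone (fun _ : σ => ()) ↔ a ≠ 0 := by
  simp [blockCone, Function.ne_iff]

theorem blockCone_fst : blockCone (Prod.fst : Fin 3 × Fin 2 → Fin 3) = cone222 := by
  ext a
  refine forall_congr' fun i => ?_
  rw [Function.ne_iff]
  exact ⟨fun ⟨s, h, hs⟩ => ⟨s.2, by subst h; exact hs⟩, fun ⟨k, hk⟩ => ⟨(i, k), rfl, hk⟩⟩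

theorem mem_threeNodalQuartics_iff {x : QuarticData} : x ∈ threeNodalQuartics ↔
    x.1.IsHomogeneous 4 ∧ (∀ i, x.2 i ≠ 0) ∧ (∀ i j, i ≠ j → ∀ t : ℂ, x.2 i ≠ t • x.2 j) ∧
      HasNodesExactlyAt (fun _ => ()) x.1 x.2 := by
  refine and_congr_right fun hF => and_congr_right fun h0 => and_congr_right fun _ => ?_
  refine and_congr (forall_congr' fun i => isNode_iff (isHomogeneous_iff_blockWt.1 hF) (by simp)
    (mem_blockCone_unit.2 (h0 i)) (by simp)) (forall_congr' fun a => ?_)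
  rw [mem_blockCone_unit]
  refine forall_congr' fun _ => forall_congr' fun _ => exists_congr fun i => ?_
  exact ⟨fun ⟨t, ht⟩ => ⟨fun _ => t, ht⟩, fun ⟨t, ht⟩ => ⟨t (), ht⟩⟩

theorem mem_nodal222_iff {y : Data222} : y ∈ nodal222 ↔
    IsWeightedHomogeneous (blockWt Prod.fst) y.1 (fun _ => 2) ∧ y.2 ∈ blockCone Prod.fst ∧
      HasNodesExactlyAt Prod.fst y.1 fun _ : Unit => y.2 := by
  rw [blockCone_fst]
  refine and_congr_right fun hG => and_congr_right fun h0 => ?_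
  have h1 := isNode_iff hG (by simp) (by rwa [blockCone_fst]) (by simp)
  rw [h1, HasNodesExactlyAt, blockCone_fst]
  refine and_congr (by simp) (forall_congr' fun a => forall_congr' fun _ => forall_congr' fun _ => ?_)
  simp only [_root_.funext_iff, Prod.forall, blockScale, exists_const]

/-! ### Frames -/

/-- The matrix with the columns `r, n 0, n 1, n 2`. -/
def frame4 {R : Type*} (r : Fin 4 → R) (n : Fin 3 → Fin 4 → R) : Matrix (Fin 4) (Fin 4) R :=
  Matrix.of fun s => Fin.cons (r s) fun i => n i s

/-- The block diagonal matrix whose blocks have the columns `q (i, ·)` and `p (i, ·)`. -/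
def frame222 {R : Type*} [Zero R] (q p : Fin 3 × Fin 2 → R) :
    Matrix (Fin 3 × Fin 2) (Fin 3 × Fin 2) R :=
  Matrix.of fun s t => if t.1 = s.1 then if t.2 = 0 then q s else p s else 0

theorem frame4_mulVec (r : Fin 4 → ℂ) (n : Fin 3 → Fin 4 → ℂ) (x : Fin 4 → ℂ) :
    frame4 r n *ᵥ x = x 0 • r + ∑ i, x i.succ • n i := by
  funext s
  simp [frame4, mulVec, dotProduct, Fin.sum_univ_succ, mul_comm]

theorem frame222_mulVec (q p v : Fin 3 × Fin 2 → ℂ) (s : Fin 3 × Fin 2) :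
    (frame222 q p *ᵥ v) s = v (s.1, 0) * q s + v (s.1, 1) * p s := by
  obtain ⟨i, k⟩ := s
  simp [frame222, mulVec, dotProduct, Fintype.sum_prod_type,
    mul_comm]

theorem frame4_mulVec_stdNodes (r : Fin 4 → ℂ) (n : Fin 3 → Fin 4 → ℂ) (i : Fin 3) :
    frame4 r n *ᵥ stdNodes i = n i := by
  rw [frame4_mulVec]
  simp [stdNodes, Pi.single_apply, Fin.succ_ne_zero, eq_comm]

theorem frame222_mulVec_stdPoint (q p : Fin 3 × Fin 2 → ℂ) : frame222 q p *ᵥ stdPoint = p := by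
  funext s
  simp [frame222_mulVec, stdPoint]

theorem frame222_block {q p : Fin 3 × Fin 2 → ℂ} (s t : Fin 3 × Fin 2)
    (h : frame222 q p s t ≠ 0) : t.1 = s.1 := by
  by_contra hne
  simp [frame222, hne] at h

theorem frame4_std : frame4 (Pi.single 0 1) stdNodes = (1 : Matrix (Fin 4) (Fin 4) ℂ) := by
  ext s t
  refine Fin.cases ?_ (fun i => ?_) t
  · simp [frame4, Matrix.one_apply, Pi.single_apply]
  · simp [frame4, Matrix.one_apply, stdNodes, Pi.single_apply]

/-- The inverse of a block diagonal matrix is block diagonal. -/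
theorem Matrix.inv_block {σ ι : Type} [Fintype σ] [DecidableEq σ] {τ : σ → ι} {g : Matrix σ σ ℂ}
    (hu : IsUnit g.det) (hg : ∀ s t, g s t ≠ 0 → τ t = τ s) (s t : σ) (h : g⁻¹ s t ≠ 0) :
    τ t = τ s := by
  classical
  let ε : ι → ℂ := Pi.single (τ t) 1
  have h1 : blockScale τ ε (Pi.single t 1) = Pi.single t 1 := by
    funext u
    by_cases hut : u = t
    · subst hut; simp [blockScale, ε]
    · simp [blockScale, hut]
  -- The projection to the block of `t` commutes with `g`, so it fixes the preimage of a basis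
  -- vector of that block.
  have h2 : blockScale τ ε (g⁻¹ *ᵥ Pi.single t 1) = g⁻¹ *ᵥ Pi.single t 1 := by
    have h3 := congrArg (g⁻¹ *ᵥ ·) (mulVec_blockScale hg ε (g⁻¹ *ᵥ Pi.single t 1))
    simpa only [mulVec_mulVec, Matrix.nonsing_inv_mul _ hu, Matrix.mul_nonsing_inv _ hu,
      one_mulVec, h1] using h3
  have h3 := congrFun h2 s
  by_contra hne
  simp only [blockScale, mulVec_single_one, Matrix.col_apply, ε, Pi.single_apply,
    if_neg (Ne.symm hne), zero_mul] at h3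
  exact h h3.symm

/-! ### Reduction to the normal form -/

/-- The coefficients of the normal form of a quartic in a given frame. -/
noncomputable def quarticCoeff {R : Type*} [CommRing R] (g : Matrix (Fin 4) (Fin 4) R)
    (F : MvPolynomial (Fin 4) R) (e : Fin 3 × Fin 3 × Fin 3) : R :=
  coeff (quarticExp e) (subst g F)

/-- The coefficients of the normal form of a `(2,2,2)` form in a given frame. -/
noncomputable def coeff222 {R : Type*} [CommRing R]
    (g : Matrix (Fin 3 × Fin 2) (Fin 3 × Fin 2) R) (G : MvPolynomial (Fin 3 × Fin 2) R)
    (e : Fin 3 × Fin 3 × Fin 3) : R :=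
  coeff (exp222 e) (subst g G)

theorem subst_frame4 {F : MvPolynomial (Fin 4) ℂ} (hF : F.IsHomogeneous 4) {r : Fin 4 → ℂ}
    {n : Fin 3 → Fin 4 → ℂ} (hn : ∀ i, IsSingularAt F (n i)) (hu : IsUnit (frame4 r n).det) :
    subst (frame4 r n) F = quarticOf (quarticCoeff (frame4 r n) F) := by
  refine eq_quarticOf (IsWeightedHomogeneous.subst (fun _ _ _ => rfl) hF) fun i => ?_
  rw [isSingularAt_subst hu, frame4_mulVec_stdNodes]
  exact hn i

theorem subst_frame222 {G : MvPolynomial (Fin 3 × Fin 2) ℂ}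
    (hG : IsWeightedHomogeneous (blockWt Prod.fst) G (fun _ => 2)) {q p : Fin 3 × Fin 2 → ℂ}
    (hp : IsSingularAt G p) (hu : IsUnit (frame222 q p).det) :
    subst (frame222 q p) G = form222Of (coeff222 (frame222 q p) G) := by
  refine eq_form222Of (IsWeightedHomogeneous.subst (fun s t h => ?_) hG) ?_
  · funext i
    simp only [blockWt, frame222_block s t h]
  · rw [isSingularAt_subst hu, frame222_mulVec_stdPoint]
    exact hp

theorem coeff_quarticOf (c : Fin 3 × Fin 3 × Fin 3 → ℂ) {e : Fin 3 × Fin 3 × Fin 3}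
    (he : e ∈ exps) : coeff (quarticExp e) (quarticOf c) = c e := by
  classical
  simp [quarticOf, coeff_sum, coeff_monomial, quarticExp_injective.eq_iff, he]

theorem coeff_form222Of (c : Fin 3 × Fin 3 × Fin 3 → ℂ) {e : Fin 3 × Fin 3 × Fin 3}
    (he : e ∈ exps) : coeff (exp222 e) (form222Of c) = c e := by
  classical
  simp [form222Of, coeff_sum, coeff_monomial, exp222_injective.eq_iff, he]

theorem disc_congr {R : Type*} [CommRing R] {c c' : Fin 3 × Fin 3 × Fin 3 → R}
    (h : ∀ e ∈ exps, c e = c' e) : disc c = disc c' := by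
  simp only [disc, conics, conicDisc, h (0, 2, 2) (by decide), h (2, 0, 2) (by decide),
    h (2, 2, 0) (by decide), h (2, 1, 1) (by decide), h (1, 2, 1) (by decide),
    h (1, 1, 2) (by decide), h (2, 0, 0) (by decide), h (0, 2, 0) (by decide),
    h (0, 0, 2) (by decide), h (2, 0, 1) (by decide), h (2, 1, 0) (by decide),
    h (0, 2, 1) (by decide), h (1, 2, 0) (by decide), h (0, 1, 2) (by decide),
    h (1, 0, 2) (by decide)]

/-- With nonvanishing discriminant each side amounts to the absence of singular points in the common
affine chart. -/
theorem hasNodesExactlyAt_iff {c : Fin 3 × Fin 3 × Fin 3 → ℂ} (hc : disc c ≠ 0) :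
    HasNodesExactlyAt (fun _ => ()) (quarticOf c) stdNodes ↔
      HasNodesExactlyAt Prod.fst (form222Of c) fun _ : Unit => stdPoint := by
  constructor
  · refine fun h => hasNodesExactlyAt_form222Of hc fun x hx hs => hx ?_
    obtain ⟨i, t, rfl⟩ := h.2 x (mem_blockCone_unit.2 fun h0 => hx (congrFun h0 0)) hs
    simp [blockScale, stdNodes]
  · refine fun h => hasNodesExactlyAt_quarticOf hc fun u hu hs => hu 0 ?_
    obtain ⟨-, t, rfl⟩ := h.2 u (fun i => ⟨(i, 0), rfl, hu i⟩) hs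
    simp [blockScale, stdPoint]

/-- The three-nodal quartics with noncollinear nodes such that, in suitable coordinates, the
discriminant of the normal form does not vanish. -/
def genericQuartics : Set QuarticData :=
  {x ∈ threeNodalQuartics | ∃ r : Fin 4 → ℂ,
    (frame4 r x.2).det ≠ 0 ∧ disc (quarticCoeff (frame4 r x.2) x.1) ≠ 0}

/-- The nodal `(2,2,2)` forms such that, in suitable coordinates, the discriminant of the normal
form does not vanish. -/
def generic222 : Set Data222 :=
  {y ∈ nodal222 | ∃ q : Fin 3 × Fin 2 → ℂ,
    (frame222 q y.2).det ≠ 0 ∧ disc (coeff222 (frame222 q y.2) y.1) ≠ 0}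

theorem linearIndependent_of_det_frame4 {r : Fin 4 → ℂ} {n : Fin 3 → Fin 4 → ℂ}
    (h : (frame4 r n).det ≠ 0) : LinearIndependent ℂ n := by
  rw [Fintype.linearIndependent_iff]
  intro t ht i
  by_contra hne
  refine h (Matrix.exists_mulVec_eq_zero_iff.1 ⟨Fin.cons 0 t, fun h0 => hne ?_, ?_⟩)
  · exact congrFun h0 i.succ
  · rw [frame4_mulVec]
    simpa using ht

/-! ### Construction of the pencil chart -/

/-- The inverse of `stdMap`. -/
def stdInv (v : Fin 3 × Fin 2 → ℂ) : Fin 4 → ℂ :=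
  ![v (0, 0) * v (1, 0) * v (2, 0), v (0, 1) * v (1, 0) * v (2, 0),
    v (0, 0) * v (1, 1) * v (2, 0), v (0, 0) * v (1, 0) * v (2, 1)]

theorem stdInv_stdMap (x : Fin 4 → ℂ) : stdInv (stdMap x) = x 0 ^ 2 • x := by
  funext s
  fin_cases s <;> simp [stdInv, stdMap, -mul_eq_mul_right_iff] <;> ring

theorem stdMap_stdInv (v : Fin 3 × Fin 2 → ℂ) :
    blockScale Prod.fst (fun i => v (i, 0)) (stdMap (stdInv v)) = (∏ i, v (i, 0)) • v := by
  funext ⟨i, k⟩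
  fin_cases i <;> fin_cases k <;>
    simp [blockScale, stdInv, stdMap, Fin.prod_univ_three] <;> ring

/-- The form defining the inverse of `stdMap` in the coordinates given by the rows of `B`. -/
noncomputable def stdInvPoly (B : Matrix (Fin 3 × Fin 2) (Fin 3 × Fin 2) ℂ) :
    Fin 4 → MvPolynomial (Fin 3 × Fin 2) ℂ :=
  ![linForm (B (0, 0)) * linForm (B (1, 0)) * linForm (B (2, 0)),
    linForm (B (0, 1)) * linForm (B (1, 0)) * linForm (B (2, 0)),
    linForm (B (0, 0)) * linForm (B (1, 1)) * linForm (B (2, 0)),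
    linForm (B (0, 0)) * linForm (B (1, 0)) * linForm (B (2, 1))]

theorem eval_stdInvPoly (B : Matrix (Fin 3 × Fin 2) (Fin 3 × Fin 2) ℂ) (u : Fin 3 × Fin 2 → ℂ)
    (s : Fin 4) : eval u (stdInvPoly B s) = stdInv (B *ᵥ u) s := by
  fin_cases s <;> simp [stdInvPoly, stdInv, mulVec]

theorem isWeightedHomogeneous_stdInvPoly {B : Matrix (Fin 3 × Fin 2) (Fin 3 × Fin 2) ℂ}
    (hB : ∀ s t, B s t ≠ 0 → t.1 = s.1) (s : Fin 4) :
    IsWeightedHomogeneous wt222 (stdInvPoly B s) (fun _ => 1) := by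
  have h : ∀ a b c : Fin 2, IsWeightedHomogeneous wt222
      (linForm (B (0, a)) * linForm (B (1, b)) * linForm (B (2, c))) (fun _ => 1) := by
    intro a b c
    have hl : ∀ i k, IsWeightedHomogeneous wt222 (linForm (B (i, k))) (Pi.single i 1) :=
      fun i k => isWeightedHomogeneous_linForm fun t ht => by
        funext j
        simp [wt222, hB _ t ht, Pi.single_apply, eq_comm]
    have h3 := ((hl 0 a).mul (hl 1 b)).mul (hl 2 c)
    convert h3 using 1
    funext j
    fin_cases j <;> simp
  fin_cases s
  exacts [h 0 0 0, h 1 0 0, h 0 1 0, h 0 0 1]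

theorem exists_form222Of_ne_zero {c : Fin 3 × Fin 3 × Fin 3 → ℂ} (hc : disc c ≠ 0) (i : Fin 3) :
    ∃ v, v (i, 0) = 0 ∧ eval v (form222Of c) ≠ 0 := by
  obtain ⟨⟨h022, h202, h220⟩, -⟩ := disc_ne_zero_iff.1 hc
  -- A vertex of the face `v (i, 0) = 0`, at which only one of the three monomials with exponents
  -- (0,2,2), (2,0,2), (2,2,0) survives; their coefficients are factors of `disc`.
  refine ⟨fun s => if s.1 = i + 1 then (if s.2 = 0 then 1 else 0) else if s.2 = 0 then 0 else 1,
    by fin_cases i <;> simp, ?_⟩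
  rw [eval_form222Of]
  fin_cases i <;>
    simpa [exps, Finset.sum_filter, Fintype.sum_prod_type, Fin.sum_univ_three]

theorem exists_quarticOf_ne_zero {c : Fin 3 × Fin 3 × Fin 3 → ℂ} (hc : disc c ≠ 0) :
    ∃ x, x 0 = 0 ∧ eval x (quarticOf c) ≠ 0 := by
  obtain ⟨⟨h022, h202, h220⟩, -⟩ := disc_ne_zero_iff.1 hc
  refine ⟨![0, 1, 1, 0], rfl, ?_⟩
  rw [eval_quarticOf]
  simpa [exps, Finset.sum_filter, Fintype.sum_prod_type, Fin.sum_univ_three]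

/-- A chart from frames in which the two forms have the same normal form. -/
noncomputable def pencilChart {F : MvPolynomial (Fin 4) ℂ} {G : MvPolynomial (Fin 3 × Fin 2) ℂ}
    {ℓ : Fin 3 → Fin 2 → Fin 4 → ℂ} {A : Matrix (Fin 4) (Fin 4) ℂ}
    {B : Matrix (Fin 3 × Fin 2) (Fin 3 × Fin 2) ℂ} {c : Fin 3 × Fin 3 × Fin 3 → ℂ}
    (hA : IsUnit A.det) (hB : IsUnit B.det) (hB' : ∀ s t, B s t ≠ 0 → t.1 = s.1)
    (hF : subst A F = quarticOf c) (hG : subst B G = form222Of c) (hc : disc c ≠ 0)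
    (hGh : IsWeightedHomogeneous wt222 G (fun _ => 2))
    (hℓ : ∀ x, pencilVector ℓ (A *ᵥ x) = B *ᵥ stdMap x) : PencilChart F G ℓ :=
  have hAi : ∀ a, A *ᵥ (A⁻¹ *ᵥ a) = a := fun a => by
    rw [mulVec_mulVec, Matrix.mul_nonsing_inv _ hA, one_mulVec]
  have hBi : ∀ u, B *ᵥ (B⁻¹ *ᵥ u) = u := fun u => by
    rw [mulVec_mulVec, Matrix.mul_nonsing_inv _ hB, one_mulVec]
  have hiA : ∀ a, A⁻¹ *ᵥ (A *ᵥ a) = a := fun a => by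
    rw [mulVec_mulVec, Matrix.nonsing_inv_mul _ hA, one_mulVec]
  have hiB : ∀ u, B⁻¹ *ᵥ (B *ᵥ u) = u := fun u => by
    rw [mulVec_mulVec, Matrix.nonsing_inv_mul _ hB, one_mulVec]
  have hℓ' : ∀ a, pencilVector ℓ a = B *ᵥ stdMap (A⁻¹ *ᵥ a) := fun a => by rw [← hℓ, hAi]
  have hψ : ∀ u s, eval u (∑ t, C (A s t) * stdInvPoly B⁻¹ t) = (A *ᵥ stdInv (B⁻¹ *ᵥ u)) s :=
    fun u s => by simp [eval_stdInvPoly, mulVec, dotProduct]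
  -- The first coordinate in the frame `A`; likewise `β i` is the first coordinate of the block `i`
  -- in the frame `B`.
  { h := A⁻¹ 0
    β := fun i => B⁻¹ (i, 0)
    ψ := fun s => ∑ t, C (A s t) * stdInvPoly B⁻¹ t
    isHomogeneous_ψ := fun s => IsWeightedHomogeneous.sum _ _ _ fun t _ => by
      have h := (isWeightedHomogeneous_C wt222 (A s t)).mul
        (isWeightedHomogeneous_stdInvPoly (Matrix.inv_block hB hB') t)
      rwa [zero_add] at h
    isHomogeneous_G := hGh
    h_ne_zero := fun h => by
      have h1 := congrFun (hiA (Pi.single 0 1)) 0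
      simp [mulVec, h] at h1
    β_ne_zero := fun i h => by
      have h1 := congrFun (hiB (Pi.single (i, 0) 1)) (i, 0)
      simp [mulVec, h] at h1
    β_block := fun i s hs => by
      by_contra h
      exact hs (Matrix.inv_block hB hB' _ _ h)
    β_pencilVector := fun i a => by
      rw [hℓ']
      exact (congrFun (hiB _) (i, 0)).trans (by simp [stdMap, mulVec])
    h_ψ := fun u => by
      simp only [hψ]
      refine (congrFun (hiA _) 0).trans ?_
      simp [stdInv, mulVec, Fin.prod_univ_three]
    ψ_pencilVector := fun a s => by
      rw [hψ, hℓ', hiB, stdInv_stdMap, mulVec_smul, hAi]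
      rfl
    pencilVector_ψ := fun u s => by
      simp only [hψ, hℓ]
      have h1 := mulVec_blockScale hB' (fun i => (B⁻¹ *ᵥ u) (i, 0)) (stdMap (stdInv (B⁻¹ *ᵥ u)))
      rw [stdMap_stdInv, mulVec_smul, hBi] at h1
      exact (congrFun h1 s).symm
    eval_pencilVector := fun a => by
      rw [hℓ', ← eval_subst, hG, eval_stdMap_form222Of, ← hF, eval_subst, hAi]
      rfl
    exists_F_ne_zero := by
      obtain ⟨x, h0, h1⟩ := exists_quarticOf_ne_zero hc
      refine ⟨A *ᵥ x, (congrFun (hiA x) 0).trans h0, ?_⟩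
      rwa [← eval_subst, hF]
    exists_G_ne_zero := fun i => by
      obtain ⟨v, h0, h1⟩ := exists_form222Of_ne_zero hc i
      refine ⟨B *ᵥ v, (congrFun (hiB v) (i, 0)).trans h0, ?_⟩
      rwa [← eval_subst, hG]
    exists_F_eq_zero := by
      refine ⟨A *ᵥ stdNodes 0, fun h => ?_, ?_⟩
      · have h1 := congrFun (hiA (stdNodes 0)) 1
        rw [h, mulVec_zero] at h1
        simp [stdNodes] at h1
      · rw [← eval_subst, hF]
        exact (isSingularAt_quarticOf_stdNodes c 0).eval_eq_zero
          (isWeightedHomogeneous_quarticOf c) (i := ()) (by simp)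
    exists_G_eq_zero := by
      refine ⟨B *ᵥ stdPoint, ?_, ?_⟩
      · rw [← blockCone_fst]
        exact mulVec_mem_blockCone hB hB' fun i => ⟨(i, 1), rfl, by simp [stdPoint]⟩
      · rw [← eval_subst, hG]
        exact (isSingularAt_form222Of_stdPoint c).eval_eq_zero
          (isWeightedHomogeneous_form222Of c) (i := 0) (by simp) }

/-! ### The correspondence of the generic parameter spaces -/

/-- The values of the pencils at `r` and at the nodes form a frame of ℙ¹ × ℙ¹ × ℙ¹ in which φ
becomes `stdMap`. The form G is then forced: it has the normal form of F in that frame. -/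
theorem exists_correspond_of_mem_genericQuartics {x : QuarticData} (hx : x ∈ genericQuartics)
    {ℓ : Fin 3 → Fin 2 → Fin 4 → ℂ} (hℓ : ArePencils x.2 ℓ) :
    ∃ y ∈ generic222, Correspond ℓ x y := by
  obtain ⟨F, n⟩ := x
  obtain ⟨hxT, r, hA, hc⟩ := hx
  obtain ⟨hF, hn0, -, hns⟩ := mem_threeNodalQuartics_iff.1 hxT
  dsimp only at hA hc hF hn0 hns hℓ
  have hFc := subst_frame4 hF (fun i => (hns.1 i).1) hA.isUnit
  set c := quarticCoeff (frame4 r n) F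
  let q : Fin 3 × Fin 2 → ℂ := fun s => ℓ s.1 s.2 ⬝ᵥ r
  let p : Fin 3 × Fin 2 → ℂ := fun s => ℓ s.1 s.2 ⬝ᵥ n s.1
  have hAl : ∀ w : Fin 4 → ℂ, w ⬝ᵥ r = 0 → (∀ i, w ⬝ᵥ n i = 0) → w = 0 := by
    intro w h0 h1
    by_contra hne
    refine hA (Matrix.exists_vecMul_eq_zero_iff.1 ⟨w, hne, funext fun s => ?_⟩)
    exact Fin.cases h0 h1 s
  -- A relation in the block `i` would give a nontrivial combination of the two forms `ℓ i`
  -- vanishing at `r` and at `n i`. It vanishes at the other nodes anyway, hence on a basis.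
  have hB : (frame222 q p).det ≠ 0 := by
    intro hdet
    obtain ⟨v, hv, hv0⟩ := Matrix.exists_mulVec_eq_zero_iff.2 hdet
    refine hv (funext fun s => ?_)
    obtain ⟨i, k⟩ := s
    have hi : ∀ k, v (i, 0) * q (i, k) + v (i, 1) * p (i, k) = 0 := fun k => by
      rw [← frame222_mulVec q p v (i, k), hv0]; rfl
    let M : Matrix (Fin 2) (Fin 2) ℂ := Matrix.of fun k => ![q (i, k), p (i, k)]
    have hM : M.det ≠ 0 := by
      intro h0
      obtain ⟨w, hw, hw0⟩ := Matrix.exists_vecMul_eq_zero_iff.2 h0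
      have h1 := congrFun hw0 0
      have h2 := congrFun hw0 1
      simp only [vecMul, dotProduct, Fin.sum_univ_two, M, of_apply, cons_val_zero, cons_val_one,
        Pi.zero_apply] at h1 h2
      have hlin := Fintype.linearIndependent_iff.1 (hℓ i).1 w (hAl _ ?_ fun j => ?_)
      · exact hw (funext hlin)
      · simpa [Fin.sum_univ_two, add_dotProduct] using h1
      · by_cases hj : j = i
        · subst hj
          simpa [Fin.sum_univ_two, add_dotProduct] using h2
        · simp [Fin.sum_univ_two, add_dotProduct, (hℓ i).2 j hj]
    have hv' : (fun k => v (i, k)) = 0 := by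
      by_contra hne
      refine hM (Matrix.exists_mulVec_eq_zero_iff.1 ⟨_, hne, funext fun k => ?_⟩)
      simpa [M, mulVec, dotProduct, Fin.sum_univ_two, mul_comm] using hi k
    exact congrFun hv' k
  have hBi := Matrix.inv_block hB.isUnit frame222_block
  let G := subst (frame222 q p)⁻¹ (form222Of c)
  have hGc : subst (frame222 q p) G = form222Of c := by
    rw [subst_mul, Matrix.nonsing_inv_mul _ hB.isUnit, subst_one]
  have hG : IsWeightedHomogeneous (blockWt Prod.fst) G (fun _ => 2) :=
    (isWeightedHomogeneous_form222Of c).subst fun s t h => by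
      funext j
      simp only [blockWt, hBi s t h]
  have h4 : HasNodesExactlyAt (fun _ => ()) (quarticOf c) stdNodes := by
    rw [← hFc]
    refine HasNodesExactlyAt.subst hA.isUnit (fun _ _ _ => rfl) (fun _ _ _ => rfl) ?_
    simpa only [frame4_mulVec_stdNodes] using hns
  have h6 : HasNodesExactlyAt Prod.fst G fun _ : Unit => p := by
    have h := (hasNodesExactlyAt_iff hc).1 h4
    rw [← hGc] at h
    simpa only [frame222_mulVec_stdPoint] using h.of_subst hB.isUnit frame222_block hBi
  have hp : p ∈ blockCone Prod.fst := by
    rw [← frame222_mulVec_stdPoint q p]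
    exact mulVec_mem_blockCone hB.isUnit frame222_block fun i => ⟨(i, 1), rfl, by simp [stdPoint]⟩
  refine ⟨(G, p), ⟨mem_nodal222_iff.2 ⟨hG, hp, h6⟩, q, hB, ?_⟩, ?_⟩
  · refine (disc_congr fun e he => ?_).trans_ne hc
    exact (congrArg (coeff (exp222 e)) hGc).trans (coeff_form222Of c he)
  · refine (pencilChart hA.isUnit hB.isUnit frame222_block hFc hGc hc hG fun x => ?_).correspond
      fun i => ⟨1, one_ne_zero, fun k => (one_mul _).symm⟩
    funext ⟨i, k⟩
    rw [frame222_mulVec, frame4_mulVec]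
    simp only [pencilVector, dotProduct_add, dotProduct_smul, dotProduct_sum, stdMap, if_true,
      one_ne_zero, if_false, smul_eq_mul]
    rw [Finset.sum_eq_single i (fun j _ hj => by rw [(hℓ i).2 j hj, mul_zero]) (by simp)]

theorem stdNodes_ne_zero (i : Fin 3) : stdNodes i ≠ 0 := fun h => by
  have := congrFun h i.succ
  simp [stdNodes] at this

theorem stdNodes_ne_smul (i j : Fin 3) (hij : i ≠ j) (t : ℂ) : stdNodes i ≠ t • stdNodes j :=
  fun h => by
    have := congrFun h i.succ
    simp [stdNodes, hij] at this

theorem exists_correspond_of_mem_generic222 {y : Data222} (hy : y ∈ generic222) :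
    ∃ x ∈ genericQuartics, ∃ ℓ : Fin 3 → Fin 2 → Fin 4 → ℂ, ArePencils x.2 ℓ ∧
      Correspond ℓ x y := by
  obtain ⟨G, p⟩ := y
  obtain ⟨hyT, q, hB, hc⟩ := hy
  obtain ⟨hG, hp, hns⟩ := mem_nodal222_iff.1 hyT
  dsimp only at hB hc hG hp hns
  have hGc := subst_frame222 hG (hns.1 ()).1 hB.isUnit
  set c := coeff222 (frame222 q p) G
  have hBi := Matrix.inv_block hB.isUnit frame222_block
  have h6 : HasNodesExactlyAt Prod.fst (form222Of c) fun _ : Unit => stdPoint := by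
    rw [← hGc]
    refine HasNodesExactlyAt.subst hB.isUnit frame222_block hBi ?_
    simpa only [frame222_mulVec_stdPoint] using hns
  have h4 := (hasNodesExactlyAt_iff hc).2 h6
  have hFc : subst (1 : Matrix (Fin 4) (Fin 4) ℂ) (quarticOf c) = quarticOf c := subst_one _
  -- The forms q(i,k) x₀ + p(i,k) x_i (with x_i the coordinate of the i-th node), so that φ is
  -- `stdMap` followed by the frame of G.
  let ℓ : Fin 3 → Fin 2 → Fin 4 → ℂ := fun i k =>
    Fin.cons (q (i, k)) fun j => if j = i then p (i, k) else 0
  have hℓn : ∀ i k j, ℓ i k ⬝ᵥ stdNodes j = if j = i then p (i, k) else 0 := fun i k j => by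
    simp [stdNodes, ℓ]
  refine ⟨(quarticOf c, stdNodes), ⟨mem_threeNodalQuartics_iff.2
    ⟨isHomogeneous_iff_blockWt.2 (isWeightedHomogeneous_quarticOf c), stdNodes_ne_zero,
      stdNodes_ne_smul, h4⟩,
    Pi.single 0 1, ?_, ?_⟩, ℓ, fun i => ⟨?_, fun j hj k => ?_⟩, ?_⟩
  · simp [frame4_std]
  · refine (disc_congr fun e he => ?_).trans_ne hc
    simp only [quarticCoeff, frame4_std, hFc]
    exact coeff_quarticOf c he
  · rw [Fintype.linearIndependent_iff]
    intro w hw k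
    by_contra hne
    refine hB (Matrix.exists_vecMul_eq_zero_iff.1 ⟨fun s => if s.1 = i then w s.2 else 0,
      fun h => hne (by simpa using congrFun h (i, k)), ?_⟩)
    have h1 := congrFun hw 0
    have h2 := congrFun hw i.succ
    simp [Fin.sum_univ_two, ℓ] at h1 h2
    funext ⟨j, l⟩
    by_cases hj : j = i
    · subst hj
      fin_cases l <;>
        simpa [vecMul, dotProduct, Fintype.sum_prod_type, frame222, Finset.sum_add_distrib]
    · simp [vecMul, dotProduct, Fintype.sum_prod_type, frame222, hj]
  · rw [hℓn, if_neg hj]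
  · refine (pencilChart (A := 1) (by simp) hB.isUnit frame222_block hFc hGc hc hG
      fun x => ?_).correspond fun i => ⟨1, one_ne_zero, fun k => ?_⟩
    · funext ⟨i, k⟩
      rw [frame222_mulVec, one_mulVec]
      simp [pencilVector, dotProduct, Fin.sum_univ_succ, ℓ, stdMap, mul_comm]
    · rw [hℓn, if_pos rfl, one_mul]

/-! ### The generic sets are open -/

/-- The generic polynomial with exponents in `S`; its coefficients are variables. -/
noncomputable def genericForm {σ : Type} (κ : Type) (S : Finset (σ →₀ ℕ)) :
    MvPolynomial σ (MvPolynomial ((σ →₀ ℕ) ⊕ κ) ℂ) :=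
  ∑ m ∈ S, monomial m (X (Sum.inl m))

theorem map_genericForm {σ κ : Type} {S : Finset (σ →₀ ℕ)} {F : MvPolynomial σ ℂ}
    (hF : F.support ⊆ S) (v : κ → ℂ) :
    map (eval (Sum.elim (fun m => coeff m F) v)) (genericForm κ S) = F := by
  simp only [genericForm, map_sum, map_monomial, eval_X, Sum.elim_inl]
  exact (eq_sum_monomial_coeff (S := S) (μ := id) Function.injective_id
    fun m hm => ⟨m, hF hm, rfl⟩).symm

/-- Determinant and discriminant are formed once over the polynomial ring in the parameters and
commute with specialization. Multiplying them puts both genericity conditions into one polynomial.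
-/
theorem eval_det_mul_disc {σ κ : Type} [Fintype σ] [DecidableEq σ] {S : Finset (σ →₀ ℕ)}
    {F : MvPolynomial σ ℂ} (hF : F.support ⊆ S) (v : κ → ℂ)
    (g : Matrix σ σ (MvPolynomial ((σ →₀ ℕ) ⊕ κ) ℂ)) (μ : Fin 3 × Fin 3 × Fin 3 → σ →₀ ℕ) :
    eval (Sum.elim (fun m => coeff m F) v)
        (g.det * disc fun e => coeff (μ e) (subst g (genericForm κ S))) =
      (g.map (eval (Sum.elim (fun m => coeff m F) v))).det *
        disc fun e => coeff (μ e)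
          (subst (g.map (eval (Sum.elim (fun m => coeff m F) v))) F) := by
  rw [map_mul, map_disc, RingHom.map_det]
  simp only [← coeff_map, map_subst, map_genericForm hF]
  rfl

theorem support_subset_antidiag {σ : Type} [Fintype σ] [DecidableEq σ] {F : MvPolynomial σ ℂ}
    {d : ℕ} (hF : F.IsHomogeneous d) : F.support ⊆ Finset.univ.finsuppAntidiag d := by
  intro m hm
  have := hF (mem_support_iff.1 hm)
  rw [Finsupp.weight_apply, Finsupp.sum_fintype _ _ (by simp)] at this
  simpa [Finset.mem_finsuppAntidiag] using this

theorem isHomogeneous_of_isWeightedHomogeneous_fst {G : MvPolynomial (Fin 3 × Fin 2) ℂ}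
    (hG : IsWeightedHomogeneous (blockWt Prod.fst) G (fun _ => 2)) : G.IsHomogeneous 6 := by
  intro m hm
  have h : ∀ i : Fin 3, m (i, 0) + m (i, 1) = 2 := by
    intro i
    have := congrFun (hG hm) i
    rw [Finsupp.weight_apply, Finsupp.sum_fintype _ _ (by simp)] at this
    fin_cases i <;>
      simpa [Fintype.sum_prod_type, Fin.sum_univ_three, blockWt] using this
  rw [Finsupp.weight_apply, Finsupp.sum_fintype _ _ (by simp)]
  simp [Fintype.sum_prod_type, h]

theorem exists_isOpen_genericQuartics : ∃ I : Set (MvPolynomial ((Fin 4 →₀ ℕ) ⊕ Fin 3 × Fin 4) ℂ),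
    genericQuartics = {x ∈ threeNodalQuartics | ∃ f ∈ I, eval (quarticCoords x) f ≠ 0} := by
  let g : (Fin 4 → ℂ) → Matrix (Fin 4) (Fin 4) (MvPolynomial ((Fin 4 →₀ ℕ) ⊕ Fin 3 × Fin 4) ℂ) :=
    fun r => frame4 (fun s => C (r s)) fun i s => X (Sum.inr (i, s))
  -- One polynomial for each constant vector `r`; the existential over `r` becomes the union of the
  -- corresponding basic open sets.
  refine ⟨Set.range fun r => (g r).det * disc fun e => coeff (quarticExp e) (subst (g r)
    (genericForm _ (Finset.univ.finsuppAntidiag 4))), ?_⟩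
  ext x
  simp only [Set.exists_range_iff]
  refine and_congr_right fun hx => exists_congr fun r => ?_
  have hF := (mem_threeNodalQuartics_iff.1 hx).1
  have hg : (g r).map (eval (quarticCoords x)) = frame4 r x.2 := by
    ext s t
    refine Fin.cases ?_ (fun i => ?_) t <;> simp [g, frame4, quarticCoords]
  have h := eval_det_mul_disc (support_subset_antidiag hF) (fun s => x.2 s.1 s.2) (g r) quarticExp
  rw [← mul_ne_zero_iff, ← hg]
  exact not_congr (Eq.congr_left h.symm)

theorem exists_isOpen_generic222 :
    ∃ I : Set (MvPolynomial ((Fin 3 × Fin 2 →₀ ℕ) ⊕ Fin 3 × Fin 2) ℂ),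
      generic222 = {y ∈ nodal222 | ∃ f ∈ I, eval (coords222 y) f ≠ 0} := by
  let g : (Fin 3 × Fin 2 → ℂ) → Matrix (Fin 3 × Fin 2) (Fin 3 × Fin 2)
      (MvPolynomial ((Fin 3 × Fin 2 →₀ ℕ) ⊕ Fin 3 × Fin 2) ℂ) :=
    fun q => frame222 (fun s => C (q s)) fun s => X (Sum.inr s)
  refine ⟨Set.range fun q => (g q).det * disc fun e => coeff (exp222 e) (subst (g q)
    (genericForm _ (Finset.univ.finsuppAntidiag 6))), ?_⟩
  ext y
  simp only [Set.exists_range_iff]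
  refine and_congr_right fun hy => exists_congr fun q => ?_
  have hG := isHomogeneous_of_isWeightedHomogeneous_fst (mem_nodal222_iff.1 hy).1
  have hg : (g q).map (eval (coords222 y)) = frame222 q y.2 := by
    ext s t
    simp only [g, frame222, map_apply, of_apply]
    split_ifs <;> simp [coords222]
  have h := eval_det_mul_disc (support_subset_antidiag hG) y.2 (g q) exp222
  rw [← mul_ne_zero_iff, ← hg]
  exact not_congr (Eq.congr_left h.symm)

/-! ### The generic sets are dense -/

/-- A polynomial that vanishes along an arc near its origin vanishes at the origin. -/
theorem eval_eq_zero_of_arc {κ : Type} {c : ℂ → κ → ℂ} (hc : Continuous c) {f : MvPolynomial κ ℂ}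
    (h : ∀ᶠ t in 𝓝[≠] 0, eval (c t) f = 0) : eval (c 0) f = 0 := by
  have hcl : IsClosed {t : ℂ | eval (c t) f = 0} :=
    isClosed_eq (f.continuous_eval.comp hc) continuous_const
  exact hcl.mem_of_frequently_of_tendsto h.frequently (tendsto_id.mono_left nhdsWithin_le_nhds)

/-- The line through two polynomials. -/
noncomputable def lineThrough {σ : Type} (P P' : MvPolynomial σ ℂ) (t : ℂ) : MvPolynomial σ ℂ :=
  P + C t * (P' - P)

theorem isWeightedHomogeneous_lineThrough {σ M : Type} [AddCommMonoid M] {w : σ → M} {d : M}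
    {P P' : MvPolynomial σ ℂ} (hP : IsWeightedHomogeneous w P d)
    (hP' : IsWeightedHomogeneous w P' d) (t : ℂ) :
    IsWeightedHomogeneous w (lineThrough P P' t) d := by
  have h1 := (isWeightedHomogeneous_C w t).mul
    ((weightedHomogeneousSubmodule ℂ w d).sub_mem hP' hP)
  rw [zero_add] at h1
  exact hP.add h1

theorem eventually_hasNodesExactlyAt_lineThrough {σ ι J : Type} [Fintype σ] [Fintype ι] [Finite J]
    [DecidableEq σ] [DecidableEq ι] {τ : σ → ι} {d : ι → ℕ} (hd : ∀ i, d i ≠ 0)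
    {P P' : MvPolynomial σ ℂ} (hP : IsWeightedHomogeneous (blockWt τ) P d)
    (hP' : IsWeightedHomogeneous (blockWt τ) P' d) {n : J → σ → ℂ}
    (hc : ∀ j, n j ∈ blockCone τ) (h : HasNodesExactlyAt τ P n)
    (h' : ∀ j, IsSingularAt P' (n j)) :
    ∀ᶠ t in 𝓝 0, HasNodesExactlyAt τ (lineThrough P P' t) n := by
  have hQ : ∀ t, specialize t (rename some P + X none * rename some (P' - P)) =
      lineThrough P P' t := fun t => MvPolynomial.funext fun a => by
    rw [eval_specialize, lineThrough]
    simp [eval_rename_some]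
  have h1 := eventually_hasNodesExactlyAt hd (n := fun _ => n) (fun t => (hQ t).symm ▸
    isWeightedHomogeneous_lineThrough hP hP' t)
    (fun _ => continuous_const) hc (fun t j s => ?_) (by rwa [hQ, lineThrough, C_0, zero_mul, add_zero])
  · simpa only [hQ] using h1
  · rw [hQ, lineThrough, map_add, pderiv_C_mul, map_sub]
    simp [(h.1 j).1 s, h' j s]

/-- Along the line the discriminant is a polynomial in t that does not vanish at t = 1, so it has
finitely many zeros. It may vanish at 0, whence the punctured neighbourhood. -/
theorem eventually_disc_ne_zero (c : Fin 3 × Fin 3 × Fin 3 → ℂ) {c' : Fin 3 × Fin 3 × Fin 3 → ℂ}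
    (hc' : disc c' ≠ 0) : ∀ᶠ t in 𝓝[≠] (0 : ℂ), disc (fun e => c e + t * (c' e - c e)) ≠ 0 := by
  let D : Polynomial ℂ := disc fun e => .C (c e) + .X * .C (c' e - c e)
  have hD : ∀ t, D.eval t = disc fun e => c e + t * (c' e - c e) := fun t => by
    rw [← Polynomial.coe_evalRingHom, map_disc]
    simp
  have hD0 : D ≠ 0 := by
    rintro h
    have h1 := hD 1
    simp [h] at h1
    exact hc' h1.symm
  simp only [← hD]
  have hfin : {t | D.IsRoot t}.Finite := D.finite_setOfPred_isRoot hD0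
  have h2 : ∀ᶠ t in 𝓝[≠] (0 : ℂ), t ∉ {t | D.IsRoot t} \ {0} :=
    nhdsWithin_le_nhds ((hfin.sdiff (t := {0})).isClosed.isOpen_compl.mem_nhds (by simp))
  filter_upwards [h2, self_mem_nhdsWithin] with t ht h0 h
  exact ht ⟨h, h0⟩

/-! ### A sample normal form -/

/-- The coefficients of `x₁²x₂² + x₂²x₃² + x₁²x₃² + x₀²(x₁² + x₂² + x₃²) + 2x₀⁴`. -/
def sampleCoeff (e : Fin 3 × Fin 3 × Fin 3) : ℂ :=
  if e.1 = 1 ∨ e.2.1 = 1 ∨ e.2.2 = 1 then 0 else if e = (0, 0, 0) then 2 else 1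

theorem disc_sampleCoeff : disc sampleCoeff ≠ 0 := by
  simp [disc, Fin.prod_univ_four, conics, conicDisc, sampleCoeff]

/-- Suppose x₀ ≠ 0 at a singular point and let S = x₁² + x₂² + x₃². Then S = -4x₀², and each nonzero
x_i has x_i² = S + x₀² = -3x₀². If k of them are nonzero, 4 = 3k, which is impossible. -/
theorem hasNodesExactlyAt_sampleCoeff :
    HasNodesExactlyAt (fun _ => ()) (quarticOf sampleCoeff) stdNodes := by
  refine ⟨fun i => ⟨isSingularAt_quarticOf_stdNodes _ i, isNondegenerateAt_stdNodes
    disc_sampleCoeff i⟩, fun a _ hs => eq_smul_stdNodes_of_isSingularAt disc_sampleCoeff ?_ hs⟩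
  by_contra ha
  have h0 := hs 0
  have h1 := hs 1
  have h2 := hs 2
  have h3 := hs 3
  rw [eval_pderiv_quarticOf] at h0 h1 h2 h3
  simp [exps, Finset.sum_filter, Fintype.sum_prod_type, Fin.sum_univ_three, Fin.prod_univ_four,
    quarticExp, sampleCoeff] at h0 h1 h2 h3
  have e0 : 4 * a 0 ^ 2 + (a 1 ^ 2 + a 2 ^ 2 + a 3 ^ 2) = 0 :=
    (mul_eq_zero.1 (by linear_combination h0 : 2 * a 0 * _ = 0)).resolve_left (by simpa using ha)
  have key : ∀ x X Y Z : ℂ, 2 * (Y * x) + 2 * (x * Z) + 2 * (X * x) = 0 → x ^ 2 = 0 ∨ X + Y + Z = 0 :=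
    fun x X Y Z h => (mul_eq_zero.1 (by linear_combination h / 2 : x * (X + Y + Z) = 0)).imp_left
      fun h => by simp [h]
  have ha2 : a 0 ^ 2 ≠ 0 := pow_ne_zero 2 ha
  obtain k1 | k1 := key (a 1) (a 2 ^ 2) (a 0 ^ 2) (a 3 ^ 2) (by linear_combination h1) <;>
  obtain k2 | k2 := key (a 2) (a 1 ^ 2) (a 0 ^ 2) (a 3 ^ 2) (by linear_combination h2) <;>
  obtain k3 | k3 := key (a 3) (a 1 ^ 2) (a 0 ^ 2) (a 2 ^ 2) (by linear_combination h3) <;>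
  grind

theorem genericQuartics_nonempty : genericQuartics.Nonempty := by
  refine ⟨(quarticOf sampleCoeff, stdNodes), mem_threeNodalQuartics_iff.2
    ⟨isHomogeneous_iff_blockWt.2 (isWeightedHomogeneous_quarticOf _), stdNodes_ne_zero,
      stdNodes_ne_smul, hasNodesExactlyAt_sampleCoeff⟩, Pi.single 0 1, ?_, ?_⟩
  · simp [frame4_std]
  · refine (disc_congr fun e he => ?_).trans_ne disc_sampleCoeff
    simp only [quarticCoeff, frame4_std, subst_one]
    exact coeff_quarticOf _ he

/-! ### Lines towards the sample form -/

theorem exists_det_frame222_ne_zero {p : Fin 3 × Fin 2 → ℂ} (hp : p ∈ cone222) :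
    ∃ q, (frame222 q p).det ≠ 0 := by
  let q : Fin 3 × Fin 2 → ℂ := fun s =>
    if p (s.1, 0) = 0 then (if s.2 = 0 then 1 else 0) else if s.2 = 0 then 0 else 1
  refine ⟨q, fun h => ?_⟩
  obtain ⟨v, hv, hv0⟩ := Matrix.exists_mulVec_eq_zero_iff.2 h
  refine hv (funext fun ⟨i, k⟩ => ?_)
  have h0 := congrFun hv0 (i, 0)
  have h1 := congrFun hv0 (i, 1)
  rw [frame222_mulVec] at h0 h1
  have hi : p (i, 0) = 0 → p (i, 1) ≠ 0 := fun h0 h1 => hp i (funext fun k => by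
    fin_cases k
    exacts [h0, h1])
  have hv' : v (i, 0) = 0 ∧ v (i, 1) = 0 := by
    by_cases hp0 : p (i, 0) = 0
    · simp_all [q]
    · simp_all [q]
  fin_cases k
  exacts [hv'.1, hv'.2]

theorem continuous_coeff_lineThrough {σ : Type} (P P' : MvPolynomial σ ℂ) (m : σ →₀ ℕ) :
    Continuous fun t => coeff m (lineThrough P P' t) := by
  simp only [lineThrough, coeff_add, coeff_C_mul]
  fun_prop

/-- With the node fixed, G is joined by a line to the form whose normal form in the same frame is
the sample. All members are singular at `p`, those near G have no other singular point, and all of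
these but finitely many have nonzero discriminant. -/
theorem eval_coords222_eq_zero {f : MvPolynomial ((Fin 3 × Fin 2 →₀ ℕ) ⊕ Fin 3 × Fin 2) ℂ}
    (hf : ∀ y ∈ generic222, eval (coords222 y) f = 0) {y : Data222} (hy : y ∈ nodal222) :
    eval (coords222 y) f = 0 := by
  obtain ⟨G, p⟩ := y
  obtain ⟨hG, hp, hns⟩ := mem_nodal222_iff.1 hy
  dsimp only at hG hp hns
  obtain ⟨q, hB⟩ := exists_det_frame222_ne_zero (blockCone_fst ▸ hp)
  have hBi := Matrix.inv_block hB.isUnit frame222_block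
  let G' := subst (frame222 q p)⁻¹ (form222Of sampleCoeff)
  have hGc : subst (frame222 q p) G' = form222Of sampleCoeff := by
    rw [subst_mul, Matrix.nonsing_inv_mul _ hB.isUnit, subst_one]
  have hG' : IsWeightedHomogeneous (blockWt Prod.fst) G' (fun _ => 2) :=
    (isWeightedHomogeneous_form222Of _).subst fun s t h => by
      funext j
      simp only [blockWt, hBi s t h]
  have hs' : IsSingularAt G' p := by
    rw [← frame222_mulVec_stdPoint q p, ← isSingularAt_subst hB.isUnit, hGc]
    exact isSingularAt_form222Of_stdPoint _
  have hnodes := eventually_hasNodesExactlyAt_lineThrough (by simp) hG hG' (fun _ => hp) hns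
    fun _ => hs'
  have hdisc := eventually_disc_ne_zero (coeff222 (frame222 q p) G) disc_sampleCoeff
  have h := eval_eq_zero_of_arc (c := fun t => coords222 (lineThrough G G' t, p)) (f := f) ?_ ?_
  · simpa [lineThrough] using h
  · refine continuous_pi fun s => ?_
    rcases s with m | s
    · exact continuous_coeff_lineThrough G G' m
    · exact continuous_const
  · filter_upwards [hdisc, nhdsWithin_le_nhds hnodes] with t ht htn
    refine hf _ ⟨mem_nodal222_iff.2 ⟨?_, hp, htn⟩, q, hB, ?_⟩
    · exact isWeightedHomogeneous_lineThrough hG hG' t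
    · refine (disc_congr fun e he => ?_).trans_ne ht
      simp only [coeff222, lineThrough, map_add, map_mul, map_sub, hGc, coeff_add]
      rw [← algebraMap_eq, AlgHom.commutes, algebraMap_eq, coeff_C_mul, coeff_sub,
        coeff_form222Of _ he]

theorem exists_det_frame4_ne_zero {n : Fin 3 → Fin 4 → ℂ} (hn : LinearIndependent ℂ n) :
    ∃ r, (frame4 r n).det ≠ 0 := by
  obtain ⟨r, hr⟩ : ∃ r, r ∉ Submodule.span ℂ (Set.range n) := by
    by_contra! h
    have h1 := finrank_range_le_card (R := ℂ) n
    rw [Set.finrank, (Submodule.eq_top_iff'.2 h), finrank_top] at h1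
    simp at h1
  refine ⟨r, fun h => ?_⟩
  obtain ⟨v, hv, hv0⟩ := Matrix.exists_mulVec_eq_zero_iff.2 h
  rw [frame4_mulVec] at hv0
  have hli := linearIndependent_finCons.2 ⟨hn, hr⟩
  rw [Fintype.linearIndependent_iff] at hli
  exact hv (funext (hli v (by simpa [Fin.sum_univ_succ] using hv0)))

theorem eval_quarticCoords_eq_zero_of_linearIndependent
    {f : MvPolynomial ((Fin 4 →₀ ℕ) ⊕ Fin 3 × Fin 4) ℂ}
    (hf : ∀ x ∈ genericQuartics, eval (quarticCoords x) f = 0) {x : QuarticData}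
    (hx : x ∈ threeNodalQuartics) (hn : LinearIndependent ℂ x.2) :
    eval (quarticCoords x) f = 0 := by
  obtain ⟨F, n⟩ := x
  obtain ⟨hF, h0, hne, hns⟩ := mem_threeNodalQuartics_iff.1 hx
  dsimp only at hF h0 hne hns hn
  obtain ⟨r, hA⟩ := exists_det_frame4_ne_zero hn
  let F' := subst (frame4 r n)⁻¹ (quarticOf sampleCoeff)
  have hFc : subst (frame4 r n) F' = quarticOf sampleCoeff := by
    rw [subst_mul, Matrix.nonsing_inv_mul _ hA.isUnit, subst_one]
  have hF' : IsWeightedHomogeneous (blockWt fun _ => ()) F' (fun _ => 4) :=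
    (isWeightedHomogeneous_quarticOf _).subst fun s t h => rfl
  have hs' : ∀ i, IsSingularAt F' (n i) := fun i => by
    rw [← frame4_mulVec_stdNodes r n, ← isSingularAt_subst hA.isUnit, hFc]
    exact isSingularAt_quarticOf_stdNodes _ i
  have hnodes := eventually_hasNodesExactlyAt_lineThrough (by simp) (isHomogeneous_iff_blockWt.1 hF)
    hF' (fun i => mem_blockCone_unit.2 (h0 i)) hns hs'
  have hdisc := eventually_disc_ne_zero (quarticCoeff (frame4 r n) F) disc_sampleCoeff
  have h := eval_eq_zero_of_arc (c := fun t => quarticCoords (lineThrough F F' t, n)) (f := f) ?_ ?_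
  · simpa [lineThrough] using h
  · refine continuous_pi fun s => ?_
    rcases s with m | s
    · exact continuous_coeff_lineThrough F F' m
    · exact continuous_const
  · filter_upwards [hdisc, nhdsWithin_le_nhds hnodes] with t ht htn
    refine hf _ ⟨mem_threeNodalQuartics_iff.2 ⟨?_, h0, hne, htn⟩, r, hA, ?_⟩
    · exact isHomogeneous_iff_blockWt.2
        (isWeightedHomogeneous_lineThrough (isHomogeneous_iff_blockWt.1 hF) hF' t)
    · refine (disc_congr fun e he => ?_).trans_ne ht
      simp only [quarticCoeff, lineThrough, map_add, map_mul, map_sub, hFc, coeff_add]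
      rw [← algebraMap_eq, AlgHom.commutes, algebraMap_eq, coeff_C_mul, coeff_sub,
        coeff_quarticOf _ he]

/-! ### Deformation of collinear nodes -/

/-- Product rule. Singularity of a product can thereby be checked by counting the factors that
vanish at the point. -/
theorem isSingularAt_of_mem_sq {σ : Type} {a : σ → ℂ} {P : MvPolynomial σ ℂ}
    (h : P ∈ RingHom.ker (eval a) ^ 2) : IsSingularAt P a := by
  intro s
  rw [pow_two] at h
  refine Submodule.mul_induction_on h (fun x hx y hy => ?_) fun x y hx hy => ?_
  · rw [pderiv_mul, map_add, map_mul, map_mul, (RingHom.mem_ker).1 hx, (RingHom.mem_ker).1 hy]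
    simp
  · rw [map_add, map_add, hx, hy, add_zero]

theorem Ideal.mul_pow_mem_pow_add {R : Type*} [CommRing R] {I : Ideal R} {x y : R} {n : ℕ}
    (hx : x ∈ I ^ n) (hy : y ∈ I) (k : ℕ) : x * y ^ k ∈ I ^ (n + k) := by
  rw [pow_add]
  exact Ideal.mul_mem_mul hx (Ideal.pow_mem_pow hy k)

/-- Three points, which are collinear for `t = 0` only. -/
def arcNodes (α β t : ℂ) : Fin 3 → Fin 4 → ℂ :=
  ![![0, 0, 1, 0], ![0, 0, 0, 1], ![0, t, α, β]]

/-- A quartic form has a deformation with singular points at `arcNodes`. -/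
def IsDeformable (α β : ℂ) (P : MvPolynomial (Fin 4) ℂ) : Prop :=
  ∃ Q : MvPolynomial (Option (Fin 4)) ℂ, specialize 0 Q = P ∧
    (∀ t, (specialize t Q).IsHomogeneous 4) ∧
    ∀ t j, IsSingularAt (specialize t Q) (arcNodes α β t j)

theorem IsDeformable.of_specialize {α β : ℂ} {P : MvPolynomial (Fin 4) ℂ}
    {Q : MvPolynomial (Option (Fin 4)) ℂ} {R : ℂ → MvPolynomial (Fin 4) ℂ}
    (hQ : ∀ t, specialize t Q = R t) (h0 : R 0 = P) (h1 : ∀ t, (R t).IsHomogeneous 4)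
    (h2 : ∀ t j, IsSingularAt (R t) (arcNodes α β t j)) : IsDeformable α β P :=
  ⟨Q, (hQ 0).trans h0, fun t => by rw [hQ]; exact h1 t, fun t j => by rw [hQ]; exact h2 t j⟩

theorem specialize_add {σ : Type} (t : ℂ) (P Q : MvPolynomial (Option σ) ℂ) :
    specialize t (P + Q) = specialize t P + specialize t Q := map_add _ _ _

theorem specialize_mul {σ : Type} (t : ℂ) (P Q : MvPolynomial (Option σ) ℂ) :
    specialize t (P * Q) = specialize t P * specialize t Q := map_mul _ _ _

theorem specialize_C {σ : Type} (t a : ℂ) :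
    specialize t (C a : MvPolynomial (Option σ) ℂ) = C a := bind₁_C_right _ _

theorem IsDeformable.add {α β : ℂ} {P P' : MvPolynomial (Fin 4) ℂ} (h : IsDeformable α β P)
    (h' : IsDeformable α β P') : IsDeformable α β (P + P') := by
  obtain ⟨Q, h0, h1, h2⟩ := h
  obtain ⟨Q', h0', h1', h2'⟩ := h'
  refine ⟨Q + Q', by rw [specialize_add, h0, h0'], fun t => ?_, fun t j s => ?_⟩
  · rw [specialize_add]
    exact (h1 t).add (h1' t)
  · rw [specialize_add, map_add, map_add, h2 t j s, h2' t j s, add_zero]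

theorem IsDeformable.C_mul {α β : ℂ} {P : MvPolynomial (Fin 4) ℂ} (h : IsDeformable α β P)
    (a : ℂ) : IsDeformable α β (C a * P) := by
  obtain ⟨Q, h0, h1, h2⟩ := h
  refine ⟨C a * Q, by rw [specialize_mul, specialize_C, h0], fun t => ?_, fun t j s => ?_⟩
  · rw [specialize_mul, specialize_C]
    exact (h1 t).C_mul a
  · rw [specialize_mul, specialize_C, pderiv_C_mul, map_mul, h2 t j s, mul_zero]

theorem isDeformable_zero (α β : ℂ) : IsDeformable α β 0 :=
  ⟨0, map_zero _, fun t => by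
    rw [show specialize t (0 : MvPolynomial (Option (Fin 4)) ℂ) = 0 from map_zero _]
    exact isHomogeneous_zero _ _ _, fun t j s => by
    rw [show specialize t (0 : MvPolynomial (Option (Fin 4)) ℂ) = 0 from map_zero _]
    simp⟩

/-- The exponent of X₁ is distributed over three linear forms, each vanishing at two of the three
nodes. The inequalities say that the total order of vanishing is at least 2 at each node. -/
theorem exists_exponents {i j k l : ℕ} (hd : l + k + i + j = 4) (h : 2 ≤ l + k) :
    ∃ k₁ k₂ k₃, k₁ + k₂ + k₃ = k ∧ 2 ≤ j + l + k₁ + k₂ ∧ 2 ≤ i + l + k₁ + k₃ ∧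
      2 ≤ l + k₂ + k₃ := by
  by_cases hl : 2 ≤ l
  · exact ⟨k, 0, 0, by omega⟩
  by_cases hl1 : l = 1
  · by_cases hi : 1 ≤ i
    · exact ⟨k - 1, 1, 0, by omega⟩
    by_cases hj : 1 ≤ j
    · exact ⟨k - 1, 0, 1, by omega⟩
    · exact ⟨k - 1, 1, 0, by omega⟩
  by_cases hi : 2 ≤ i
  · exact ⟨k - 2, 2, 0, by omega⟩
  by_cases hij : i = 1 ∧ 1 ≤ j
  · exact ⟨k - 2, 1, 1, by omega⟩
  by_cases hi1 : i = 1
  · exact ⟨k - 2, 2, 0, by omega⟩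
  by_cases hj : 1 ≤ j
  · exact ⟨k - 2, 0, 2, by omega⟩
  · exact ⟨k - 2, 2, 0, by omega⟩

/-- The factors X₁ are replaced by X₁ itself, X₁ - (t/β)X₃ and X₁ - (t/α)X₂. Each vanishes at two of
the points of `arcNodes α β t` for all t and equals X₁ at t = 0. -/
theorem isDeformable_monomial {α β : ℂ} (hα : α ≠ 0) (hβ : β ≠ 0) {i j k l : ℕ}
    (hd : l + k + i + j = 4) (h : 2 ≤ l + k) :
    IsDeformable α β (X 0 ^ l * X 1 ^ k * X 2 ^ i * X 3 ^ j) := by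
  obtain ⟨k₁, k₂, k₃, rfl, h0, h1, h2⟩ := exists_exponents hd h
  let R : ℂ → MvPolynomial (Fin 4) ℂ := fun t => X 0 ^ l * X 1 ^ k₁ *
    (X 1 - C (β⁻¹ * t) * X 3) ^ k₂ * (X 1 - C (α⁻¹ * t) * X 2) ^ k₃ * X 2 ^ i * X 3 ^ j
  have hQ : ∀ t, specialize t (X (some 0) ^ l * X (some 1) ^ k₁ *
      (X (some 1) - C β⁻¹ * X none * X (some 3)) ^ k₂ *
      (X (some 1) - C α⁻¹ * X none * X (some 2)) ^ k₃ * X (some 2) ^ i * X (some 3) ^ j) = R t :=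
    fun t => by simp [specialize, R]
  refine .of_specialize hQ ?_ (fun t => ?_) fun t u => isSingularAt_of_mem_sq ?_
  · simp only [R, mul_zero, C_0, zero_mul, sub_zero]
    ring
  · have h3 : ∀ (a : ℂ) (s : Fin 4), (X 1 - C a * X s : MvPolynomial (Fin 4) ℂ).IsHomogeneous 1 :=
      fun a s => (isHomogeneous_X _ _).sub ((isHomogeneous_X ℂ s).C_mul a)
    have h4 := ((((((isHomogeneous_X ℂ (0 : Fin 4)).pow l).mul ((isHomogeneous_X ℂ 1).pow k₁)).mul
      ((h3 (β⁻¹ * t) 3).pow k₂)).mul ((h3 (α⁻¹ * t) 2).pow k₃)).mul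
      ((isHomogeneous_X ℂ 2).pow i)).mul ((isHomogeneous_X ℂ 3).pow j)
    convert h4 using 1
    omega
  · have hone : ∀ a : Fin 4 → ℂ, (1 : MvPolynomial (Fin 4) ℂ) ∈ RingHom.ker (eval a) ^ 0 :=
      fun a => by simp
    simp only [R]
    -- The factor 1, in the zeroth power of the ideal of the point, starts the count of vanishing
    -- orders.
    rw [← one_mul (X 0 ^ l)]
    fin_cases u
    · refine Ideal.pow_le_pow_right (by omega : 2 ≤ 0 + l + k₁ + k₂ + j)
        (Ideal.mul_pow_mem_pow_add (Ideal.mul_mem_right _ _ (Ideal.mul_mem_right _ _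
          (Ideal.mul_pow_mem_pow_add (Ideal.mul_pow_mem_pow_add (Ideal.mul_pow_mem_pow_add
            (hone _) ?_ _) ?_ _) ?_ _))) ?_ _) <;> simp [RingHom.mem_ker, arcNodes]
    · refine Ideal.pow_le_pow_right (by omega : 2 ≤ 0 + l + k₁ + k₃ + i)
        (Ideal.mul_mem_right _ _ (Ideal.mul_pow_mem_pow_add (Ideal.mul_pow_mem_pow_add
          (Ideal.mul_mem_right _ _ (Ideal.mul_pow_mem_pow_add (Ideal.mul_pow_mem_pow_add
            (hone _) ?_ _) ?_ _)) ?_ _) ?_ _)) <;> simp [RingHom.mem_ker, arcNodes]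
    · refine Ideal.pow_le_pow_right (by omega : 2 ≤ 0 + l + k₂ + k₃)
        (Ideal.mul_mem_right _ _ (Ideal.mul_mem_right _ _ (Ideal.mul_pow_mem_pow_add
          (Ideal.mul_pow_mem_pow_add (Ideal.mul_mem_right _ _ (Ideal.mul_pow_mem_pow_add
            (hone _) ?_ _)) ?_ _) ?_ _))) <;> simp [RingHom.mem_ker, arcNodes] <;> field_simp <;> simp

/-- The constant family works: X₀ and the cubic factor both vanish at all three points for every t,
since the coordinates X₂ and X₃ of the points do not move. -/
theorem isDeformable_cubic (α β : ℂ) :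
    IsDeformable α β (X 0 * X 2 * X 3 * (C β * X 2 - C α * X 3)) := by
  have hQ : ∀ t, specialize t (X (some 0) * X (some 2) * X (some 3) *
      (C β * X (some 2) - C α * X (some 3))) =
      (X 0 * X 2 * X 3 * (C β * X 2 - C α * X 3) : MvPolynomial (Fin 4) ℂ) := fun t => by
    simp [specialize]
  refine .of_specialize hQ rfl (fun t => ?_) fun t u s => ?_
  · exact (((isHomogeneous_X ℂ (0 : Fin 4)).mul (isHomogeneous_X ℂ 2)).mul (isHomogeneous_X ℂ 3)).mul
      (((isHomogeneous_X ℂ 2).C_mul β).sub ((isHomogeneous_X ℂ 3).C_mul α))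
  · fin_cases u <;> fin_cases s <;> (simp [arcNodes, pderiv_X]; try grind)

theorem isSingularAt_sum {σ K : Type} {S : Finset K} {P : K → MvPolynomial σ ℂ} {a : σ → ℂ}
    (h : ∀ k ∈ S, IsSingularAt (P k) a) : IsSingularAt (∑ k ∈ S, P k) a := fun s => by
  rw [map_sum, map_sum]
  exact Finset.sum_eq_zero fun k hk => h k hk s

theorem monomial_fin_four (m : Fin 4 →₀ ℕ) (a : ℂ) :
    monomial m a = C a * (X 0 ^ m 0 * X 1 ^ m 1 * X 2 ^ m 2 * X 3 ^ m 3) := by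
  rw [monomial_eq, Finsupp.prod_fintype _ _ (fun _ => pow_zero _), Fin.prod_univ_four]

/-- The exponents of the monomials of degree at most `1` in the first two variables. -/
noncomputable def lowExp : Fin 5 ⊕ Fin 4 ⊕ Fin 4 → Fin 4 →₀ ℕ :=
  Sum.elim (fun i => Finsupp.equivFunOnFinite.symm ![0, 0, i, 4 - i])
    (Sum.elim (fun i => Finsupp.equivFunOnFinite.symm ![0, 1, i, 3 - i])
      fun i => Finsupp.equivFunOnFinite.symm ![1, 0, i, 3 - i])

theorem lowExp_injective : Function.Injective lowExp := by
  rintro (i | i | i) (j | j | j) h <;>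
  have h0 := DFunLike.congr_fun h 0 <;>
  have h1 := DFunLike.congr_fun h 1 <;>
  have h2 := DFunLike.congr_fun h 2 <;>
  simp [lowExp] at h0 h1 h2 <;> simp [Fin.ext_iff, h2]

theorem exists_low_part {P : MvPolynomial (Fin 4) ℂ} (hP : P.IsHomogeneous 4)
    (h : ∀ m ∈ P.support, m 0 + m 1 < 2) : ∃ (a : Fin 5 → ℂ) (b c : Fin 4 → ℂ),
      P = ∑ i, C (a i) * (X 2 ^ (i : ℕ) * X 3 ^ (4 - i : ℕ)) +
        (∑ i, C (b i) * (X 1 * X 2 ^ (i : ℕ) * X 3 ^ (3 - i : ℕ)) +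
          ∑ i, C (c i) * (X 0 * X 2 ^ (i : ℕ) * X 3 ^ (3 - i : ℕ))) := by
  have h1 := eq_sum_monomial_coeff (S := Finset.univ) lowExp_injective (P := P) fun m hm => ?_
  · rw [Fintype.sum_sum_type, Fintype.sum_sum_type] at h1
    refine ⟨fun i => coeff (lowExp (.inl i)) P, fun i => coeff (lowExp (.inr (.inl i))) P,
      fun i => coeff (lowExp (.inr (.inr i))) P, h1.trans ?_⟩
    simp [monomial_fin_four, lowExp]
  · have hd : m 0 + m 1 + m 2 + m 3 = 4 := by
      have := hP (mem_support_iff.1 hm)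
      rw [Finsupp.weight_apply, Finsupp.sum_fintype _ _ (by simp), Fin.sum_univ_four] at this
      simpa using this
    have hm2 := h m hm
    by_cases h0 : m 0 = 1
    · refine ⟨.inr (.inr ⟨m 2, by omega⟩), Finset.mem_univ _, ?_⟩
      ext u
      fin_cases u <;> simp [lowExp] <;> omega
    by_cases h1 : m 1 = 1
    · refine ⟨.inr (.inl ⟨m 2, by omega⟩), Finset.mem_univ _, ?_⟩
      ext u
      fin_cases u <;> simp [lowExp] <;> omega
    · refine ⟨.inl ⟨m 2, by omega⟩, Finset.mem_univ _, ?_⟩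
      ext u
      fin_cases u <;> simp [lowExp] <;> omega

/-- On the line X₀ = X₁ = 0 the quartic has three double zeros, so it vanishes there. The
coefficients of X₀ and X₁ are binary cubics vanishing at the three nodes, hence multiples of
X₂X₃(βX₂ - αX₃). The last hypothesis evaluates the coefficient of X₁ at a fourth point of the line
and so kills it. -/
theorem low_part_eq {α β : ℂ} (hα : α ≠ 0) (hβ : β ≠ 0) {P : MvPolynomial (Fin 4) ℂ}
    (hP : P.IsHomogeneous 4) (h : ∀ m ∈ P.support, m 0 + m 1 < 2)
    (hs : ∀ j, IsSingularAt P (arcNodes α β 0 j)) (h1 : eval ![0, 0, α, -β] (pderiv 1 P) = 0) :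
    ∃ b, P = C b * (X 0 * X 2 * X 3 * (C β * X 2 - C α * X 3)) := by
  obtain ⟨a, b, c, rfl⟩ := exists_low_part hP h
  have k : ∀ j s, _ := fun j s => hs j s
  have k00 := k 0 0
  have k01 := k 0 1
  have k02 := k 0 2
  have k03 := k 0 3
  have k10 := k 1 0
  have k11 := k 1 1
  have k12 := k 1 2
  have k13 := k 1 3
  have k20 := k 2 0
  have k21 := k 2 1
  have k22 := k 2 2
  clear k hs
  simp [Fin.sum_univ_succ, arcNodes, pderiv_X] at k00 k01 k02 k03 k10 k11 k12 k13 k20 k21 k22 h1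
  clear hP h
  simp only [k00, k01, k02, k03, k10, k11, k12, zero_mul, zero_add, add_zero] at k20 k21 k22 h1
  have a2 : a 2 = 0 := by simpa [hα, hβ] using k22
  -- Two coefficients of the cubic are left; the sum and the difference of its values at (α, β) and
  -- (α, -β) isolate them.
  have b1 : b 1 = 0 := by
    have : b 1 * (2 * β ^ 2 * α) = 0 := by linear_combination k21 + h1
    simpa [hα, hβ] using this
  have b2 : b 2 = 0 := by
    have : b 2 * (2 * β * α ^ 2) = 0 := by linear_combination k21 - h1
    simpa [hα, hβ] using this
  have c1 : c 1 = -(c 2 / β * α) := by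
    have : c 1 * β + c 2 * α = 0 :=
      (mul_eq_zero.1 (by linear_combination k20 : α * β * _ = 0)).resolve_left (mul_ne_zero hα hβ)
    field_simp
    linear_combination this
  refine ⟨c 2 / β, MvPolynomial.funext fun x => ?_⟩
  simp [Fin.sum_univ_succ, k00, k01, k02, k03, k10, k11, k12, k13, a2, b1, b2, c1]
  field_simp
  ring

/-- The monomials of degree at least 2 in X₀ and X₁ deform one by one. They are singular along the
whole line of nodes, so the remaining part inherits the singularity conditions and is a multiple of
a form with a constant deformation. -/
theorem isDeformable {α β : ℂ} (hα : α ≠ 0) (hβ : β ≠ 0) {P : MvPolynomial (Fin 4) ℂ}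
    (hP : P.IsHomogeneous 4) (hs : ∀ j, IsSingularAt P (arcNodes α β 0 j))
    (h1 : eval ![0, 0, α, -β] (pderiv 1 P) = 0) : IsDeformable α β P := by
  classical
  let H := ∑ m ∈ P.support with 2 ≤ m 0 + m 1, monomial m (coeff m P)
  let L := ∑ m ∈ P.support with ¬ 2 ≤ m 0 + m 1, monomial m (coeff m P)
  have hsum : H + L = P :=
    (Finset.sum_filter_add_sum_filter_not _ _ _).trans P.support_sum_monomial_coeff
  have hdeg : ∀ m ∈ P.support, m 0 + m 1 + m 2 + m 3 = 4 := fun m hm => by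
    have := hP (mem_support_iff.1 hm)
    rw [Finsupp.weight_apply, Finsupp.sum_fintype _ _ (by simp), Fin.sum_univ_four] at this
    simpa using this
  have hmon : ∀ m ∈ P.support, (monomial m (coeff m P)).IsHomogeneous 4 := fun m hm =>
    isWeightedHomogeneous_monomial _ _ _ (hP (mem_support_iff.1 hm))
  have hH : IsDeformable α β H := by
    refine Finset.sum_induction _ (IsDeformable α β) (fun _ _ => IsDeformable.add)
      (isDeformable_zero α β) fun m hm => ?_
    rw [Finset.mem_filter] at hm
    rw [monomial_fin_four]
    exact (isDeformable_monomial hα hβ (hdeg m hm.1) hm.2).C_mul _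
  have hHs : ∀ x : Fin 4 → ℂ, x 0 = 0 → x 1 = 0 → IsSingularAt H x := by
    refine fun x h0 h1 => isSingularAt_sum fun m hm => isSingularAt_of_mem_sq ?_
    rw [Finset.mem_filter] at hm
    rw [monomial_fin_four]
    refine Ideal.mul_mem_left _ _ (Ideal.mul_mem_right _ _ (Ideal.mul_mem_right _ _
      (Ideal.pow_le_pow_right hm.2 ?_)))
    refine Ideal.mul_pow_mem_pow_add (Ideal.pow_mem_pow ?_ _) ?_ _ <;>
      simpa [RingHom.mem_ker]
  have hL : ∀ x s, IsSingularAt H x → eval x (pderiv s L) = eval x (pderiv s P) := by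
    intro x s hx
    rw [← hsum, map_add, map_add, hx s, zero_add]
  have hlow : ∀ m ∈ L.support, m 0 + m 1 < 2 := fun m hm => by
    have h2 := mem_support_iff.1 hm
    simp only [L, coeff_sum, coeff_monomial, Finset.sum_ite_eq', Finset.mem_filter] at h2
    by_contra hlt
    exact h2 (if_neg fun h => h.2 (not_lt.1 hlt))
  have hLs : ∀ j, IsSingularAt L (arcNodes α β 0 j) := fun j s =>
    (hL _ s (hHs _ (by fin_cases j <;> rfl) (by fin_cases j <;> rfl))).trans (hs j s)
  obtain ⟨b, hb⟩ := low_part_eq hα hβ (P := L)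
    (IsHomogeneous.sum _ _ _ fun m hm => hmon m (Finset.mem_filter.1 hm).1) hlow hLs
    ((hL _ 1 (hHs _ rfl rfl)).trans h1)
  rw [← hsum, hb]
  exact hH.add ((isDeformable_cubic α β).C_mul b)

/-! ### Quartics with collinear nodes -/

theorem continuous_coeff_subst_specialize {σ : Type} [Fintype σ] (g : Matrix σ σ ℂ)
    (Q : MvPolynomial (Option σ) ℂ) (m : σ →₀ ℕ) :
    Continuous fun t => coeff m (subst g (specialize t Q)) := by
  classical
  induction Q using MvPolynomial.induction_on generalizing m with
  | C a => simp only [specialize_C]; exact continuous_const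
  | add p q hp hq =>
    simp only [specialize_add, map_add, coeff_add]
    exact (hp m).add (hq m)
  | mul_X p o hp =>
    simp only [specialize_mul, map_mul, coeff_mul]
    refine continuous_finsetSum _ fun k _ => (hp _).mul ?_
    cases o with
    | none =>
      simp only [specialize, bind₁_X_right, Option.elim, subst, bind₁_C_right, coeff_C]
      split_ifs
      exacts [continuous_id, continuous_const]
    | some s =>
      simp only [specialize, bind₁_X_right, Option.elim]
      exact continuous_const

theorem exists_collinear {n : Fin 3 → Fin 4 → ℂ} (h0 : ∀ i, n i ≠ 0)
    (hne : ∀ i j, i ≠ j → ∀ t : ℂ, n i ≠ t • n j) (hn : ¬ LinearIndependent ℂ n) :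
    LinearIndependent ℂ ![n 0, n 1] ∧ ∃ α β : ℂ, α ≠ 0 ∧ β ≠ 0 ∧ n 2 = α • n 0 + β • n 1 := by
  have hli : LinearIndependent ℂ ![n 0, n 1] :=
    (LinearIndependent.pair_iff' (h0 0)).2 fun t h => hne 1 0 (by decide) t h.symm
  refine ⟨hli, ?_⟩
  have hmem : n 2 ∈ Submodule.span ℂ {n 0, n 1} := by
    by_contra hnot
    refine hn ?_
    have h1 := linearIndependent_finSnoc.2 ⟨hli, by simpa [Set.pair_comm] using hnot⟩
    rwa [show Fin.snoc ![n 0, n 1] (n 2) = n by funext i; fin_cases i <;> rfl] at h1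
  obtain ⟨α, β, h⟩ := Submodule.mem_span_pair.1 hmem
  refine ⟨α, β, ?_, ?_, h.symm⟩
  · rintro rfl
    exact hne 2 1 (by decide) β (by rw [← h, zero_smul, zero_add])
  · rintro rfl
    exact hne 2 0 (by decide) α (by rw [← h, zero_smul, add_zero])

/-- The matrix with the columns `w, v, a, b`. -/
def columns (w v a b : Fin 4 → ℂ) : Matrix (Fin 4) (Fin 4) ℂ :=
  (Matrix.of ![w, v, a, b])ᵀ

theorem columns_mulVec (w v a b x : Fin 4 → ℂ) :
    columns w v a b *ᵥ x = x 0 • w + x 1 • v + x 2 • a + x 3 • b := by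
  funext s
  simp [columns, mulVec, dotProduct, Fin.sum_univ_four, mul_comm]

/-- Two independent vectors extend to a basis with a further vector in the kernel of a given linear
form that vanishes at the two vectors. -/
theorem exists_columns {a b : Fin 4 → ℂ} (hab : LinearIndependent ℂ ![a, b])
    (φ : (Fin 4 → ℂ) →ₗ[ℂ] ℂ) : ∃ w v, φ v = 0 ∧ (columns w v a b).det ≠ 0 := by
  have hcard : ∀ {k : ℕ} (f : Fin k → Fin 4 → ℂ),
      Module.finrank ℂ (Submodule.span ℂ (Set.range f)) ≤ k := fun f => by
    simpa [Set.finrank] using finrank_range_le_card (R := ℂ) f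
  obtain ⟨v, hφv, hv⟩ : ∃ v, φ v = 0 ∧ v ∉ Submodule.span ℂ (Set.range ![a, b]) := by
    by_contra! h
    -- The kernel has dimension at least 3 and cannot lie in the span of two vectors.
    have h1 : LinearMap.ker φ ≤ Submodule.span ℂ (Set.range ![a, b]) := fun v hv => h v hv
    have h2 := (Submodule.finrank_mono h1).trans (hcard _)
    have h3 := φ.finrank_range_add_finrank_ker
    have h4 := Submodule.finrank_le (LinearMap.range φ)
    simp at h3 h4
    omega
  have hv2 : LinearIndependent ℂ ![v, a, b] := linearIndependent_finCons.2 ⟨hab, hv⟩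
  obtain ⟨w, hw⟩ : ∃ w, w ∉ Submodule.span ℂ (Set.range ![v, a, b]) := by
    by_contra! h
    have h1 := hcard ![v, a, b]
    rw [Submodule.eq_top_iff'.2 h, finrank_top] at h1
    simp at h1
  have hw2 : LinearIndependent ℂ ![w, v, a, b] := linearIndependent_finCons.2 ⟨hv2, hw⟩
  refine ⟨w, v, hφv, ?_⟩
  rw [columns, det_transpose]
  exact ((Matrix.isUnit_iff_isUnit_det _).1 (Matrix.linearIndependent_rows_iff_isUnit.1 hw2)).ne_zero

theorem linearIndependent_arcNodes {α β t : ℂ} (ht : t ≠ 0) :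
    LinearIndependent ℂ (arcNodes α β t) := by
  rw [Fintype.linearIndependent_iff]
  intro c hc
  have h1 := congrFun hc 1
  have h2 := congrFun hc 2
  have h3 := congrFun hc 3
  simp [Fin.sum_univ_three, arcNodes, ht] at h1 h2 h3
  simp [h1] at h2 h3
  intro i
  fin_cases i
  exacts [h2, h3, h1]

/-- For collinear nodes, coordinates are chosen in which the nodes are `arcNodes α β 0` and the
deformation exists. For small t ≠ 0 its members have exactly three nodes, now noncollinear, where
`f` vanishes by the case already treated; continuity gives the value at t = 0. -/
theorem eval_quarticCoords_eq_zero
    {f : MvPolynomial ((Fin 4 →₀ ℕ) ⊕ Fin 3 × Fin 4) ℂ}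
    (hf : ∀ x ∈ genericQuartics, eval (quarticCoords x) f = 0) {x : QuarticData}
    (hx : x ∈ threeNodalQuartics) : eval (quarticCoords x) f = 0 := by
  by_cases hn : LinearIndependent ℂ x.2
  · exact eval_quarticCoords_eq_zero_of_linearIndependent hf hx hn
  obtain ⟨F, n⟩ := x
  obtain ⟨hF, h0, hne, hns⟩ := mem_threeNodalQuartics_iff.1 hx
  dsimp only at hF h0 hne hns hn
  obtain ⟨hab, α, β, hα, hβ, hn2⟩ := exists_collinear h0 hne hn
  -- The derivative of F along a vector at the point αn₀ - βn₁ of the line. A direction v in its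
  -- kernel, taken as second column of the frame, yields the condition at the fourth point that
  -- `isDeformable` requires.
  let φ : (Fin 4 → ℂ) →ₗ[ℂ] ℂ :=
    dotProductBilin ℂ ℂ fun s => eval (α • n 0 - β • n 1) (pderiv s F)
  obtain ⟨w, v, hφ, hdet⟩ := exists_columns hab φ
  set g := columns w v (n 0) (n 1) with hg
  have hnodes : (fun j => g *ᵥ arcNodes α β 0 j) = n := by
    funext j
    rw [hg, columns_mulVec]
    fin_cases j <;> simp [arcNodes, hn2]
  obtain ⟨Q, hQ0, hQ1, hQ2⟩ : IsDeformable α β (subst g F) := by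
    refine isDeformable hα hβ (IsWeightedHomogeneous.subst (fun _ _ _ => rfl) hF) (fun j => ?_) ?_
    · rw [isSingularAt_subst hdet.isUnit, congrFun hnodes j]
      exact (hns.1 j).1
    · have h1 : g *ᵥ ![0, 0, α, -β] = α • n 0 - β • n 1 := by
        rw [hg, columns_mulVec]
        simp [sub_eq_add_neg]
      have hg1 : ∀ s, g s 1 = v s := fun s => rfl
      simpa [pderiv_subst, h1, hg1, φ, dotProduct, mul_comm] using hφ
  have hQw : ∀ t, IsWeightedHomogeneous (blockWt fun _ => ()) (specialize t Q) (fun _ => 4) :=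
    fun t => isHomogeneous_iff_blockWt.1 (hQ1 t)
  have hev := eventually_hasNodesExactlyAt (by simp) hQw (n := fun t => arcNodes α β t)
    (fun j => ?_) (fun j => ?_) hQ2 ?_
  · have h := eval_eq_zero_of_arc (f := f)
      (c := fun t => quarticCoords (subst g⁻¹ (specialize t Q), fun j => g *ᵥ arcNodes α β t j)) ?_ ?_
    · rwa [hQ0, subst_mul, Matrix.mul_nonsing_inv _ hdet.isUnit, subst_one, hnodes] at h
    · refine continuous_pi fun s => ?_
      rcases s with m | ⟨i, s⟩
      · exact continuous_coeff_subst_specialize g⁻¹ Q m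
      · simp only [quarticCoords, Sum.elim_inr, hg, columns_mulVec]
        fin_cases i <;> simp [arcNodes] <;> fun_prop
    · filter_upwards [self_mem_nhdsWithin, nhdsWithin_le_nhds hev] with t ht htn
      have hli : LinearIndependent ℂ fun j => g *ᵥ arcNodes α β t j :=
        (linearIndependent_arcNodes ht).map' g.mulVecLin
          (LinearMap.ker_eq_bot.2 (Matrix.mulVec_injective_of_isUnit
            ((Matrix.isUnit_iff_isUnit_det _).2 hdet.isUnit)))
      refine eval_quarticCoords_eq_zero_of_linearIndependent hf
        (mem_threeNodalQuartics_iff.2 ⟨?_, fun i => hli.ne_zero i, fun i j hij u h => ?_, ?_⟩) hli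
      · exact IsWeightedHomogeneous.subst (fun _ _ _ => rfl) (hQ1 t)
      · have := (Fintype.linearIndependent_iff.1 hli (Pi.single i 1 - Pi.single j u) ?_) i
        · simp [hij] at this
        · simp only [Pi.sub_apply, sub_smul, Finset.sum_sub_distrib, Pi.single_apply, ite_smul,
            one_smul, zero_smul, Finset.sum_ite_eq', Finset.mem_univ, if_true]
          exact sub_eq_zero.2 h
      · refine HasNodesExactlyAt.of_subst hdet.isUnit (fun _ _ _ => rfl) (fun _ _ _ => rfl) ?_
        rwa [subst_mul, Matrix.nonsing_inv_mul _ hdet.isUnit, subst_one]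
  · refine continuous_pi fun s => ?_
    fin_cases j <;> fin_cases s <;> simp [arcNodes] <;> fun_prop
  · refine mem_blockCone_unit.2 fun h => ?_
    have h2 := congrFun h 2
    have h3 := congrFun h 3
    fin_cases j <;> simp [arcNodes, hα] at h2 h3
  · rw [hQ0]
    refine HasNodesExactlyAt.subst hdet.isUnit (fun _ _ _ => rfl) (fun _ _ _ => rfl) ?_
    rwa [hnodes]

/-! ### The main theorem -/

theorem mainTheorem8 :
    ∃ (U : Set QuarticData) (U' : Set Data222),
      U.Nonempty ∧
      IsZariskiDenseOpenIn quarticCoords threeNodalQuartics U ∧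
      IsZariskiDenseOpenIn coords222 nodal222 U' ∧
      (∀ x ∈ U, LinearIndependent ℂ x.2 ∧
        ∀ ℓ : Fin 3 → Fin 2 → Fin 4 → ℂ, ArePencils x.2 ℓ → ∃ y ∈ U', Correspond ℓ x y) ∧
      (∀ y ∈ U', ∃ x ∈ U, ∃ ℓ : Fin 3 → Fin 2 → Fin 4 → ℂ, ArePencils x.2 ℓ ∧
        Correspond ℓ x y) := by
  refine ⟨genericQuartics, generic222, genericQuartics_nonempty,
    ⟨exists_isOpen_genericQuartics, fun _ hf _ => eval_quarticCoords_eq_zero hf⟩,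
    ⟨exists_isOpen_generic222, fun _ hf _ => eval_coords222_eq_zero hf⟩, fun x hx => ⟨?_, fun _ =>
    exists_correspond_of_mem_genericQuartics hx⟩, fun _ => exists_correspond_of_mem_generic222⟩
  obtain ⟨-, r, hr, -⟩ := hx
  exact linearIndependent_of_det_frame4 hr
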